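/- Let $\sigma>0$ and $P\ge 0$. Consider the channel with real input $X$ and output $Y\in\{1,-1\}$, where $Y=1$ if $X+Z\in\mathcal D$ and $Y=-1$ otherwise; here $Z$ is Gaussian with mean zero and variance $\sigma^2$, independent of $X$, and the quantization region $\mathcal D\subset\mathbb R$ is a Borel set. Let $$C(P)=\sup I(X;Y),$$ where the supremum is over all Borel sets $\mathcal D\subset\mathbb R$ and all distributions of $X$ on $\mathbb R$ with $\mathsf E[X^2]\le P$. Call a distribution $\mu$ on $\mathbb R$ with $\int x^2\,d\mu(x)\le P$ capacity-achieving if, for some Borel set $\mathcal D$, the input $X\sim\mu$ gives $I(X;Y)=C(P)$. Then a capacity-achieving input distribution exists, and every capacity-achieving input distribution is discrete with at most three mass points: it is of the form $\sum_{\ell=1}^3 p_\ell\,\delta_{\xi_\ell}$ with $\xi_\ell\in\mathbb R$, $0\le p_\ell\le 1$ and $p_1+p_2+p_3=1$, where $$\sum_{\ell=1}^3 p_\ell\,\xi_\ell=0\qquad\text{and}\qquad\sum_{\ell=1}^3 p_\ell\,\xi_\ell^2=P.$$ -/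

import Mathlib

open MeasureTheory ProbabilityTheory
open scoped NNReal ENNReal

namespace OneBitChannel

noncomputable section

/-- The one-bit quantizer with quantization region `D`: it outputs `1` on `D` and `-1` off `D`. -/
def quantizer (D : Set ℝ) (y : ℝ) : ℤ :=
  open Classical in if y ∈ D then 1 else -1

/-- The joint law of `(X, Y)`, where `X` has law `μ`, the noise `Z` is independent of `X` and
Gaussian with mean zero and variance `σ ^ 2`, and `Y` is the quantized value of `X + Z`. -/
def jointLaw (σ : ℝ≥0) (D : Set ℝ) (μ : Measure ℝ) : Measure (ℝ × ℤ) :=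
  (μ.prod (gaussianReal 0 (σ ^ 2))).map fun w => (w.1, quantizer D (w.1 + w.2))

/-- The mutual information of a pair with the given joint law, in nats: the relative entropy of
the joint law with respect to the product of its marginals. -/
def mutualInfo {α β : Type*} [MeasurableSpace α] [MeasurableSpace β] (ρ : Measure (α × β)) :
    ℝ≥0∞ :=
  InformationTheory.klDiv ρ (ρ.fst.prod ρ.snd)

/-- `μ` is a probability distribution on the reals with second moment at most `P`. -/
structure IsAdmissibleInput (P : ℝ) (μ : Measure ℝ) : Prop where
  isProbabilityMeasure : IsProbabilityMeasure μ
  power_le : ∫⁻ x, ENNReal.ofReal (x ^ 2) ∂μ ≤ ENNReal.ofReal P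

/-- The capacity under the average-power constraint `P`: the supremum of `I(X; Y)` over all Borel
quantization regions and all admissible input distributions. -/
def capacity (σ : ℝ≥0) (P : ℝ) : ℝ≥0∞ :=
  ⨆ (D : Set ℝ) (_ : MeasurableSet D) (μ : Measure ℝ) (_ : IsAdmissibleInput P μ),
    mutualInfo (jointLaw σ D μ)

/-- `μ` is an admissible input distribution which, with a suitable Borel quantization region,
attains the capacity. -/
def IsCapacityAchieving (σ : ℝ≥0) (P : ℝ) (μ : Measure ℝ) : Prop :=
  IsAdmissibleInput P μ ∧
    ∃ D : Set ℝ, MeasurableSet D ∧ mutualInfo (jointLaw σ D μ) = capacity σ P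

end

end OneBitChannel

open MeasureTheory ProbabilityTheory
open scoped NNReal ENNReal BoundedContinuousFunction

namespace OneBitChannel

noncomputable section

/-! Dividing input and output by the noise deviation reduces everything to unit noise. Let `f x` be
the probability of output `1` given input `x`, and `h` the binary entropy. The mutual information is
then `h (∫ f) - ∫ h (f)`, which is linear in the joint law of the perturbation as long as `∫ f` is
kept, and convex in the channel `f`.

Convexity in the channel settles the quantizer. The gradient in the direction of a randomized
quantizer is `scoreConv`, the log-likelihood score smoothed by the normal kernel. Hence deciding by
the sign of `scoreConv` is at least as good as any randomized rule, and a rule that is nowhere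
deterministic is strictly improvable (`exists_info_lt_info_hard`). An amplified input can simulate
the original channel by adding noise at the receiver, which is such a rule; so more power strictly
helps, and an optimal input uses all of `P`. Recentering saves power, so its mean is zero.

Zero mean is a consequence of optimality and not a constraint, and this makes it rigid. Perturbing
the input density by a bounded `w` orthogonal to `1`, `x ^ 2` and `f` keeps the pair optimal, so `w`
must be orthogonal to `x` as well. By duality `x` lies in the span of `1`, `x ^ 2`, `f` almost
everywhere (`IsOpt.ae_quadratic`). Either `x` solves a fixed quadratic equation, leaving at most two
mass points, or `f` is a quadratic polynomial on the support. In the second case the score has the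
sign pattern of a quadratic, the normal kernel does not create sign changes, and the region is, up
to complement and null sets, a half-line or a bounded interval (`IsOpt.exists_interval`).

For these regions the Karush–Kuhn–Tucker conditions confine the support to the points where the
divergence touches a parabola in `x`. For a half-line, four contacts would give seven zeros of a
derivative, hence at least five solutions of an equation between the Fisher information of a sign
and a parabola; hazard rate bounds allow only four (`not_five_fisher_eq`). For an interval, the
vanishing of `scoreConv` at the endpoints turns contact into an equation with one increasing
exponential and a quadratic, and sign considerations leave at most three solutions
(`encard_interval_solutions_le`).

Existence is by compactness. Bounded power makes input laws tight, and quantizers are weakly compact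
as functions with values in the unit interval. Their responses are equicontinuous, so information
passes to the limit. The limiting quantizer may be randomized, and the convexity argument replaces
it by a deterministic one. -/

/-! ### Mutual information of a channel with binary output -/

/-- The mutual information, in nats, of an input with law `μ` and the output of the binary channel
that outputs `1` with probability `f x` when the input is `x`. -/
def info (μ : Measure ℝ) (f : ℝ → ℝ) : ℝ :=
  Real.binEntropy (∫ x, f x ∂μ) - ∫ x, Real.binEntropy (f x) ∂μ

/-- `f` is a measurable function with values in the unit interval. -/
structure IsSoftTest (f : ℝ → ℝ) : Prop where
  measurable : Measurable f
  nonneg : ∀ x, 0 ≤ f x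
  le_one : ∀ x, f x ≤ 1

namespace IsSoftTest

variable {f : ℝ → ℝ} {μ : Measure ℝ}

lemma integral_nonneg (hf : IsSoftTest f) : 0 ≤ ∫ x, f x ∂μ :=
  MeasureTheory.integral_nonneg hf.nonneg

lemma info_le_log_two (hf : IsSoftTest f) : info μ f ≤ Real.log 2 := by
  have : 0 ≤ ∫ x, Real.binEntropy (f x) ∂μ :=
    MeasureTheory.integral_nonneg fun x => Real.binEntropy_nonneg (hf.nonneg x) (hf.le_one x)
  have := Real.binEntropy_le_log_two (p := ∫ x, f x ∂μ)
  unfold info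
  linarith

variable [IsProbabilityMeasure μ]

lemma integrable (hf : IsSoftTest f) : Integrable f μ :=
  Integrable.of_bound hf.measurable.aestronglyMeasurable 1
    (ae_of_all _ fun x => by rw [Real.norm_eq_abs, abs_of_nonneg (hf.nonneg x)]; exact hf.le_one x)

lemma integrable_binEntropy (hf : IsSoftTest f) : Integrable (fun x => Real.binEntropy (f x)) μ :=
  Integrable.of_bound
    (Real.binEntropy_continuous.measurable.comp hf.measurable).aestronglyMeasurable (Real.log 2)
    (ae_of_all _ fun x => by
      rw [Real.norm_eq_abs, abs_of_nonneg (Real.binEntropy_nonneg (hf.nonneg x) (hf.le_one x))]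
      exact Real.binEntropy_le_log_two)

lemma integral_le_one (hf : IsSoftTest f) : ∫ x, f x ∂μ ≤ 1 := by
  calc ∫ x, f x ∂μ ≤ ∫ _, (1 : ℝ) ∂μ :=
        integral_mono hf.integrable (integrable_const _) hf.le_one
    _ = 1 := by simp

lemma ae_eq_zero (hf : IsSoftTest f) (h : ∫ x, f x ∂μ = 0) : ∀ᵐ x ∂μ, f x = 0 :=
  (integral_eq_zero_iff_of_nonneg hf.nonneg hf.integrable).1 h

lemma one_sub (hf : IsSoftTest f) : IsSoftTest fun x => 1 - f x where
  measurable := measurable_const.sub hf.measurable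
  nonneg x := sub_nonneg.2 (hf.le_one x)
  le_one x := by linarith [hf.nonneg x]

lemma integral_one_sub (hf : IsSoftTest f) : ∫ x, (1 - f x) ∂μ = 1 - ∫ x, f x ∂μ := by
  rw [integral_sub (integrable_const _) hf.integrable]; simp

lemma ae_eq_one (hf : IsSoftTest f) (h : ∫ x, f x ∂μ = 1) : ∀ᵐ x ∂μ, f x = 1 := by
  have := hf.one_sub.ae_eq_zero (μ := μ) (by rw [hf.integral_one_sub, h, sub_self])
  filter_upwards [this] with x hx
  linarith

lemma info_nonneg (hf : IsSoftTest f) : 0 ≤ info μ f :=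
  sub_nonneg.2 <| Real.strictConcave_binEntropy.concaveOn.le_map_integral
    Real.binEntropy_continuous.continuousOn isClosed_Icc
    (ae_of_all _ fun x => ⟨hf.nonneg x, hf.le_one x⟩) hf.integrable hf.integrable_binEntropy

end IsSoftTest

/-- The affine corrections in `klFun` cancel between the two outputs. The hypotheses are absolute
continuity of the Bernoulli law of parameter `f` with respect to that of parameter `q`, which makes
division by zero harmless. -/
lemma mul_klFun_div_add {f q : ℝ} (h0 : q = 0 → f = 0) (h1 : q = 1 → f = 1) :
    q * InformationTheory.klFun (f / q) + (1 - q) * InformationTheory.klFun ((1 - f) / (1 - q)) =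
      -Real.binEntropy f - f * Real.log q - (1 - f) * Real.log (1 - q) := by
  have key : ∀ a b : ℝ, (b = 0 → a = 0) →
      b * InformationTheory.klFun (a / b) = a * Real.log a - a * Real.log b + b - a := by
    intro a b hab
    rcases eq_or_ne b 0 with rfl | hb
    · simp [hab rfl]
    rcases eq_or_ne a 0 with rfl | ha
    · simp [InformationTheory.klFun_apply]
    · rw [InformationTheory.klFun_apply, Real.log_div ha hb]
      field_simp
  rw [key f q h0, key (1 - f) (1 - q) (fun h => by rw [h1 (by linarith)]; simp),
    Real.binEntropy, Real.log_inv, Real.log_inv]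
  ring

/-- Mutual information of a pair whose second component takes the values `1` and `-1` with
conditional probabilities `f x` and `1 - f x`. -/
lemma mutualInfo_eq_info {μ : Measure ℝ} [IsProbabilityMeasure μ] {f : ℝ → ℝ} (hf : IsSoftTest f)
    {ρ : Measure (ℝ × ℤ)} (hρ : ∀ F : ℝ × ℤ → ℝ≥0∞, Measurable F → ∫⁻ w, F w ∂ρ =
      ∫⁻ x, (ENNReal.ofReal (f x) * F (x, 1) + ENNReal.ofReal (1 - f x) * F (x, -1)) ∂μ) :
    mutualInfo ρ = ENNReal.ofReal (info μ f) := by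
  set q := ∫ x, f x ∂μ with hq
  have hq0 : 0 ≤ q := hf.integral_nonneg
  have hq1 : q ≤ 1 := hf.integral_le_one
  have hfm := hf.measurable
  have hadd : ∀ x, ENNReal.ofReal (f x) + ENNReal.ofReal (1 - f x) = 1 := fun x => by
    rw [← ENNReal.ofReal_add (hf.nonneg x) (sub_nonneg.2 (hf.le_one x))]; simp
  have hfst : ρ.fst = μ := by
    ext s hs
    rw [Measure.fst_apply hs, ← lintegral_indicator_one (measurable_fst hs),
      hρ _ (measurable_one.indicator (measurable_fst hs)), ← lintegral_indicator_one hs]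
    refine lintegral_congr fun x => ?_
    by_cases hx : x ∈ s <;> simp [Set.indicator, hx, hadd]
  have hsnd : ρ.snd = ENNReal.ofReal q • Measure.dirac 1 +
      ENNReal.ofReal (1 - q) • Measure.dirac (-1) := by
    ext s hs
    rw [Measure.snd_apply hs, ← lintegral_indicator_one (measurable_snd hs),
      hρ _ (measurable_one.indicator (measurable_snd hs)),
      show (∫⁻ x, (ENNReal.ofReal (f x) * (Prod.snd ⁻¹' s).indicator 1 (x, (1 : ℤ)) +
        ENNReal.ofReal (1 - f x) * (Prod.snd ⁻¹' s).indicator 1 (x, (-1 : ℤ))) ∂μ) =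
        ∫⁻ x, (ENNReal.ofReal (f x) * s.indicator 1 1 +
        ENNReal.ofReal (1 - f x) * s.indicator 1 (-1)) ∂μ from rfl,
      lintegral_add_left (by fun_prop),
      lintegral_mul_const _ (by fun_prop), lintegral_mul_const _ (by fun_prop),
      ← ofReal_integral_eq_lintegral_ofReal hf.integrable (ae_of_all _ hf.nonneg),
      ← ofReal_integral_eq_lintegral_ofReal hf.one_sub.integrable (ae_of_all _ hf.one_sub.nonneg),
      hf.integral_one_sub]
    simp [Set.indicator, hq]
  have hprod : ∀ F : ℝ × ℤ → ℝ≥0∞, Measurable F → ∫⁻ w, F w ∂(ρ.fst.prod ρ.snd) =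
      ∫⁻ x, (ENNReal.ofReal q * F (x, 1) + ENNReal.ofReal (1 - q) * F (x, -1)) ∂μ := by
    intro F hF
    rw [hfst, hsnd, lintegral_prod _ hF.aemeasurable]
    refine lintegral_congr fun x => ?_
    rw [lintegral_add_measure, lintegral_smul_measure, lintegral_smul_measure, lintegral_dirac,
      lintegral_dirac]
    rfl
  -- The candidate density of the joint law with respect to the product of its marginals. If `q` is
  -- `0` or `1`, one branch divides by zero, but that output then has mass zero.
  let r : ℝ × ℤ → ℝ≥0∞ := fun w =>
    if w.2 = 1 then ENNReal.ofReal (f w.1 / q) else ENNReal.ofReal ((1 - f w.1) / (1 - q))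
  have hr : Measurable r := by
    refine Measurable.ite (measurable_snd (measurableSet_singleton 1)) ?_ ?_ <;> fun_prop
  have h0 : ∀ᵐ x ∂μ, q = 0 → f x = 0 := by
    by_cases h : q = 0
    · filter_upwards [hf.ae_eq_zero h] with x hx _ using hx
    · exact ae_of_all _ fun x h' => absurd h' h
  have h1 : ∀ᵐ x ∂μ, q = 1 → f x = 1 := by
    by_cases h : q = 1
    · filter_upwards [hf.ae_eq_one h] with x hx _ using hx
    · exact ae_of_all _ fun x h' => absurd h' h
  have hρr : ρ = (ρ.fst.prod ρ.snd).withDensity r := by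
    ext s hs
    rw [withDensity_apply _ hs, ← lintegral_indicator hs, hprod _ (hr.indicator hs),
      ← lintegral_indicator_one hs, hρ _ (measurable_one.indicator hs)]
    refine lintegral_congr_ae ?_
    filter_upwards [h0, h1] with x hx0 hx1
    have e1 : ENNReal.ofReal q * ENNReal.ofReal (f x / q) = ENNReal.ofReal (f x) := by
      rw [← ENNReal.ofReal_mul hq0]
      rcases eq_or_ne q 0 with h | h
      · rw [hx0 h, h]; simp
      · rw [mul_div_cancel₀ _ h]
    have e2 : ENNReal.ofReal (1 - q) * ENNReal.ofReal ((1 - f x) / (1 - q)) =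
        ENNReal.ofReal (1 - f x) := by
      rw [← ENNReal.ofReal_mul (sub_nonneg.2 hq1)]
      rcases eq_or_ne (1 - q) 0 with h | h
      · rw [hx1 (by linarith), h]; simp
      · rw [mul_div_cancel₀ _ h]
    congr 1
    · by_cases hx : (x, (1 : ℤ)) ∈ s <;> simp [Set.indicator, hx, r, e1]
    · by_cases hx : (x, (-1 : ℤ)) ∈ s <;> simp [Set.indicator, hx, r, e2]
  have : IsFiniteMeasure ρ := ⟨by
    rw [← lintegral_one, hρ _ measurable_const]
    simp [hadd]⟩
  have hac : ρ ≪ ρ.fst.prod ρ.snd := by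
    conv_lhs => rw [hρr]
    exact withDensity_absolutelyContinuous _ _
  have hrn : ρ.rnDeriv (ρ.fst.prod ρ.snd) =ᵐ[ρ.fst.prod ρ.snd] r := by
    have := Measure.rnDeriv_withDensity (ρ.fst.prod ρ.snd) hr
    rwa [← hρr] at this
  rw [mutualInfo, InformationTheory.klDiv_eq_lintegral_klFun_of_ac hac,
    lintegral_congr_ae (g := fun w => ENNReal.ofReal (InformationTheory.klFun (r w).toReal))
      (by filter_upwards [hrn] with w hw; rw [hw]),
    hprod _ (by fun_prop)]
  have hd : Integrable (fun x => -Real.binEntropy (f x) - f x * Real.log q -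
      (1 - f x) * Real.log (1 - q)) μ :=
    (hf.integrable_binEntropy.neg.sub (hf.integrable.mul_const _)).sub
      (hf.one_sub.integrable.mul_const _)
  have hinfo : info μ f = ∫ x, (-Real.binEntropy (f x) - f x * Real.log q -
      (1 - f x) * Real.log (1 - q)) ∂μ := by
    have i1 : Integrable (fun x => -Real.binEntropy (f x)) μ := hf.integrable_binEntropy.neg
    have i2 : Integrable (fun x => f x * Real.log q) μ := hf.integrable.mul_const _
    have i3 : Integrable (fun x => -Real.binEntropy (f x) - f x * Real.log q) μ := i1.sub i2
    rw [integral_sub i3 (hf.one_sub.integrable.mul_const _), integral_sub i1 i2,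
      integral_mul_const, integral_mul_const, hf.integral_one_sub,
      integral_neg, ← hq, info, ← hq, Real.binEntropy, Real.log_inv, Real.log_inv]
    ring
  have hpt : ∀ᵐ x ∂μ, ENNReal.ofReal q * ENNReal.ofReal (InformationTheory.klFun (r (x, 1)).toReal) +
      ENNReal.ofReal (1 - q) * ENNReal.ofReal (InformationTheory.klFun (r (x, -1)).toReal) =
      ENNReal.ofReal (-Real.binEntropy (f x) - f x * Real.log q - (1 - f x) * Real.log (1 - q)) ∧
      0 ≤ -Real.binEntropy (f x) - f x * Real.log q - (1 - f x) * Real.log (1 - q) := by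
    filter_upwards [h0, h1] with x hx0 hx1
    have k1 : 0 ≤ f x / q := div_nonneg (hf.nonneg x) hq0
    have k2 : 0 ≤ (1 - f x) / (1 - q) := div_nonneg (hf.one_sub.nonneg x) (sub_nonneg.2 hq1)
    have k3 := mul_nonneg hq0 (InformationTheory.klFun_nonneg k1)
    have k4 := mul_nonneg (sub_nonneg.2 hq1) (InformationTheory.klFun_nonneg k2)
    rw [← mul_klFun_div_add hx0 hx1]
    refine ⟨?_, add_nonneg k3 k4⟩
    rw [ENNReal.ofReal_add k3 k4, ENNReal.ofReal_mul hq0, ENNReal.ofReal_mul (sub_nonneg.2 hq1)]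
    simp [r, k1, k2]
  rw [hinfo, ofReal_integral_eq_lintegral_ofReal hd (hpt.mono fun x hx => hx.2)]
  exact lintegral_congr_ae (hpt.mono fun x hx => hx.1)

/-! ### The quantized Gaussian channel as a binary-output channel -/

/-- The probability that the quantizer with region `D` outputs `1` on input `x`. -/
def crossover (σ : ℝ≥0) (D : Set ℝ) (x : ℝ) : ℝ := (gaussianReal 0 (σ ^ 2)).real {z | x + z ∈ D}

lemma isSoftTest_crossover (σ : ℝ≥0) {D : Set ℝ} (hD : MeasurableSet D) :
    IsSoftTest (crossover σ D) where
  measurable := by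
    have : MeasurableSet {w : ℝ × ℝ | w.1 + w.2 ∈ D} := (measurable_fst.add measurable_snd) hD
    exact (measurable_measure_prodMk_left this).ennreal_toReal
  nonneg _ := measureReal_nonneg
  le_one _ := measureReal_le_one

lemma mutualInfo_jointLaw (σ : ℝ≥0) {D : Set ℝ} (hD : MeasurableSet D) (μ : Measure ℝ)
    [IsProbabilityMeasure μ] :
    mutualInfo (jointLaw σ D μ) = ENNReal.ofReal (info μ (crossover σ D)) := by
  refine mutualInfo_eq_info (isSoftTest_crossover σ hD) fun F hF => ?_
  have hE : MeasurableSet {w : ℝ × ℝ | w.1 + w.2 ∈ D} := (measurable_fst.add measurable_snd) hD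
  have hq : Measurable (quantizer D) := by
    unfold quantizer
    exact Measurable.ite hD measurable_const measurable_const
  have hT : Measurable fun w : ℝ × ℝ => (w.1, quantizer D (w.1 + w.2)) :=
    measurable_fst.prodMk (hq.comp (measurable_fst.add measurable_snd))
  have hFT : Measurable fun w : ℝ × ℝ => F (w.1, quantizer D (w.1 + w.2)) := hF.comp hT
  rw [jointLaw, lintegral_map hF hT, lintegral_prod _ hFT.aemeasurable]
  refine lintegral_congr fun x => ?_
  have hA : MeasurableSet {z : ℝ | x + z ∈ D} := measurable_prodMk_left hE
  have hcompl : (gaussianReal 0 (σ ^ 2)).real {z : ℝ | x + z ∈ D}ᶜ = 1 - crossover σ D x := by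
    rw [probReal_compl_eq_one_sub hA, crossover]
  rw [← hcompl, crossover, ofReal_measureReal, ofReal_measureReal, ← lintegral_add_compl _ hA,
    setLIntegral_congr_fun (g := fun _ => F (x, 1)) hA
      (fun z (hz : x + z ∈ D) => by simp only [quantizer]; rw [if_pos hz]),
    setLIntegral_congr_fun (g := fun _ => F (x, -1)) hA.compl
      (fun z (hz : x + z ∉ D) => by simp only [quantizer]; rw [if_neg hz]),
    setLIntegral_const, setLIntegral_const, mul_comm, mul_comm (F (x, -1))]

/-! ### The normal density and responses of randomized quantizers -/

/-- The standard normal density. -/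
def npdf (y : ℝ) : ℝ := gaussianPDFReal 0 1 y

lemma npdf_eq (y : ℝ) : npdf y = (√(2 * Real.pi))⁻¹ * Real.exp (-y ^ 2 / 2) := by
  simp [npdf, gaussianPDFReal]

lemma npdf_pos (y : ℝ) : 0 < npdf y := gaussianPDFReal_pos 0 1 y one_ne_zero

lemma npdf_nonneg (y : ℝ) : 0 ≤ npdf y := (npdf_pos y).le

lemma npdf_neg (y : ℝ) : npdf (-y) = npdf y := by simp [npdf_eq]

lemma gaussianPDFReal_eq_npdf (x y : ℝ) : gaussianPDFReal x 1 y = npdf (y - x) := by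
  simp [npdf, gaussianPDFReal]

lemma hasDerivAt_npdf (y : ℝ) : HasDerivAt npdf (-y * npdf y) y := by
  have : npdf = fun y => (√(2 * Real.pi))⁻¹ * Real.exp (-y ^ 2 / 2) := funext npdf_eq
  rw [npdf_eq, this]
  have h : HasDerivAt (fun y : ℝ => -y ^ 2 / 2) (-y) y :=
    ((hasDerivAt_pow 2 y).fun_neg.div_const 2).congr_deriv (by norm_num; ring)
  exact (h.exp.const_mul _).congr_deriv (by ring)

@[fun_prop]
lemma continuous_npdf : Continuous npdf :=
  continuous_iff_continuousAt.2 fun y => (hasDerivAt_npdf y).continuousAt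

lemma integrable_npdf : Integrable npdf := integrable_gaussianPDFReal 0 1

lemma integral_npdf : ∫ y, npdf y = 1 := integral_gaussianPDFReal_eq_one 0 one_ne_zero

lemma integrable_npdf_sub (x : ℝ) : Integrable fun y => npdf (y - x) :=
  integrable_npdf.comp_sub_right x

lemma integral_npdf_sub (x : ℝ) : ∫ y, npdf (y - x) = 1 := by
  rw [integral_sub_right_eq_self npdf x, integral_npdf]

lemma npdf_le_one (y : ℝ) : npdf y ≤ 1 := by
  rw [npdf_eq]
  have h1 : 1 ≤ √(2 * Real.pi) := Real.one_le_sqrt.2 (by linarith [Real.pi_gt_three])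
  have h2 : Real.exp (-y ^ 2 / 2) ≤ 1 := Real.exp_le_one_iff.2 (by nlinarith [sq_nonneg y])
  exact mul_le_one₀ (inv_le_one_of_one_le₀ h1) (Real.exp_pos _).le h2

/-- Exponential tilting: as functions of the input `x`, the kernels at two observations differ by an
exponential. All comparisons of `scoreConv` at different points rest on this. -/
lemma npdf_sub_eq_mul (y z x : ℝ) :
    npdf (y - x) = Real.exp ((z ^ 2 - y ^ 2) / 2) * Real.exp (x * (y - z)) * npdf (z - x) := by
  rw [npdf_eq, npdf_eq, mul_left_comm, ← Real.exp_add, ← Real.exp_add]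
  congr 2
  ring

/-- The probability of a positive output on input `x` when the receiver decides for a positive
output with probability `ψ y` on observing `y`, in standard Gaussian noise. -/
def resp (ψ : ℝ → ℝ) (x : ℝ) : ℝ := ∫ y, ψ y * npdf (y - x)

lemma resp_eq_integral_gaussianReal (ψ : ℝ → ℝ) (x : ℝ) :
    resp ψ x = ∫ y, ψ y ∂(gaussianReal x 1) := by
  rw [integral_gaussianReal_eq_integral_smul one_ne_zero, resp]
  simp only [gaussianPDFReal_eq_npdf, smul_eq_mul, mul_comm]

/-- The likelihood ratio form integrates against one law for all inputs, so that responses become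
pairings in a single `L²` space. -/
lemma resp_eq_integral_exp (ψ : ℝ → ℝ) (x : ℝ) :
    resp ψ x = ∫ y, ψ y * Real.exp (x * y - x ^ 2 / 2) ∂(gaussianReal 0 1) := by
  rw [integral_gaussianReal_eq_integral_smul one_ne_zero, resp]
  refine integral_congr_ae (ae_of_all _ fun y => ?_)
  simp only [smul_eq_mul]
  have h : npdf (y - x) = npdf y * Real.exp (x * y - x ^ 2 / 2) := by
    rw [npdf_eq, npdf_eq, mul_assoc, ← Real.exp_add]
    congr 2
    ring
  rw [h, show gaussianPDFReal 0 1 y = npdf y from rfl]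
  ring

lemma resp_congr {ψ ψ' : ℝ → ℝ} (h : ψ =ᵐ[volume] ψ') : resp ψ = resp ψ' := by
  ext x
  exact integral_congr_ae (by filter_upwards [h] with y hy; rw [hy])

namespace IsSoftTest

variable {ψ : ℝ → ℝ}

lemma integrable_mul (hψ : IsSoftTest ψ) {u : ℝ → ℝ} {ν : Measure ℝ} (hu : Integrable u ν) :
    Integrable (fun y => ψ y * u y) ν :=
  hu.bdd_mul (c := 1) hψ.measurable.aestronglyMeasurable
    (ae_of_all _ fun x => by rw [Real.norm_eq_abs, abs_of_nonneg (hψ.nonneg x)]; exact hψ.le_one x)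

lemma resp_one_sub (hψ : IsSoftTest ψ) (x : ℝ) : resp (fun y => 1 - ψ y) x = 1 - resp ψ x := by
  simp only [resp, sub_mul, one_mul]
  rw [integral_sub (integrable_npdf_sub x) (hψ.integrable_mul (integrable_npdf_sub x)),
    integral_npdf_sub]

lemma resp_nonneg (hψ : IsSoftTest ψ) (x : ℝ) : 0 ≤ resp ψ x :=
  MeasureTheory.integral_nonneg fun y => mul_nonneg (hψ.nonneg y) (npdf_nonneg _)

lemma resp_le_one (hψ : IsSoftTest ψ) (x : ℝ) : resp ψ x ≤ 1 := by
  linarith [hψ.one_sub.resp_nonneg x, hψ.resp_one_sub x]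

/-- A modulus of continuity for `resp ψ` that does not depend on the test `ψ`. -/
lemma sq_resp_sub_le (hψ : IsSoftTest ψ) (x x' : ℝ) :
    (resp ψ x - resp ψ x') ^ 2 ≤
      Real.exp (x ^ 2) + Real.exp (x' ^ 2) - 2 * Real.exp (x * x') := by
  have hintg : ∀ t : ℝ, Integrable (fun y => Real.exp (t * y)) (gaussianReal 0 1) := fun t =>
    integrable_exp_mul_gaussianReal t
  have hval : ∀ t : ℝ, ∫ y, Real.exp (t * y) ∂(gaussianReal 0 1) = Real.exp (t ^ 2 / 2) := fun t => by
    have := congrFun (mgf_fun_id_gaussianReal (μ := 0) (v := 1)) t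
    simpa [mgf] using this
  have hexp : ∀ t y : ℝ, Real.exp (t * y - t ^ 2 / 2) = Real.exp (-t ^ 2 / 2) * Real.exp (t * y) :=
    fun t y => by rw [← Real.exp_add]; congr 1; ring
  set u : ℝ → ℝ := fun y => Real.exp (x * y - x ^ 2 / 2) - Real.exp (x' * y - x' ^ 2 / 2) with hu
  have huint : ∀ t : ℝ, Integrable (fun y => Real.exp (t * y - t ^ 2 / 2)) (gaussianReal 0 1) :=
    fun t => by simpa only [hexp] using (hintg t).const_mul _
  have husq : ∀ y, u y ^ 2 = Real.exp (-x ^ 2) * Real.exp (2 * x * y) +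
      Real.exp (-x' ^ 2) * Real.exp (2 * x' * y) -
      2 * (Real.exp (-x ^ 2 / 2 - x' ^ 2 / 2) * Real.exp ((x + x') * y)) := by
    intro y
    simp only [hu, sub_sq, ← Real.exp_nat_mul, mul_assoc, ← Real.exp_add]
    push_cast
    ring_nf
  have i1 := (hintg (2 * x)).const_mul (Real.exp (-x ^ 2))
  have i2 := (hintg (2 * x')).const_mul (Real.exp (-x' ^ 2))
  have i3 := ((hintg (x + x')).const_mul (Real.exp (-x ^ 2 / 2 - x' ^ 2 / 2))).const_mul 2
  have i12 := i1.fun_add i2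
  have husqint : Integrable (fun y => u y ^ 2) (gaussianReal 0 1) := by
    simp only [husq]; exact i12.sub i3
  have hum : Measurable u := by fun_prop
  have hle : ∀ y, (ψ y * u y) ^ 2 ≤ u y ^ 2 := fun y => by
    rw [mul_pow]
    exact mul_le_of_le_one_left (sq_nonneg _) (pow_le_one₀ (hψ.nonneg y) (hψ.le_one y))
  have hψum : Measurable fun y => ψ y * u y := hψ.measurable.mul hum
  have hmem : MemLp (fun y => ψ y * u y) 2 (gaussianReal 0 1) := by
    rw [memLp_two_iff_integrable_sq hψum.aestronglyMeasurable]
    refine husqint.mono' (hψum.pow_const 2).aestronglyMeasurable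
      (ae_of_all _ fun y => ?_)
    rw [Real.norm_eq_abs, abs_of_nonneg (sq_nonneg _)]
    exact hle y
  -- Nonnegative variance plays the part of the Cauchy–Schwarz inequality: the squared mean of `ψ *
  -- u` is at most the mean of its square, hence at most that of `u ^ 2`, which removes `ψ`.
  have hvar := variance_nonneg (fun y => ψ y * u y) (gaussianReal 0 1)
  rw [variance_eq_sub hmem] at hvar
  have hdiff : resp ψ x - resp ψ x' = ∫ y, ψ y * u y ∂(gaussianReal 0 1) := by
    rw [resp_eq_integral_exp, resp_eq_integral_exp,
      ← integral_sub (hψ.integrable_mul (huint x)) (hψ.integrable_mul (huint x'))]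
    simp only [hu, mul_sub]
  have hmono : ∫ y, (ψ y * u y) ^ 2 ∂(gaussianReal 0 1) ≤ ∫ y, u y ^ 2 ∂(gaussianReal 0 1) :=
    integral_mono hmem.integrable_sq husqint hle
  have htot : ∫ y, u y ^ 2 ∂(gaussianReal 0 1) =
      Real.exp (x ^ 2) + Real.exp (x' ^ 2) - 2 * Real.exp (x * x') := by
    simp only [husq]
    rw [integral_sub i12 i3, integral_add i1 i2, integral_const_mul, integral_const_mul,
      integral_const_mul, integral_const_mul, hval, hval, hval, ← Real.exp_add, ← Real.exp_add,
      ← Real.exp_add]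
    ring_nf
  simp only [Pi.pow_apply] at hvar
  rw [hdiff, ← htot]
  linarith

lemma continuous_resp (hψ : IsSoftTest ψ) : Continuous (resp ψ) := by
  refine continuous_iff_continuousAt.2 fun x => ?_
  have h1 : Filter.Tendsto (fun x' => Real.exp (x' ^ 2) + Real.exp (x ^ 2) - 2 * Real.exp (x' * x))
      (nhds x) (nhds 0) := by
    have : Continuous (fun x' => Real.exp (x' ^ 2) + Real.exp (x ^ 2) - 2 * Real.exp (x' * x)) := by
      fun_prop
    convert this.tendsto x using 2
    simp only [sq]
    ring
  have h2 : Filter.Tendsto (fun x' => (resp ψ x' - resp ψ x) ^ 2) (nhds x) (nhds 0) :=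
    squeeze_zero (fun _ => sq_nonneg _) (fun x' => hψ.sq_resp_sub_le x' x) h1
  have h3 : Filter.Tendsto (fun x' => |resp ψ x' - resp ψ x|) (nhds x) (nhds 0) := by
    have := h2.sqrt
    simpa [Real.sqrt_sq_eq_abs] using this
  exact tendsto_iff_norm_sub_tendsto_zero.2 h3

lemma isSoftTest_resp (hψ : IsSoftTest ψ) : IsSoftTest (resp ψ) :=
  ⟨hψ.continuous_resp.measurable, hψ.resp_nonneg, hψ.resp_le_one⟩

/-- Since `(y - x) ^ 2 / 2 ≤ x ^ 2 + y ^ 2`, the kernel factors from below. The bound makes the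
logarithm of the response grow at most quadratically, hence integrable under finite power. -/
lemma exists_mul_exp_le_resp (hψ : IsSoftTest ψ) (h : ¬ ψ =ᵐ[volume] 0) :
    ∃ c > 0, ∀ x, c * Real.exp (-x ^ 2) ≤ resp ψ x := by
  have hintg : Integrable fun y : ℝ => Real.exp (-1 * y ^ 2) := integrable_exp_neg_mul_sq one_pos
  have hintg' := hψ.integrable_mul hintg
  have hnn : 0 ≤ fun y => ψ y * Real.exp (-1 * y ^ 2) :=
    fun y => mul_nonneg (hψ.nonneg y) (Real.exp_pos _).le
  have hpos : 0 < ∫ y, ψ y * Real.exp (-1 * y ^ 2) := by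
    refine lt_of_le_of_ne (MeasureTheory.integral_nonneg hnn) fun h0 => h ?_
    filter_upwards [(integral_eq_zero_iff_of_nonneg hnn hintg').1 h0.symm] with y hy
    simpa [(Real.exp_pos _).ne'] using hy
  have hs : 0 < (√(2 * Real.pi))⁻¹ := by positivity
  refine ⟨(√(2 * Real.pi))⁻¹ * ∫ y, ψ y * Real.exp (-1 * y ^ 2), mul_pos hs hpos, fun x => ?_⟩
  rw [mul_assoc, ← integral_mul_const, ← integral_const_mul]
  refine integral_mono ((hintg'.mul_const _).const_mul _)
    (hψ.integrable_mul (integrable_npdf_sub x)) fun y => ?_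
  simp only
  rw [npdf_eq, mul_assoc, mul_left_comm, ← Real.exp_add]
  refine mul_le_mul_of_nonneg_left (mul_le_mul_of_nonneg_left ?_ hs.le) (hψ.nonneg y)
  exact Real.exp_le_exp.2 (by nlinarith [sq_nonneg (x + y)])

lemma resp_pos (hψ : IsSoftTest ψ) (h : ¬ ψ =ᵐ[volume] 0) (x : ℝ) : 0 < resp ψ x := by
  obtain ⟨c, hc, hx⟩ := hψ.exists_mul_exp_le_resp h
  exact (mul_pos hc (Real.exp_pos _)).trans_le (hx x)

lemma integrable_log_resp (hψ : IsSoftTest ψ) (h : ¬ ψ =ᵐ[volume] 0) {μ : Measure ℝ}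
    [IsProbabilityMeasure μ] (hμ : Integrable (fun x => x ^ 2) μ) :
    Integrable (fun x => Real.log (resp ψ x)) μ := by
  obtain ⟨c, hc, hx⟩ := hψ.exists_mul_exp_le_resp h
  refine Integrable.mono' ((integrable_const |Real.log c|).add hμ)
    (hψ.continuous_resp.measurable.log.aestronglyMeasurable) (ae_of_all _ fun x => ?_)
  have h1 : Real.log (resp ψ x) ≤ 0 := Real.log_nonpos (hψ.resp_nonneg x) (hψ.resp_le_one x)
  have h2 := Real.log_le_log (mul_pos hc (Real.exp_pos _)) (hx x)
  rw [Real.log_mul hc.ne' (Real.exp_pos _).ne', Real.log_exp] at h2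
  rw [Real.norm_eq_abs, abs_of_nonpos h1]
  simp only [Pi.add_apply]
  linarith [neg_abs_le (Real.log c)]

end IsSoftTest

/-- A soft test that is almost surely constant neither `0` nor `1`. -/
structure IsProperTest (ψ : ℝ → ℝ) : Prop extends IsSoftTest ψ where
  not_zero : ¬ ψ =ᵐ[volume] 0
  not_one : ¬ ψ =ᵐ[volume] 1

namespace IsProperTest

variable {ψ : ℝ → ℝ} {μ : Measure ℝ}

lemma one_sub (hψ : IsProperTest ψ) : IsProperTest fun y => 1 - ψ y where
  toIsSoftTest := hψ.toIsSoftTest.one_sub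
  not_zero h := hψ.not_one (by filter_upwards [h] with y hy; simp at hy ⊢; linarith)
  not_one h := hψ.not_zero (by filter_upwards [h] with y hy; simpa using hy)

lemma resp_pos (hψ : IsProperTest ψ) (x : ℝ) : 0 < resp ψ x :=
  hψ.toIsSoftTest.resp_pos hψ.not_zero x

lemma resp_lt_one (hψ : IsProperTest ψ) (x : ℝ) : resp ψ x < 1 := by
  have := hψ.one_sub.resp_pos x
  rw [hψ.toIsSoftTest.resp_one_sub] at this
  linarith

lemma integrable_log_resp (hψ : IsProperTest ψ) [IsProbabilityMeasure μ]
    (hμ : Integrable (fun x => x ^ 2) μ) : Integrable (fun x => Real.log (resp ψ x)) μ :=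
  hψ.toIsSoftTest.integrable_log_resp hψ.not_zero hμ

lemma integrable_log_one_sub_resp (hψ : IsProperTest ψ) [IsProbabilityMeasure μ]
    (hμ : Integrable (fun x => x ^ 2) μ) : Integrable (fun x => Real.log (1 - resp ψ x)) μ := by
  simpa only [hψ.toIsSoftTest.resp_one_sub] using hψ.one_sub.integrable_log_resp hμ

lemma integral_resp_pos (hψ : IsProperTest ψ) [IsProbabilityMeasure μ] :
    0 < ∫ x, resp ψ x ∂μ := by
  have hf := hψ.toIsSoftTest.isSoftTest_resp
  refine lt_of_le_of_ne hf.integral_nonneg fun h => ?_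
  obtain ⟨x, hx⟩ := (hf.ae_eq_zero h.symm).exists
  exact (hψ.resp_pos x).ne' hx

lemma integral_resp_lt_one (hψ : IsProperTest ψ) [IsProbabilityMeasure μ] :
    ∫ x, resp ψ x ∂μ < 1 := by
  have hf := hψ.toIsSoftTest.isSoftTest_resp
  refine lt_of_le_of_ne hf.integral_le_one fun h => ?_
  obtain ⟨x, hx⟩ := (hf.ae_eq_one h).exists
  exact (hψ.resp_lt_one x).ne hx

end IsProperTest

lemma IsSoftTest.isProperTest_of_info_pos {ψ : ℝ → ℝ} {μ : Measure ℝ} [IsProbabilityMeasure μ]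
    (hψ : IsSoftTest ψ) (h : 0 < info μ (resp ψ)) : IsProperTest ψ where
  toIsSoftTest := hψ
  not_zero h0 := by
    rw [resp_congr h0] at h
    simp [info, resp] at h
  not_one h1 := by
    rw [resp_congr h1] at h
    simp [info, resp, integral_npdf_sub] at h

/-! ### Convexity in the channel and the best region for a given input -/

/-- The derivative of the binary entropy function on `(0, 1)`. -/
def entSlope (p : ℝ) : ℝ := Real.log (1 - p) - Real.log p

/-- The log-likelihood-ratio score of the input `x` for the channel `f` with input law `μ`. -/
def score (μ : Measure ℝ) (f : ℝ → ℝ) (x : ℝ) : ℝ := entSlope (∫ x, f x ∂μ) - entSlope (f x)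

/-- This is `log t ≤ t - 1` at `t = b * c / (e * a)`. In the application `a`, `b` are the
probabilities of one output given the input, under the new and the old channel, and `c`, `e` are
their averages. -/
lemma mul_log_sub_mul_log_ge {a b c e : ℝ} (ha : 0 ≤ a) (hb : 0 < b) (hc : 0 ≤ c) (he : 0 < e)
    (hca : c = 0 → a = 0) :
    a * Real.log c - a * Real.log e + a - b * c / e ≤ a * Real.log a - a * Real.log b := by
  rcases ha.eq_or_lt with rfl | ha
  · have : 0 ≤ b * c / e := by positivity
    simpa using this
  have hc : 0 < c := hc.lt_of_ne fun h => ha.ne' (hca h.symm)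
  have h := Real.log_le_sub_one_of_pos (x := b * c / (e * a)) (by positivity)
  rw [Real.log_div (by positivity) (by positivity), Real.log_mul hb.ne' hc.ne',
    Real.log_mul he.ne' ha.ne'] at h
  have h2 := mul_le_mul_of_nonneg_left h ha.le
  have h3 : a * (b * c / (e * a) - 1) = b * c / e - a := by field_simp
  rw [h3] at h2
  linarith

/-- Mutual information lies above its tangents as a functional of the channel. -/
lemma info_add_integral_mul_score_le {μ : Measure ℝ} [IsProbabilityMeasure μ] {f f' : ℝ → ℝ}
    (hf : IsSoftTest f) (hf0 : ∀ x, 0 < f x) (hf1 : ∀ x, f x < 1)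
    (hl : Integrable (fun x => Real.log (f x)) μ) (hl' : Integrable (fun x => Real.log (1 - f x)) μ)
    (hf' : IsSoftTest f') :
    info μ f + ∫ x, (f' x - f x) * score μ f x ∂μ ≤ info μ f' := by
  set q := ∫ x, f x ∂μ with hq
  set q' := ∫ x, f' x ∂μ with hq'
  have hq0 : 0 < q := by
    refine lt_of_le_of_ne hf.integral_nonneg fun h => ?_
    obtain ⟨x, hx⟩ := (hf.ae_eq_zero h.symm).exists
    exact (hf0 x).ne' hx
  have hq1 : q < 1 := by
    refine lt_of_le_of_ne hf.integral_le_one fun h => ?_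
    obtain ⟨x, hx⟩ := (hf.ae_eq_one h).exists
    exact (hf1 x).ne hx
  have hq'0 : 0 ≤ q' := hf'.integral_nonneg
  have hq'1 : q' ≤ 1 := hf'.integral_le_one
  have h0 : ∀ᵐ x ∂μ, q' = 0 → f' x = 0 := by
    by_cases h : q' = 0
    · filter_upwards [hf'.ae_eq_zero h] with x hx _ using hx
    · exact ae_of_all _ fun x h' => absurd h' h
  have h1 : ∀ᵐ x ∂μ, q' = 1 → f' x = 1 := by
    by_cases h : q' = 1
    · filter_upwards [hf'.ae_eq_one h] with x hx _ using hx
    · exact ae_of_all _ fun x h' => absurd h' h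
  have hsc : Integrable (score μ f) μ := (integrable_const _).sub (hl'.sub hl)
  have i1 : Integrable (fun x => Real.binEntropy (f x)) μ := hf.integrable_binEntropy
  have i2 : Integrable (fun x => Real.binEntropy (f' x)) μ := hf'.integrable_binEntropy
  have i3 : Integrable (fun x => (f' x - f x) * score μ f x) μ := by
    simp only [sub_mul]
    exact (hf'.integrable_mul hsc).sub (hf.integrable_mul hsc)
  have i4 : Integrable f μ := hf.integrable
  have i5 : Integrable f' μ := hf'.integrable
  -- One logarithmic inequality for each output bounds the integrand by an expression affine in `f
  -- x` and `f' x`, whose integral depends on `q` and `q'` only.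
  have hpt : ∀ᵐ x ∂μ, Real.binEntropy (f' x) - Real.binEntropy (f x) + (f' x - f x) * score μ f x ≤
      f' x * (Real.log q - Real.log q' - Real.log (1 - q) + Real.log (1 - q') + entSlope q) -
        f x * (entSlope q - q' / q + (1 - q') / (1 - q)) +
        (Real.log (1 - q) - Real.log (1 - q') - 1 + (1 - q') / (1 - q)) := by
    filter_upwards [h0, h1] with x hx0 hx1
    have k1 := mul_log_sub_mul_log_ge (hf'.nonneg x) (hf0 x) hq'0 hq0 hx0
    have k2 := mul_log_sub_mul_log_ge (sub_nonneg.2 (hf'.le_one x)) (sub_pos.2 (hf1 x))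
      (sub_nonneg.2 hq'1) (sub_pos.2 hq1) (fun h => by rw [hx1 (by linarith), sub_self])
    simp only [score, ← hq, entSlope, Real.binEntropy, Real.log_inv]
    have e1 : f x * (q' / q) = f x * q' / q := by ring
    have e2 : f x * ((1 - q') / (1 - q)) = (1 - q') / (1 - q) - (1 - f x) * (1 - q') / (1 - q) := by
      ring
    nlinarith [k1, k2, e1, e2]
  have hI : Integrable (fun x =>
      f' x * (Real.log q - Real.log q' - Real.log (1 - q) + Real.log (1 - q') + entSlope q) -
        f x * (entSlope q - q' / q + (1 - q') / (1 - q))) μ :=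
    (i5.mul_const _).sub (i4.mul_const _)
  have hJ : Integrable (fun x => Real.binEntropy (f' x) - Real.binEntropy (f x)) μ := i2.sub i1
  have h := integral_mono_ae (hJ.add i3) (hI.add (integrable_const
    (Real.log (1 - q) - Real.log (1 - q') - 1 + (1 - q') / (1 - q)))) hpt
  simp only [Pi.add_apply] at h
  rw [integral_add hJ i3, integral_add hI (integrable_const _), integral_sub i2 i1,
    integral_sub (i5.mul_const _) (i4.mul_const _), integral_mul_const, integral_mul_const,
    ← hq, ← hq'] at h
  simp only [integral_const, probReal_univ, one_smul] at h
  simp only [info, ← hq, ← hq']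
  have e3 : q * (q' / q) = q' := by field_simp
  have e4 : (1 - q) * ((1 - q') / (1 - q)) = 1 - q' := by
    have := (sub_pos.2 hq1).ne'
    field_simp
  simp only [Real.binEntropy, Real.log_inv, entSlope] at h ⊢
  nlinarith [h, e3, e4]

/-- The hard test that accepts on `D`. -/
def hard (D : Set ℝ) : ℝ → ℝ := D.indicator fun _ => 1

lemma hard_of_mem {D : Set ℝ} {y : ℝ} (hy : y ∈ D) : hard D y = 1 := Set.indicator_of_mem hy _

lemma hard_of_notMem {D : Set ℝ} {y : ℝ} (hy : y ∉ D) : hard D y = 0 :=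
  Set.indicator_of_notMem hy _

lemma isSoftTest_hard {D : Set ℝ} (hD : MeasurableSet D) : IsSoftTest (hard D) where
  measurable := measurable_const.indicator hD
  nonneg y := Set.indicator_nonneg (fun _ _ => zero_le_one) y
  le_one y := Set.indicator_le_self' (fun _ _ => zero_le_one) y

lemma hard_compl (D : Set ℝ) : hard Dᶜ = fun y => 1 - hard D y := by
  ext y
  by_cases hy : y ∈ D <;> simp [hard, hy]

/-- The score averaged over the inputs, weighted by the likelihood of the observation `y`. -/
def scoreConv (μ : Measure ℝ) (f : ℝ → ℝ) (y : ℝ) : ℝ := ∫ x, score μ f x * npdf (y - x) ∂μ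

lemma IsProperTest.integrable_score {ψ : ℝ → ℝ} (hψ : IsProperTest ψ) {μ : Measure ℝ}
    [IsProbabilityMeasure μ] (hμ : Integrable (fun x => x ^ 2) μ) :
    Integrable (score μ (resp ψ)) μ :=
  (integrable_const _).sub ((hψ.integrable_log_one_sub_resp hμ).sub (hψ.integrable_log_resp hμ))

section Conv

variable {μ : Measure ℝ} {s : ℝ → ℝ}

lemma integrable_mul_npdf_sub (hs : Integrable s μ) (y : ℝ) :
    Integrable (fun x => s x * npdf (y - x)) μ := by
  refine hs.mul_bdd (c := 1) (by fun_prop) (ae_of_all _ fun x => ?_)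
  rw [Real.norm_eq_abs, abs_of_pos (npdf_pos _)]
  exact npdf_le_one _

lemma continuous_integral_mul_npdf_sub (hs : Integrable s μ) :
    Continuous fun y => ∫ x, s x * npdf (y - x) ∂μ := by
  refine continuous_of_dominated (fun y => (integrable_mul_npdf_sub hs y).aestronglyMeasurable)
    (bound := fun x => |s x|) (fun y => ae_of_all _ fun x => ?_) hs.abs
    (ae_of_all _ fun x => by fun_prop)
  rw [Real.norm_eq_abs, abs_mul, abs_of_pos (npdf_pos _)]
  exact mul_le_of_le_one_right (abs_nonneg _) (npdf_le_one _)

lemma integrable_prod_mul_npdf (hs : Integrable s μ) :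
    Integrable (fun w : ℝ × ℝ => s w.1 * npdf (w.2 - w.1)) (μ.prod volume) := by
  have hm : AEStronglyMeasurable (fun w : ℝ × ℝ => s w.1 * npdf (w.2 - w.1)) (μ.prod volume) :=
    hs.aestronglyMeasurable.comp_fst.mul
      (continuous_npdf.comp (continuous_snd.sub continuous_fst)).aestronglyMeasurable
  refine (integrable_prod_iff hm).2 ⟨ae_of_all _ fun x => (integrable_npdf_sub x).const_mul (s x), ?_⟩
  have : (fun x => ∫ y, ‖s x * npdf (y - x)‖) = fun x => ‖s x‖ := by
    ext x
    simp only [norm_mul, integral_const_mul]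
    simp only [Real.norm_eq_abs, abs_of_pos (npdf_pos _), integral_npdf_sub, mul_one]
  simp only [this]
  exact hs.norm

variable [IsProbabilityMeasure μ]

lemma integrable_integral_mul_npdf_sub (hs : Integrable s μ) :
    Integrable fun y => ∫ x, s x * npdf (y - x) ∂μ :=
  (integrable_prod_mul_npdf hs).integral_prod_right

lemma integral_resp_mul (hs : Integrable s μ) {ψ : ℝ → ℝ} (hψ : IsSoftTest ψ) :
    ∫ x, resp ψ x * s x ∂μ = ∫ y, ψ y * ∫ x, s x * npdf (y - x) ∂μ := by
  have h : Integrable (fun w : ℝ × ℝ => ψ w.2 * (s w.1 * npdf (w.2 - w.1))) (μ.prod volume) :=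
    (integrable_prod_mul_npdf hs).bdd_mul (c := 1)
      (hψ.measurable.comp measurable_snd).aestronglyMeasurable
      (ae_of_all _ fun w => by
        rw [Real.norm_eq_abs, abs_of_nonneg (hψ.nonneg _)]; exact hψ.le_one _)
  simp only [← integral_const_mul]
  rw [← integral_integral_swap (f := fun x y => ψ y * (s x * npdf (y - x))) h]
  refine integral_congr_ae (ae_of_all _ fun x => ?_)
  simp only [resp]
  rw [← integral_mul_const]
  exact integral_congr_ae (ae_of_all _ fun y => by ring)

end Conv

section Optimal

variable {μ : Measure ℝ} [IsProbabilityMeasure μ] {ψ ψ' : ℝ → ℝ}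

/-- The tangent inequality carried from the channel to the test: Fubini moves the normal kernel from
the test onto the score, so `scoreConv` is the gradient in the test. -/
lemma info_resp_add_le (hψ : IsProperTest ψ) (hμ : Integrable (fun x => x ^ 2) μ)
    (hψ' : IsSoftTest ψ') :
    info μ (resp ψ) + ∫ y, (ψ' y - ψ y) * scoreConv μ (resp ψ) y ≤ info μ (resp ψ') := by
  have hs := hψ.integrable_score hμ
  have hf := hψ.toIsSoftTest.isSoftTest_resp
  have h := info_add_integral_mul_score_le hf hψ.resp_pos
    hψ.resp_lt_one (hψ.integrable_log_resp hμ) (hψ.integrable_log_one_sub_resp hμ)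
    hψ'.isSoftTest_resp
  have hg : Integrable (scoreConv μ (resp ψ)) := integrable_integral_mul_npdf_sub hs
  simp only [sub_mul] at h ⊢
  rw [integral_sub (hψ'.isSoftTest_resp.integrable_mul hs) (hf.integrable_mul hs),
    integral_resp_mul hs hψ', integral_resp_mul hs hψ.toIsSoftTest] at h
  rwa [integral_sub (hψ'.integrable_mul hg) (hψ.toIsSoftTest.integrable_mul hg)]

lemma measurableSet_scoreConv_pos (hψ : IsProperTest ψ) (hμ : Integrable (fun x => x ^ 2) μ) :
    MeasurableSet {y | 0 < scoreConv μ (resp ψ) y} :=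
  (isOpen_lt continuous_const
    (continuous_integral_mul_npdf_sub (hψ.integrable_score hμ))).measurableSet

lemma hard_sub_mul_nonneg (hψ : IsSoftTest ψ) (g : ℝ → ℝ) (y : ℝ) :
    0 ≤ (hard {y | 0 < g y} y - ψ y) * g y := by
  by_cases hy : 0 < g y
  · have : hard {y | 0 < g y} y = 1 := by simp [hard, hy]
    rw [this]
    exact mul_nonneg (sub_nonneg.2 (hψ.le_one y)) hy.le
  · have : hard {y | 0 < g y} y = 0 := by simp [hard, hy]
    rw [this]
    exact mul_nonneg_of_nonpos_of_nonpos (by linarith [hψ.nonneg y]) (not_lt.1 hy)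

/-- The gradient pairs best, among all tests, with the indicator of its positivity set, and
convexity turns this first-order gain into a true one. -/
lemma info_le_info_hard (hψ : IsProperTest ψ) (hμ : Integrable (fun x => x ^ 2) μ) :
    info μ (resp ψ) ≤ info μ (resp (hard {y | 0 < scoreConv μ (resp ψ) y})) := by
  have h := info_resp_add_le hψ hμ (isSoftTest_hard (measurableSet_scoreConv_pos hψ hμ))
  have : 0 ≤ ∫ y, (hard {y | 0 < scoreConv μ (resp ψ) y} y - ψ y) * scoreConv μ (resp ψ) y :=
    integral_nonneg fun y => hard_sub_mul_nonneg hψ.toIsSoftTest (scoreConv μ (resp ψ)) y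
  linarith

/-- The first-order gain is the integral of a nonnegative function, so absence of gain makes that
function vanish: the test is already deterministic wherever the gradient is nonzero. -/
lemma ae_eq_zero_of_info_hard_le (hψ : IsProperTest ψ) (hμ : Integrable (fun x => x ^ 2) μ)
    (hle : info μ (resp (hard {y | 0 < scoreConv μ (resp ψ) y})) ≤ info μ (resp ψ)) :
    ∀ᵐ y, (hard {y | 0 < scoreConv μ (resp ψ) y} y - ψ y) * scoreConv μ (resp ψ) y = 0 := by
  have hD := isSoftTest_hard (measurableSet_scoreConv_pos hψ hμ)
  have h := info_resp_add_le hψ hμ hD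
  have hnn := hard_sub_mul_nonneg hψ.toIsSoftTest (scoreConv μ (resp ψ))
  have hg : Integrable (scoreConv μ (resp ψ)) :=
    integrable_integral_mul_npdf_sub (hψ.integrable_score hμ)
  have hintg : Integrable fun y =>
      (hard {y | 0 < scoreConv μ (resp ψ) y} y - ψ y) * scoreConv μ (resp ψ) y := by
    simp only [sub_mul]
    exact (hD.integrable_mul hg).sub (hψ.toIsSoftTest.integrable_mul hg)
  have h0 : 0 ≤ ∫ y, (hard {y | 0 < scoreConv μ (resp ψ) y} y - ψ y) * scoreConv μ (resp ψ) y :=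
    integral_nonneg fun y => hnn y
  exact (integral_eq_zero_iff_of_nonneg hnn hintg).1 (le_antisymm (by linarith) h0)

/-- A test that is nowhere deterministic is strictly worse than some hard test. -/
lemma exists_info_lt_info_hard (hψ : IsProperTest ψ) (hμ : Integrable (fun x => x ^ 2) μ)
    (h0 : ∀ y, 0 < ψ y) (h1 : ∀ y, ψ y < 1) (hpos : 0 < info μ (resp ψ)) :
    ∃ D, MeasurableSet D ∧ info μ (resp ψ) < info μ (resp (hard D)) := by
  refine ⟨_, measurableSet_scoreConv_pos hψ hμ, lt_of_not_ge fun hle => ?_⟩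
  have hae := ae_eq_zero_of_info_hard_le hψ hμ hle
  have hzero : ∀ᵐ y, scoreConv μ (resp ψ) y = 0 := by
    filter_upwards [hae] with y hy
    rcases mul_eq_zero.1 hy with h | h
    · by_cases hy' : 0 < scoreConv μ (resp ψ) y
      · simp only [hard, Set.indicator, Set.mem_ofPred_eq, hy', if_true] at h
        linarith [h1 y]
      · simp only [hard, Set.indicator, Set.mem_ofPred_eq, hy', if_false] at h
        linarith [h0 y]
    · exact h
  -- With zero gradient, the tangent inequality towards the constant quantizer bounds the
  -- information by zero.
  have h := info_resp_add_le hψ hμ (isSoftTest_hard MeasurableSet.empty)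
  have hintg : ∫ y, (hard ∅ y - ψ y) * scoreConv μ (resp ψ) y = 0 := by
    rw [integral_congr_ae (g := fun _ => (0 : ℝ)) (by filter_upwards [hzero] with y hy; simp [hy])]
    simp
  have hemp : info μ (resp (hard ∅)) = 0 := by simp [info, resp, hard]
  rw [hintg, hemp] at h
  linarith

end Optimal

/-! ### Splitting the noise: amplification strictly helps -/

lemma crossover_eq_real (σ : ℝ≥0) {D : Set ℝ} (hD : MeasurableSet D) (x : ℝ) :
    crossover σ D x = (gaussianReal x (σ ^ 2)).real D := by
  have h := gaussianReal_map_const_add (μ := 0) (v := σ ^ 2) x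
  rw [zero_add] at h
  rw [crossover, ← h, map_measureReal_apply (measurable_const_add x) hD]
  rfl

lemma resp_hard {D : Set ℝ} (hD : MeasurableSet D) (x : ℝ) :
    resp (hard D) x = (gaussianReal x 1).real D := by
  rw [resp_eq_integral_gaussianReal, hard, integral_indicator_const _ hD]
  simp

lemma crossover_eq_resp {σ : ℝ≥0} (hσ : σ ≠ 0) {D : Set ℝ} (hD : MeasurableSet D) (x : ℝ) :
    crossover σ D x = resp (hard {y | (σ : ℝ) * y ∈ D}) (x / σ) := by
  have hE : MeasurableSet {y : ℝ | (σ : ℝ) * y ∈ D} := (measurable_const_mul (σ : ℝ)) hD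
  have h := gaussianReal_map_const_mul (μ := x / σ) (v := 1) (σ : ℝ)
  have e : (σ : ℝ) * (x / σ) = x := by
    have : (σ : ℝ) ≠ 0 := by exact_mod_cast hσ
    field_simp
  rw [e] at h
  rw [resp_hard hE, crossover_eq_real _ hD]
  have h' : gaussianReal x (σ ^ 2) = (gaussianReal (x / σ) 1).map ((σ : ℝ) * ·) := by
    rw [h]; congr 1; ext; simp
  rw [h', map_measureReal_apply (measurable_const_mul _) hD]
  rfl

lemma integral_crossover (x : ℝ) (v τ : ℝ≥0) {D : Set ℝ} (hD : MeasurableSet D) :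
    ∫ u, crossover τ D u ∂(gaussianReal x v) = (gaussianReal x (v + τ ^ 2)).real D := by
  have h := gaussianReal_conv_gaussianReal (m₁ := x) (m₂ := 0) (v₁ := v) (v₂ := τ ^ 2)
  rw [add_zero] at h
  have hE : MeasurableSet {w : ℝ × ℝ | w.1 + w.2 ∈ D} := (measurable_fst.add measurable_snd) hD
  rw [← h, measureReal_def, Measure.conv, Measure.map_apply (by fun_prop) hD,
    Measure.prod_apply (show MeasurableSet ((fun w : ℝ × ℝ => w.1 + w.2) ⁻¹' D) from hE),
    ← integral_toReal (measurable_measure_prodMk_left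
      (show MeasurableSet ((fun w : ℝ × ℝ => w.1 + w.2) ⁻¹' D) from hE)).aemeasurable
      (ae_of_all _ fun _ => measure_lt_top _ _)]
  rfl

lemma crossover_pos {τ : ℝ≥0} (hτ : τ ≠ 0) {D : Set ℝ} (hD : MeasurableSet D)
    (h : volume D ≠ 0) (u : ℝ) : 0 < crossover τ D u := by
  rw [crossover_eq_real _ hD]
  have : gaussianReal u (τ ^ 2) D ≠ 0 := fun h' =>
    h (gaussianReal_absolutelyContinuous' u (pow_ne_zero 2 hτ) h')
  exact ENNReal.toReal_pos this (measure_ne_top _ _)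

lemma info_map {μ : Measure ℝ} {T f : ℝ → ℝ} (hT : Measurable T) (hf : Measurable f) :
    info (μ.map T) f = info μ fun x => f (T x) := by
  have h : Measurable fun x => Real.binEntropy (f x) :=
    Real.binEntropy_continuous.measurable.comp hf
  rw [info, info, integral_map hT.aemeasurable hf.aestronglyMeasurable,
    integral_map hT.aemeasurable h.aestronglyMeasurable]

/-- Amplifying the input strictly increases the attainable mutual information. -/
lemma exists_info_lt_info_map_mul {μ : Measure ℝ} [IsProbabilityMeasure μ]
    (hμ : Integrable (fun x => x ^ 2) μ) {D : Set ℝ} (hD : MeasurableSet D)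
    (hpos : 0 < info μ (resp (hard D))) {s : ℝ} (hs : 1 < s) :
    ∃ D', MeasurableSet D' ∧
      info μ (resp (hard D)) < info (μ.map (s * ·)) (resp (hard D')) := by
  have hs0 : 0 < s := one_pos.trans hs
  have hproper := (isSoftTest_hard hD).isProperTest_of_info_pos hpos
  have hlt : 0 < 1 - (s ^ 2)⁻¹ := sub_pos.2 (inv_lt_one_of_one_lt₀ (by nlinarith))
  -- After amplification by `s` and division of the output by `s`, the noise has variance `(s ^
  -- 2)⁻¹`. Adding independent noise of variance `τ ^ 2` restores unit variance, so the randomized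
  -- test `ψ` below reproduces the original channel exactly. It takes values strictly between `0`
  -- and `1` because the added noise has full support.
  let τ : ℝ≥0 := ⟨√(1 - (s ^ 2)⁻¹), Real.sqrt_nonneg _⟩
  have hτ : τ ≠ 0 := fun h => by
    have : √(1 - (s ^ 2)⁻¹) = 0 := congrArg NNReal.toReal h
    exact (Real.sqrt_pos.2 hlt).ne' this
  have hD0 : volume D ≠ 0 := fun h => hproper.not_zero (by
    filter_upwards [measure_eq_zero_iff_ae_notMem.1 h] with y hy
    simp [hard, hy])
  have hD1 : volume Dᶜ ≠ 0 := fun h => hproper.not_one (by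
    filter_upwards [measure_eq_zero_iff_ae_notMem.1 h] with y hy
    simp at hy
    simp [hard, hy])
  let ψ : ℝ → ℝ := fun y => crossover τ D (y / s)
  have hc := isSoftTest_crossover τ hD
  have hψ : IsSoftTest ψ :=
    ⟨hc.measurable.comp (measurable_id.div_const s), fun y => hc.nonneg _, fun y => hc.le_one _⟩
  have hψ0 : ∀ y, 0 < ψ y := fun y => crossover_pos hτ hD hD0 _
  have hψ1 : ∀ y, ψ y < 1 := fun y => by
    have h := crossover_pos hτ hD.compl hD1 (y / s)
    rw [crossover_eq_real _ hD.compl, probReal_compl_eq_one_sub hD, ← crossover_eq_real _ hD] at h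
    exact sub_pos.1 h
  have hresp : ∀ x, resp ψ (s * x) = resp (hard D) x := fun x => by
    have h := gaussianReal_map_div_const (μ := s * x) (v := 1) s
    rw [mul_div_cancel_left₀ _ hs0.ne'] at h
    rw [resp_eq_integral_gaussianReal, resp_hard hD]
    have h2 := integral_map (μ := gaussianReal (s * x) 1) (φ := fun y => y / s)
      (f := crossover τ D) (by fun_prop) hc.measurable.aestronglyMeasurable
    rw [h, integral_crossover _ _ _ hD] at h2
    rw [← h2]
    congr 2
    ext
    push_cast
    rw [show (τ : ℝ) = √(1 - (s ^ 2)⁻¹) from rfl, Real.sq_sqrt hlt.le]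
    simp
  have hpm : IsProbabilityMeasure (μ.map (s * ·)) :=
    Measure.isProbabilityMeasure_map (by fun_prop)
  have hinfo : info (μ.map (s * ·)) (resp ψ) = info μ (resp (hard D)) := by
    rw [info_map (measurable_const_mul s) hψ.continuous_resp.measurable]
    simp only [hresp]
  have hψp : IsProperTest ψ := hψ.isProperTest_of_info_pos (μ := μ.map (s * ·)) (hinfo ▸ hpos)
  have hμ' : Integrable (fun x => x ^ 2) (μ.map (s * ·)) := by
    rw [integrable_map_measure (by fun_prop) (by fun_prop)]
    simp only [Function.comp_def, mul_pow]
    exact hμ.const_mul _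
  obtain ⟨D', hD', h⟩ := exists_info_lt_info_hard hψp hμ' hψ0 hψ1 (hinfo ▸ hpos)
  exact ⟨D', hD', hinfo ▸ h⟩

/-! ### Optimal pairs: power, mean and sign conditions -/

section Admissible

variable {P : ℝ} {μ : Measure ℝ}

lemma IsAdmissibleInput.integrable_sq (h : IsAdmissibleInput P μ) :
    Integrable (fun x => x ^ 2) μ :=
  (lintegral_ofReal_ne_top_iff_integrable (by fun_prop) (ae_of_all _ fun x => sq_nonneg x)).1
    (h.power_le.trans_lt ENNReal.ofReal_lt_top).ne

lemma IsAdmissibleInput.integral_sq_le (h : IsAdmissibleInput P μ) (hP : 0 ≤ P) :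
    ∫ x, x ^ 2 ∂μ ≤ P := by
  have := h.power_le
  rw [← ofReal_integral_eq_lintegral_ofReal h.integrable_sq (ae_of_all _ fun x => sq_nonneg x)]
    at this
  exact (ENNReal.ofReal_le_ofReal_iff hP).1 this

lemma isAdmissibleInput_of_integral_sq_le [IsProbabilityMeasure μ]
    (hμ : Integrable (fun x => x ^ 2) μ) (h : ∫ x, x ^ 2 ∂μ ≤ P) : IsAdmissibleInput P μ where
  isProbabilityMeasure := inferInstance
  power_le := by
    rw [← ofReal_integral_eq_lintegral_ofReal hμ (ae_of_all _ fun x => sq_nonneg x)]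
    exact ENNReal.ofReal_le_ofReal h

lemma integrable_id_of_integrable_sq [IsProbabilityMeasure μ]
    (hμ : Integrable (fun x => x ^ 2) μ) : Integrable (fun x => x) μ := by
  refine ((integrable_const 1).add hμ).mono' (by fun_prop) (ae_of_all _ fun x => ?_)
  rw [Real.norm_eq_abs, Pi.add_apply, abs_le]
  constructor <;> nlinarith [sq_nonneg (x + 1), sq_nonneg (x - 1)]

end Admissible

/-- The input law `μ` and the region `D` attain the capacity in unit-variance noise. -/
structure IsOpt (P : ℝ) (μ : Measure ℝ) (D : Set ℝ) : Prop where
  adm : IsAdmissibleInput P μ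
  meas : MeasurableSet D
  le : ∀ μ', IsAdmissibleInput P μ' → ∀ D', MeasurableSet D' →
    info μ' (resp (hard D')) ≤ info μ (resp (hard D))

lemma integral_two_point {p : ℝ} (hp0 : 0 ≤ p) (hp1 : p ≤ 1) (a b : ℝ) (u : ℝ → ℝ) :
    ∫ x, u x ∂(ENNReal.ofReal p • Measure.dirac a + ENNReal.ofReal (1 - p) • Measure.dirac b) =
      p * u a + (1 - p) * u b := by
  have i : ∀ c, Integrable u (Measure.dirac c) := fun c => integrable_dirac (by simp)
  rw [integral_add_measure ((i a).smul_measure ENNReal.ofReal_ne_top)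
    ((i b).smul_measure ENNReal.ofReal_ne_top), integral_smul_measure, integral_smul_measure,
    integral_dirac, integral_dirac, ENNReal.toReal_ofReal hp0,
    ENNReal.toReal_ofReal (sub_nonneg.2 hp1)]
  rfl

lemma isAdmissibleInput_two_point {P p : ℝ} (hp0 : 0 ≤ p) (hp1 : p ≤ 1) {a b : ℝ}
    (h : p * a ^ 2 + (1 - p) * b ^ 2 ≤ P) :
    IsAdmissibleInput P
      (ENNReal.ofReal p • Measure.dirac a + ENNReal.ofReal (1 - p) • Measure.dirac b) where
  isProbabilityMeasure := ⟨by
    simp only [Measure.coe_add, Measure.coe_smul, Pi.add_apply, Pi.smul_apply, measure_univ,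
      smul_eq_mul, mul_one]
    rw [← ENNReal.ofReal_add hp0 (sub_nonneg.2 hp1)]
    simp⟩
  power_le := by
    rw [lintegral_add_measure, lintegral_smul_measure, lintegral_smul_measure, lintegral_dirac,
      lintegral_dirac, smul_eq_mul, smul_eq_mul, ← ENNReal.ofReal_mul hp0,
      ← ENNReal.ofReal_mul (sub_nonneg.2 hp1), ← ENNReal.ofReal_add (by positivity)
        (mul_nonneg (sub_nonneg.2 hp1) (sq_nonneg _))]
    exact ENNReal.ofReal_le_ofReal h

lemma resp_hard_shift (D : Set ℝ) (m x : ℝ) :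
    resp (hard {y | y + m ∈ D}) (x - m) = resp (hard D) x := by
  simp only [resp]
  rw [← integral_add_right_eq_self (fun y => hard D y * npdf (y - x)) m]
  refine integral_congr_ae (ae_of_all _ fun y => ?_)
  simp only
  rw [show y - (x - m) = y + m - x by ring]
  rfl

/-- A continuous function negative at one point of an open set is negative on a set of positive
measure. This upgrades almost sure sign conditions to boundary points of the region. -/
lemma nonneg_on_closure {g : ℝ → ℝ} (hg : Continuous g) {U : Set ℝ} (hU : IsOpen U)
    (h : ∀ᵐ y, y ∈ U → 0 ≤ g y) : ∀ y ∈ closure U, 0 ≤ g y := by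
  have hV : IsOpen (U ∩ {y | g y < 0}) := hU.inter (isOpen_lt hg continuous_const)
  have h0 : volume (U ∩ {y | g y < 0}) = 0 := by
    refine measure_mono_null ?_ (ae_iff.1 h)
    rintro y ⟨hy, hy'⟩
    simp only [Set.mem_ofPred_eq] at hy' ⊢
    push Not
    exact ⟨hy, hy'⟩
  have hemp := (hV.measure_eq_zero_iff volume).1 h0
  have hsub : U ⊆ {y | 0 ≤ g y} := fun y hy => by
    by_contra hn
    have : y ∈ U ∩ {y | g y < 0} := ⟨hy, show g y < 0 from not_le.1 hn⟩
    rw [hemp] at this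
    exact this
  exact fun y hy => closure_minimal hsub (isClosed_le continuous_const hg) hy

namespace IsOpt

variable {P : ℝ} {μ : Measure ℝ} {D : Set ℝ}

lemma of_info_eq (h : IsOpt P μ D) {μ' : Measure ℝ} {D' : Set ℝ} (hμ' : IsAdmissibleInput P μ')
    (hD' : MeasurableSet D') (he : info μ' (resp (hard D')) = info μ (resp (hard D))) :
    IsOpt P μ' D' :=
  ⟨hμ', hD', fun μ'' h'' D'' hD'' => he ▸ h.le μ'' h'' D'' hD''⟩

lemma congr_ae (h : IsOpt P μ D) {D' : Set ℝ} (hD' : MeasurableSet D')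
    (he : D =ᵐ[volume] D') : IsOpt P μ D' := by
  refine h.of_info_eq h.adm hD' ?_
  have : hard D =ᵐ[volume] hard D' := indicator_ae_eq_of_ae_eq_set he
  rw [resp_congr this]

lemma compl (h : IsOpt P μ D) : IsOpt P μ Dᶜ := by
  have := h.adm.isProbabilityMeasure
  refine h.of_info_eq h.adm h.meas.compl ?_
  have hs := isSoftTest_hard h.meas
  have e : resp (hard Dᶜ) = fun x => 1 - resp (hard D) x := by
    rw [hard_compl]; exact funext hs.resp_one_sub
  rw [info, info, e, hs.isSoftTest_resp.integral_one_sub]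
  simp

/-- Equiprobable antipodal inputs of power `P` induce different Gaussian laws, some set
distinguishes them, and strict concavity of entropy gives positive information. -/
lemma info_pos (h : IsOpt P μ D) (hP : 0 < P) : 0 < info μ (resp (hard D)) := by
  have hr : 0 < √P := Real.sqrt_pos.2 hP
  have hne : gaussianReal √P 1 ≠ gaussianReal (-√P) 1 := fun he => by
    have := (gaussianReal_ext_iff.1 he).1
    linarith
  obtain ⟨E, hE, hEne⟩ : ∃ E, MeasurableSet E ∧ resp (hard E) √P ≠ resp (hard E) (-√P) := by
    by_contra! hcon
    refine hne (Measure.ext fun E hE => ?_)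
    have := hcon E hE
    rw [resp_hard hE, resp_hard hE, measureReal_def, measureReal_def] at this
    exact (ENNReal.toReal_eq_toReal_iff' (measure_ne_top _ _) (measure_ne_top _ _)).1 this
  have hadm := isAdmissibleInput_two_point (P := P) (p := 1 / 2) (a := √P) (b := -√P)
    (by norm_num) (by norm_num) (by rw [neg_sq, Real.sq_sqrt hP.le]; linarith)
  refine lt_of_lt_of_le ?_ (h.le _ hadm E hE)
  rw [info, integral_two_point (by norm_num) (by norm_num),
    integral_two_point (by norm_num) (by norm_num)]
  have hs := (isSoftTest_hard hE).isSoftTest_resp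
  obtain ⟨-, hconc⟩ := Real.strictConcave_binEntropy
  have := hconc ⟨hs.nonneg √P, hs.le_one √P⟩
    ⟨hs.nonneg (-√P), hs.le_one (-√P)⟩ hEne (show (0 : ℝ) < 1 / 2 by norm_num)
    (show (0 : ℝ) < 1 - 1 / 2 by norm_num) (by norm_num)
  simp only [smul_eq_mul] at this
  linarith

lemma isProperTest (h : IsOpt P μ D) (hP : 0 < P) : IsProperTest (hard D) := by
  have := h.adm.isProbabilityMeasure
  exact (isSoftTest_hard h.meas).isProperTest_of_info_pos (h.info_pos hP)

/-- Unused power could be spent on amplification, which strictly increases the information. -/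
lemma integral_sq (h : IsOpt P μ D) (hP : 0 < P) : ∫ x, x ^ 2 ∂μ = P := by
  have := h.adm.isProbabilityMeasure
  refine le_antisymm (h.adm.integral_sq_le hP.le) (not_lt.1 fun hlt => ?_)
  obtain ⟨s, hs, hsP⟩ : ∃ s : ℝ, 1 < s ∧ s ^ 2 * ∫ x, x ^ 2 ∂μ ≤ P := by
    have hm : 0 ≤ ∫ x, x ^ 2 ∂μ := integral_nonneg fun x => sq_nonneg x
    rcases hm.eq_or_lt with h0 | h0
    · exact ⟨2, by norm_num, by rw [← h0]; linarith⟩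
    · refine ⟨√(P / ∫ x, x ^ 2 ∂μ), ?_, ?_⟩
      · rw [Real.lt_sqrt zero_le_one, one_pow, lt_div_iff₀ h0]
        linarith
      · rw [Real.sq_sqrt (by positivity), div_mul_cancel₀ _ h0.ne']
  obtain ⟨D', hD', hlt'⟩ := exists_info_lt_info_map_mul h.adm.integrable_sq h.meas
    (h.info_pos hP) hs
  have hpm : IsProbabilityMeasure (μ.map (s * ·)) := Measure.isProbabilityMeasure_map (by fun_prop)
  have hadm : IsAdmissibleInput P (μ.map (s * ·)) := by
    refine isAdmissibleInput_of_integral_sq_le ?_ ?_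
    · rw [integrable_map_measure (by fun_prop) (by fun_prop)]
      simp only [Function.comp_def, mul_pow]
      exact h.adm.integrable_sq.const_mul _
    · rw [integral_map (by fun_prop) (by fun_prop)]
      simp only [mul_pow]
      rwa [integral_const_mul]
  exact absurd (h.le _ hadm D' hD') (not_le.2 hlt')

/-- Translating input and region together by the mean `m` keeps the information and lowers the power
to `P - m ^ 2`. The translated pair is still optimal, so it too must use power `P`. -/
lemma integral_id (h : IsOpt P μ D) (hP : 0 < P) : ∫ x, x ∂μ = 0 := by
  have := h.adm.isProbabilityMeasure
  set m := ∫ x, x ∂μ with hm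
  have hpm : IsProbabilityMeasure (μ.map (· - m)) := Measure.isProbabilityMeasure_map (by fun_prop)
  have i2 := h.adm.integrable_sq
  have i1 := integrable_id_of_integrable_sq i2
  have e : ∀ x : ℝ, (x - m) ^ 2 = x ^ 2 - 2 * m * x + m ^ 2 := fun x => by ring
  have i3 : Integrable (fun x => x ^ 2 - 2 * m * x) μ := i2.sub (i1.const_mul _)
  have hsq : ∫ x, x ^ 2 ∂(μ.map (· - m)) = P - m ^ 2 := by
    rw [integral_map (by fun_prop) (by fun_prop)]
    simp only [e]
    rw [integral_add i3 (integrable_const _), integral_sub i2 (i1.const_mul _),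
      integral_const_mul, ← hm, h.integral_sq hP]
    simp
    ring
  have hadm : IsAdmissibleInput P (μ.map (· - m)) := by
    refine isAdmissibleInput_of_integral_sq_le ?_ (by rw [hsq]; linarith [sq_nonneg m])
    rw [integrable_map_measure (by fun_prop) (by fun_prop)]
    simp only [Function.comp_def, e]
    exact i3.add (integrable_const _)
  have hD' : MeasurableSet {y | y + m ∈ D} := (measurable_add_const m) h.meas
  have hopt : IsOpt P (μ.map (· - m)) {y | y + m ∈ D} := by
    refine h.of_info_eq hadm hD' ?_
    rw [info_map (by fun_prop) (isSoftTest_hard hD').continuous_resp.measurable]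
    simp only [resp_hard_shift]
  have := hopt.integral_sq hP
  rw [hsq] at this
  exact pow_eq_zero_iff two_ne_zero |>.1 (by linarith)

lemma ae_sign_scoreConv (h : IsOpt P μ D) (hP : 0 < P) :
    ∀ᵐ y, (y ∈ D → 0 ≤ scoreConv μ (resp (hard D)) y) ∧
      (y ∉ D → scoreConv μ (resp (hard D)) y ≤ 0) := by
  have := h.adm.isProbabilityMeasure
  have hp := h.isProperTest hP
  filter_upwards [ae_eq_zero_of_info_hard_le hp h.adm.integrable_sq
    (h.le _ h.adm _ (measurableSet_scoreConv_pos hp h.adm.integrable_sq))] with y hy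
  constructor
  · intro hyD
    by_contra hn
    have h1 : y ∉ {y | 0 < scoreConv μ (resp (hard D)) y} := fun h' => hn (le_of_lt h')
    rcases mul_eq_zero.1 hy with h2 | h2
    · rw [hard_of_mem hyD, hard_of_notMem h1] at h2
      norm_num at h2
    · exact hn h2.ge
  · intro hyD
    by_contra hn
    have h1 : y ∈ {y | 0 < scoreConv μ (resp (hard D)) y} := not_le.1 hn
    rcases mul_eq_zero.1 hy with h2 | h2
    · rw [hard_of_mem h1, hard_of_notMem hyD] at h2
      norm_num at h2
    · exact hn h2.le

lemma continuous_scoreConv (h : IsOpt P μ D) (hP : 0 < P) :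
    Continuous (scoreConv μ (resp (hard D))) := by
  have := h.adm.isProbabilityMeasure
  exact continuous_integral_mul_npdf_sub ((h.isProperTest hP).integrable_score h.adm.integrable_sq)

lemma scoreConv_nonneg (h : IsOpt P μ D) (hP : 0 < P) {y : ℝ} (hy : y ∈ closure (interior D)) :
    0 ≤ scoreConv μ (resp (hard D)) y :=
  nonneg_on_closure (h.continuous_scoreConv hP) isOpen_interior (by
    filter_upwards [h.ae_sign_scoreConv hP] with z hz hzD using hz.1 (interior_subset hzD)) y hy

lemma scoreConv_nonpos (h : IsOpt P μ D) (hP : 0 < P) {y : ℝ} (hy : y ∈ closure (interior Dᶜ)) :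
    scoreConv μ (resp (hard D)) y ≤ 0 := by
  have := nonneg_on_closure (h.continuous_scoreConv hP).neg isOpen_interior (U := interior Dᶜ) (by
    filter_upwards [h.ae_sign_scoreConv hP] with z hz hzD
    have := hz.2 (interior_subset hzD)
    simpa using this) y hy
  simpa using this

lemma scoreConv_eq_zero (h : IsOpt P μ D) (hP : 0 < P) {y : ℝ} (hy : y ∈ closure (interior D))
    (hy' : y ∈ closure (interior Dᶜ)) : scoreConv μ (resp (hard D)) y = 0 :=
  le_antisymm (h.scoreConv_nonpos hP hy') (h.scoreConv_nonneg hP hy)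

end IsOpt

/-! ### Reweighting the input law -/

/-- The measure `μ` reweighted by the density `1 + w`. -/
def reweight (μ : Measure ℝ) (w : ℝ → ℝ) : Measure ℝ :=
  μ.withDensity fun x => ENNReal.ofReal (1 + w x)

section Reweight

variable {μ : Measure ℝ} {w : ℝ → ℝ}

lemma integral_reweight (hw : Continuous w) (hw1 : ∀ x, |w x| ≤ 1) (u : ℝ → ℝ) :
    ∫ x, u x ∂(reweight μ w) = ∫ x, (1 + w x) * u x ∂μ := by
  rw [reweight, integral_withDensity_eq_integral_toReal_smul (by fun_prop)
    (ae_of_all _ fun _ => ENNReal.ofReal_lt_top)]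
  refine integral_congr_ae (ae_of_all _ fun x => ?_)
  simp only [smul_eq_mul]
  rw [ENNReal.toReal_ofReal (by linarith [(abs_le.1 (hw1 x)).1])]

lemma integrable_mul_of_abs_le (hw : Continuous w) (hw1 : ∀ x, |w x| ≤ 1) {u : ℝ → ℝ}
    (hu : Integrable u μ) : Integrable (fun x => w x * u x) μ :=
  hu.bdd_mul (c := 1) hw.aestronglyMeasurable (ae_of_all _ hw1)

lemma integral_reweight_eq_add (hw : Continuous w) (hw1 : ∀ x, |w x| ≤ 1) {u : ℝ → ℝ}
    (hu : Integrable u μ) : ∫ x, u x ∂(reweight μ w) = ∫ x, u x ∂μ + ∫ x, w x * u x ∂μ := by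
  rw [integral_reweight hw hw1, ← integral_add hu (integrable_mul_of_abs_le hw hw1 hu)]
  simp only [add_mul, one_mul]

lemma integrable_reweight (hw : Continuous w) (hw1 : ∀ x, |w x| ≤ 1) {u : ℝ → ℝ}
    (hu : Integrable u μ) : Integrable u (reweight μ w) := by
  rw [reweight, integrable_withDensity_iff_integrable_smul' (by fun_prop)
    (ae_of_all _ fun _ => ENNReal.ofReal_lt_top)]
  refine (hu.add (integrable_mul_of_abs_le hw hw1 hu)).congr (ae_of_all _ fun x => ?_)
  simp only [Pi.add_apply, smul_eq_mul]
  rw [ENNReal.toReal_ofReal (by linarith [(abs_le.1 (hw1 x)).1])]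
  ring

lemma isProbabilityMeasure_reweight [IsProbabilityMeasure μ] (hw : Continuous w)
    (hw1 : ∀ x, |w x| ≤ 1) (h0 : ∫ x, w x ∂μ = 0) : IsProbabilityMeasure (reweight μ w) := by
  have h := integral_reweight_eq_add (μ := μ) hw hw1 (u := fun _ => (1 : ℝ)) (integrable_const _)
  simp only [integral_const, smul_eq_mul, mul_one, probReal_univ, h0, add_zero] at h
  refine ⟨?_⟩
  rw [measureReal_def] at h
  exact (ENNReal.toReal_eq_one_iff _).1 h

end Reweight

/-- A linear functional vanishing on the common kernel of finitely many others is a combination of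
them. The resulting identity of functionals becomes one of functions by testing the difference `n`
against the bounded function `n / (1 + n ^ 2)`. -/
lemma exists_ae_eq_sum_of_forall_integral_eq_zero {μ : Measure ℝ} [IsProbabilityMeasure μ]
    {ι : Type*} [Fintype ι] {v : ι → ℝ → ℝ} {e : ℝ → ℝ} (hv : ∀ i, Integrable (v i) μ)
    (hvc : ∀ i, Continuous (v i)) (he : Integrable e μ) (hec : Continuous e)
    (H : ∀ w : ℝ →ᵇ ℝ, (∀ i, ∫ x, w x * v i x ∂μ = 0) → ∫ x, w x * e x ∂μ = 0) :
    ∃ c : ι → ℝ, ∀ᵐ x ∂μ, e x = ∑ i, c i * v i x := by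
  have hintg : ∀ (w : ℝ →ᵇ ℝ) {u : ℝ → ℝ}, Integrable u μ → Integrable (fun x => w x * u x) μ :=
    fun w u hu => hu.bdd_mul (c := ‖w‖) w.continuous.aestronglyMeasurable
      (ae_of_all _ w.norm_coe_le_norm)
  let L : {u : ℝ → ℝ // Integrable u μ} → (ℝ →ᵇ ℝ) →ₗ[ℝ] ℝ := fun u =>
    { toFun := fun w => ∫ x, w x * u.1 x ∂μ
      map_add' := fun w w' => by
        simp only [BoundedContinuousFunction.coe_add, Pi.add_apply, add_mul]
        exact integral_add (hintg w u.2) (hintg w' u.2)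
      map_smul' := fun c w => by
        simp only [BoundedContinuousFunction.coe_smul, smul_eq_mul, mul_assoc, RingHom.id_apply]
        exact integral_const_mul _ _ }
  have hmem : L ⟨e, he⟩ ∈ Submodule.span ℝ (Set.range fun i => L ⟨v i, hv i⟩) := by
    refine mem_span_of_iInf_ker_le_ker fun w hw => ?_
    simp only [Submodule.mem_iInf, LinearMap.mem_ker] at hw ⊢
    exact H w hw
  obtain ⟨c, hc⟩ := (Submodule.mem_span_range_iff_exists_fun ℝ).1 hmem
  refine ⟨c, ?_⟩
  set n : ℝ → ℝ := fun x => e x - ∑ i, c i * v i x with hn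
  have hnc : Continuous n := by fun_prop
  have hw0 : ∀ w : ℝ →ᵇ ℝ, ∫ x, w x * n x ∂μ = 0 := fun w => by
    have h := congrArg (fun T => T w) hc
    simp only [LinearMap.sum_apply, LinearMap.smul_apply, smul_eq_mul] at h
    change ∑ i, c i * ∫ x, w x * v i x ∂μ = ∫ x, w x * e x ∂μ at h
    have i1 : ∀ i ∈ Finset.univ, Integrable (fun x => c i * (w x * v i x)) μ :=
      fun i _ => (hintg w (hv i)).const_mul _
    have e1 : ∀ x, w x * n x = w x * e x - ∑ i, c i * (w x * v i x) := fun x => by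
      simp only [hn, mul_sub, Finset.mul_sum]
      congr 1
      exact Finset.sum_congr rfl fun i _ => by ring
    simp only [e1]
    rw [integral_sub (hintg w he) (integrable_finsetSum _ i1), integral_finsetSum _ i1]
    simp only [integral_const_mul]
    rw [h, sub_self]
  have hb : ∀ x, ‖n x / (1 + n x ^ 2)‖ ≤ 1 := fun x => by
    rw [Real.norm_eq_abs, abs_div, abs_of_pos (by positivity : 0 < 1 + n x ^ 2),
      div_le_one (by positivity), abs_le]
    constructor <;> nlinarith [sq_nonneg (n x + 1), sq_nonneg (n x - 1)]
  let w : ℝ →ᵇ ℝ := BoundedContinuousFunction.ofNormedAddCommGroup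
    (fun x => n x / (1 + n x ^ 2)) (hnc.div (by fun_prop) fun x => by positivity) 1 hb
  have hnint : Integrable n μ :=
    he.sub (integrable_finsetSum _ fun i _ => (hv i).const_mul (c i))
  have h1 := hw0 w
  have hnn : 0 ≤ fun x => w x * n x := fun x => by
    have : w x * n x = n x ^ 2 / (1 + n x ^ 2) := by
      change n x / (1 + n x ^ 2) * n x = _
      ring
    simp only [this, Pi.zero_apply]
    positivity
  filter_upwards [(integral_eq_zero_iff_of_nonneg hnn (hintg w hnint)).1 h1] with x hx
  have hx' : n x / (1 + n x ^ 2) * n x = 0 := hx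
  have hpos : (1 + n x ^ 2) ≠ 0 := by positivity
  have : n x = 0 := by
    rcases mul_eq_zero.1 hx' with h | h
    · rcases div_eq_zero_iff.1 h with h | h
      · exact h
      · exact absurd h hpos
    · exact h
  linarith [show n x = e x - ∑ i, c i * v i x from rfl]

namespace IsOpt

variable {P : ℝ} {μ : Measure ℝ} {D : Set ℝ} {w : ℝ → ℝ}

lemma continuous_resp (h : IsOpt P μ D) : Continuous (resp (hard D)) :=
  (isSoftTest_hard h.meas).continuous_resp

/-- The constraints on `w` make the information affine in `w` and keep both densities `1 + w` and `1
- w` admissible. An affine function with an interior maximum is constant, so the reweighted law is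
optimal again. -/
lemma reweight (h : IsOpt P μ D) (hP : 0 < P) (hw : Continuous w) (hw1 : ∀ x, |w x| ≤ 1)
    (h0 : ∫ x, w x ∂μ = 0) (h2 : ∫ x, w x * x ^ 2 ∂μ = 0)
    (hf : ∫ x, w x * resp (hard D) x ∂μ = 0) : IsOpt P (reweight μ w) D := by
  have := h.adm.isProbabilityMeasure
  have hs := (isSoftTest_hard h.meas).isSoftTest_resp
  have i2 := h.adm.integrable_sq
  have key : ∀ w : ℝ → ℝ, Continuous w → (∀ x, |w x| ≤ 1) → ∫ x, w x ∂μ = 0 →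
      ∫ x, w x * x ^ 2 ∂μ = 0 → ∫ x, w x * resp (hard D) x ∂μ = 0 →
      IsAdmissibleInput P (OneBitChannel.reweight μ w) ∧
      info (OneBitChannel.reweight μ w) (resp (hard D)) = info μ (resp (hard D)) -
        ∫ x, w x * Real.binEntropy (resp (hard D) x) ∂μ := by
    intro w hw hw1 h0 h2 hf
    have hpm := isProbabilityMeasure_reweight hw hw1 h0
    refine ⟨isAdmissibleInput_of_integral_sq_le (integrable_reweight hw hw1 i2) ?_, ?_⟩
    · rw [integral_reweight_eq_add hw hw1 i2, h2, add_zero, h.integral_sq hP]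
    · rw [info, info, integral_reweight_eq_add hw hw1 hs.integrable, hf, add_zero,
        integral_reweight_eq_add hw hw1 hs.integrable_binEntropy]
      ring
  obtain ⟨hadm, hinfo⟩ := key w hw hw1 h0 h2 hf
  obtain ⟨hadm', hinfo'⟩ := key (fun x => -w x) hw.neg (fun x => by rw [abs_neg]; exact hw1 x)
    (by rw [integral_neg, h0, neg_zero]) (by simp only [neg_mul]; rw [integral_neg, h2, neg_zero])
    (by simp only [neg_mul]; rw [integral_neg, hf, neg_zero])
  simp only [neg_mul] at hinfo'
  rw [integral_neg] at hinfo'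
  have l1 := h.le _ hadm D h.meas
  have l2 := h.le _ hadm' D h.meas
  exact h.of_info_eq hadm h.meas (by linarith)

/-- A property of the reweighting direction that is linear holds for every bounded direction once
it holds for those of size at most one. -/
lemma integral_mul_eq_zero_of_bounded {u : ℝ → ℝ} (hu : ∀ w : ℝ → ℝ, Continuous w →
      (∀ x, |w x| ≤ 1) → ∫ x, w x ∂μ = 0 → ∫ x, w x * x ^ 2 ∂μ = 0 →
      ∫ x, w x * resp (hard D) x ∂μ = 0 → ∫ x, w x * u x ∂μ = 0)
    (w : ℝ →ᵇ ℝ) (h0 : ∫ x, w x ∂μ = 0) (h2 : ∫ x, w x * x ^ 2 ∂μ = 0)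
    (hf : ∫ x, w x * resp (hard D) x ∂μ = 0) : ∫ x, w x * u x ∂μ = 0 := by
  have hpos : 0 < ‖w‖ + 1 := by positivity
  have := hu (fun x => (‖w‖ + 1)⁻¹ * w x) (by fun_prop) (fun x => by
      rw [abs_mul, abs_of_pos (inv_pos.2 hpos), inv_mul_le_one₀ hpos]
      have := w.norm_coe_le_norm x
      rw [Real.norm_eq_abs] at this
      linarith)
    (by rw [integral_const_mul, h0, mul_zero])
    (by simp only [mul_assoc]; rw [integral_const_mul, h2, mul_zero])
    (by simp only [mul_assoc]; rw [integral_const_mul, hf, mul_zero])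
  simp only [mul_assoc] at this
  rw [integral_const_mul] at this
  exact (mul_eq_zero.1 this).resolve_left (inv_pos.2 hpos).ne'

/-- Both the original and the reweighted law are optimal, hence both are centered. -/
lemma integral_mul_id_eq_zero (h : IsOpt P μ D) (hP : 0 < P) (w : ℝ →ᵇ ℝ)
    (h0 : ∫ x, w x ∂μ = 0) (h2 : ∫ x, w x * x ^ 2 ∂μ = 0)
    (hf : ∫ x, w x * resp (hard D) x ∂μ = 0) : ∫ x, w x * x ∂μ = 0 := by
  have := h.adm.isProbabilityMeasure
  refine integral_mul_eq_zero_of_bounded (fun w hw hw1 h0 h2 hf => ?_) w h0 h2 hf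
  have h1 := (h.reweight hP hw hw1 h0 h2 hf).integral_id hP
  rwa [integral_reweight_eq_add hw hw1 (integrable_id_of_integrable_sq h.adm.integrable_sq),
    h.integral_id hP, zero_add] at h1

/-- Reweighting keeps the average response, hence the score function. Both laws are optimal for the
same region, so both smoothed scores vanish at `y`. -/
lemma integral_mul_score_eq_zero (h : IsOpt P μ D) (hP : 0 < P) {y : ℝ}
    (hy : y ∈ closure (interior D)) (hy' : y ∈ closure (interior Dᶜ)) (w : ℝ →ᵇ ℝ)
    (h0 : ∫ x, w x ∂μ = 0) (h2 : ∫ x, w x * x ^ 2 ∂μ = 0)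
    (hf : ∫ x, w x * resp (hard D) x ∂μ = 0) :
    ∫ x, w x * (score μ (resp (hard D)) x * npdf (y - x)) ∂μ = 0 := by
  have := h.adm.isProbabilityMeasure
  refine integral_mul_eq_zero_of_bounded (fun w hw hw1 h0 h2 hf => ?_) w h0 h2 hf
  have hs := (isSoftTest_hard h.meas).isSoftTest_resp
  have h1 := (h.reweight hP hw hw1 h0 h2 hf).scoreConv_eq_zero hP hy hy'
  have e : score (OneBitChannel.reweight μ w) (resp (hard D)) = score μ (resp (hard D)) := by
    ext x
    rw [score, score, integral_reweight_eq_add hw hw1 hs.integrable, hf, add_zero]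
  have hz := h.scoreConv_eq_zero hP hy hy'
  rw [scoreConv] at h1 hz
  rwa [e, integral_reweight_eq_add hw hw1 (integrable_mul_npdf_sub
    ((h.isProperTest hP).integrable_score h.adm.integrable_sq) y), hz, zero_add] at h1

/-- Either the input is a root of a nontrivial quadratic, or the channel response is quadratic on
the support of the input law. -/
lemma ae_quadratic (h : IsOpt P μ D) (hP : 0 < P) :
    (∃ α β : ℝ, ∀ᵐ x ∂μ, x = α + β * x ^ 2) ∨
      ∃ A B C : ℝ, ∀ᵐ x ∂μ, resp (hard D) x = A + B * x + C * x ^ 2 := by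
  have := h.adm.isProbabilityMeasure
  have hs := (isSoftTest_hard h.meas).isSoftTest_resp
  obtain ⟨c, hc⟩ := exists_ae_eq_sum_of_forall_integral_eq_zero (μ := μ)
    (v := ![fun _ => 1, fun x => x ^ 2, resp (hard D)]) (e := fun x => x)
    (by
      intro i
      fin_cases i
      exacts [integrable_const _, h.adm.integrable_sq, hs.integrable])
    (by
      intro i
      fin_cases i
      exacts [continuous_const, continuous_pow 2, h.continuous_resp])
    (integrable_id_of_integrable_sq h.adm.integrable_sq) continuous_id
    (fun w hw => h.integral_mul_id_eq_zero hP w (by simpa using hw 0) (hw 1) (hw 2))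
  simp only [Fin.sum_univ_three, Matrix.cons_val] at hc
  rcases eq_or_ne (c 2) 0 with h0 | h0
  · exact .inl ⟨c 0, c 1, hc.mono fun x hx => by rw [h0] at hx; linarith⟩
  · refine .inr ⟨-c 0 / c 2, 1 / c 2, -c 1 / c 2, hc.mono fun x hx => ?_⟩
    field_simp
    linarith

/-- When the response is quadratic on the support, the weighted score at a boundary point of the
region is quadratic on the support, and centered. -/
lemma ae_score_quadratic (h : IsOpt P μ D) (hP : 0 < P) {A B C : ℝ}
    (hQ : ∀ᵐ x ∂μ, resp (hard D) x = A + B * x + C * x ^ 2) {y : ℝ}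
    (hy : y ∈ closure (interior D)) (hy' : y ∈ closure (interior Dᶜ)) :
    ∃ r s : ℝ, ∀ᵐ x ∂μ, score μ (resp (hard D)) x * npdf (y - x) = r * (x ^ 2 - P) + s * x := by
  have := h.adm.isProbabilityMeasure
  have hp := h.isProperTest hP
  have i2 := h.adm.integrable_sq
  have i1 := integrable_id_of_integrable_sq i2
  have hu := integrable_mul_npdf_sub (hp.integrable_score i2) y
  have hcs : Continuous (score μ (resp (hard D))) := by
    unfold score entSlope
    have hc := h.continuous_resp
    exact continuous_const.sub (((continuous_const.sub hc).log
      fun x => (sub_pos.2 (hp.resp_lt_one x)).ne').sub (hc.log fun x => (hp.resp_pos x).ne'))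
  obtain ⟨c, hc⟩ := exists_ae_eq_sum_of_forall_integral_eq_zero (μ := μ)
    (v := ![fun _ => 1, fun x => x ^ 2, fun x => x])
    (e := fun x => score μ (resp (hard D)) x * npdf (y - x))
    (by
      intro i
      fin_cases i
      exacts [integrable_const _, i2, i1])
    (by
      intro i
      fin_cases i
      exacts [continuous_const, continuous_pow 2, continuous_id])
    hu (by fun_prop) (fun w hw => by
      have w0 : ∫ x, w x * 1 ∂μ = 0 := hw 0
      have w2 : ∫ x, w x * x ^ 2 ∂μ = 0 := hw 1
      have w1 : ∫ x, w x * x ∂μ = 0 := hw 2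
      simp only [mul_one] at w0
      refine h.integral_mul_score_eq_zero hP hy hy' w w0 w2 ?_
      have hintg : ∀ {u : ℝ → ℝ}, Integrable u μ → Integrable (fun x => w x * u x) μ :=
        fun hu => hu.bdd_mul (c := ‖w‖) w.continuous.aestronglyMeasurable
          (ae_of_all _ w.norm_coe_le_norm)
      have iw : Integrable (fun x => w x) μ := by simpa using hintg (integrable_const (1 : ℝ))
      have i3 : Integrable (fun x => A * w x + B * (w x * x)) μ :=
        (iw.const_mul A).add ((hintg i1).const_mul B)
      rw [integral_congr_ae (g := fun x => A * w x + B * (w x * x) + C * (w x * x ^ 2))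
        (hQ.mono fun x hx => by simp only [hx]; ring), integral_add i3 ((hintg i2).const_mul C),
        integral_add (iw.const_mul A) ((hintg i1).const_mul B), integral_const_mul,
        integral_const_mul, integral_const_mul, w0, w1, w2]
      simp)
  simp only [Fin.sum_univ_three, Matrix.cons_val] at hc
  -- Integrating the relation just found, with mean zero and second moment `P`, fixes the constant
  -- term as `-(c 1) * P`.
  have hz := h.scoreConv_eq_zero hP hy hy'
  have i4 : Integrable (fun x => c 0 * 1 + c 1 * x ^ 2) μ :=
    (integrable_const _).add (i2.const_mul _)
  rw [scoreConv, integral_congr_ae hc, integral_add i4 (i1.const_mul _),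
    integral_add (integrable_const _) (i2.const_mul _), integral_const_mul, integral_const_mul,
    integral_const_mul, h.integral_sq hP, h.integral_id hP] at hz
  simp at hz
  refine ⟨c 1, c 2, hc.mono fun x hx => ?_⟩
  rw [hx]
  linarith

end IsOpt

/-! ### Sign changes under smoothing by the normal kernel -/

lemma exists_strictMono_of_lt_encard {S : Set ℝ} {n : ℕ} (h : (n : ℕ∞) < S.encard) :
    ∃ z : Fin (n + 1) → ℝ, StrictMono z ∧ ∀ i, z i ∈ S := by
  obtain ⟨t, htS, ht⟩ := Set.exists_subset_encard_eq (Order.add_one_le_of_lt h)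
  have hfin : t.Finite := Set.finite_of_encard_eq_coe (k := n + 1) (by rw [ht]; rfl)
  lift t to Finset ℝ using hfin
  have hcard : t.card = n + 1 := by
    rw [Set.encard_coe_eq_coe_finsetCard] at ht
    exact_mod_cast ht
  exact ⟨t.orderEmbOfFin hcard, (t.orderEmbOfFin hcard).strictMono,
    fun i => htS (t.orderEmbOfFin_mem hcard i)⟩

lemma strictConvexOn_exp_mul {κ : ℝ} (hκ : κ ≠ 0) {c : ℝ} (hc : 0 < c) :
    StrictConvexOn ℝ Set.univ fun x => c * Real.exp (κ * x) := by
  refine ⟨convex_univ, fun x _ y _ hxy a b ha hb hab => ?_⟩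
  have := strictConvexOn_exp.2 (Set.mem_univ (κ * x)) (Set.mem_univ (κ * y))
    (fun h => hxy (mul_left_cancel₀ hκ h)) ha hb hab
  simp only [smul_eq_mul] at this ⊢
  rw [show κ * (a * x + b * y) = a * (κ * x) + b * (κ * y) by ring]
  nlinarith

/-- A combination of three exponentials with prescribed sign changes. -/
lemma exists_exp_combination {α β d e : ℝ} (hαβ : α < β) (hd : 0 < d) (he : 0 < e) :
    ∃ a > 0, ∃ b > 0, ∀ x, (0 < (x - α) * (β - x) →
        0 < 1 - a * Real.exp (-d * x) - b * Real.exp (e * x)) ∧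
      ((x - α) * (β - x) < 0 → 1 - a * Real.exp (-d * x) - b * Real.exp (e * x) < 0) := by
  have hE : Real.exp (e * α) < Real.exp (e * β) := Real.exp_lt_exp.2 (by nlinarith)
  have hF : Real.exp (-d * β) < Real.exp (-d * α) := Real.exp_lt_exp.2 (by nlinarith)
  have pE := Real.exp_pos (e * α)
  have pF := Real.exp_pos (-d * β)
  set E₁ := Real.exp (e * α)
  set E₂ := Real.exp (e * β)
  set F₁ := Real.exp (-d * α)
  set F₂ := Real.exp (-d * β)
  have hdet : 0 < F₁ * E₂ - F₂ * E₁ := by nlinarith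
  -- Cramer's rule for the system making `a * exp (-d * x) + b * exp (e * x)` equal to `1` at both
  -- `α` and `β`. Strict convexity then puts it below `1` exactly between them.
  set a := (E₂ - E₁) / (F₁ * E₂ - F₂ * E₁) with ha
  set b := (F₁ - F₂) / (F₁ * E₂ - F₂ * E₁) with hb
  have ha0 : 0 < a := div_pos (sub_pos.2 hE) hdet
  have hb0 : 0 < b := div_pos (sub_pos.2 hF) hdet
  have hα : a * F₁ + b * E₁ = 1 := by
    rw [ha, hb, div_mul_eq_mul_div, div_mul_eq_mul_div, ← add_div, div_eq_one_iff_eq hdet.ne']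
    ring
  have hβ : a * F₂ + b * E₂ = 1 := by
    rw [ha, hb, div_mul_eq_mul_div, div_mul_eq_mul_div, ← add_div, div_eq_one_iff_eq hdet.ne']
    ring
  have hconv : StrictConvexOn ℝ Set.univ fun x => a * Real.exp (-d * x) + b * Real.exp (e * x) :=
    (strictConvexOn_exp_mul (neg_ne_zero.2 hd.ne') ha0).add (strictConvexOn_exp_mul he.ne' hb0)
  have hmid : ∀ u v x : ℝ, u < x → x < v → a * Real.exp (-d * u) + b * Real.exp (e * u) ≤ 1 →
      a * Real.exp (-d * v) + b * Real.exp (e * v) ≤ 1 →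
      a * Real.exp (-d * x) + b * Real.exp (e * x) < 1 := by
    intro u v x hux hxv hu hv
    have := hconv.lt_on_openSegment (Set.mem_univ u) (Set.mem_univ v) (hux.trans hxv).ne
      (by rw [openSegment_eq_Ioo (hux.trans hxv)]; exact ⟨hux, hxv⟩)
    exact this.trans_le (max_le hu hv)
  refine ⟨a, ha0, b, hb0, fun x => ⟨fun h => ?_, fun h => ?_⟩⟩
  · have : α < x ∧ x < β := by
      rcases mul_pos_iff.1 h with h | h
      · exact ⟨by linarith [h.1], by linarith [h.2]⟩
      · linarith [h.1, h.2]
    linarith [hmid α β x this.1 this.2 hα.le hβ.le]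
  · by_contra hn
    have hx : a * Real.exp (-d * x) + b * Real.exp (e * x) ≤ 1 := by linarith
    rcases mul_neg_iff.1 h with h | h
    · exact (hmid α x β hαβ (by linarith [h.2]) hα.le hx).ne hβ
    · exact (hmid x β α (by linarith [h.1]) hαβ hx hβ.le).ne hα

section SignChange

variable {μ : Measure ℝ} {s : ℝ → ℝ}

/-- The template `T` carries the common sign pattern of `s` and `k`, so their product is nonnegative
and vanishes only where `s` does. -/
lemma integral_mul_pos_of_sign (hne : ¬ s =ᵐ[μ] 0) {k T : ℝ → ℝ}
    (hsk : Integrable (fun x => s x * k x) μ)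
    (hT : ∀ᵐ x ∂μ, (0 < T x → 0 < s x) ∧ (T x < 0 → s x < 0) ∧ (T x = 0 → s x = 0))
    (hk : ∀ x, (0 < T x → 0 < k x) ∧ (T x < 0 → k x < 0)) : 0 < ∫ x, s x * k x ∂μ := by
  have hnn : ∀ᵐ x ∂μ, 0 ≤ s x * k x := by
    filter_upwards [hT] with x hx
    rcases lt_trichotomy (T x) 0 with h | h | h
    · exact (mul_pos_of_neg_of_neg (hx.2.1 h) ((hk x).2 h)).le
    · rw [hx.2.2 h, zero_mul]
    · exact (mul_pos (hx.1 h) ((hk x).1 h)).le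
  refine lt_of_le_of_ne (integral_nonneg_of_ae hnn) fun h0 => hne ?_
  filter_upwards [hT, (integral_eq_zero_iff_of_nonneg_ae hnn hsk).1 h0.symm] with x hx hx0
  have hx0 : s x * k x = 0 := hx0
  rcases lt_trichotomy (T x) 0 with h | h | h
  · exact absurd hx0 (mul_pos_of_neg_of_neg (hx.2.1 h) ((hk x).2 h)).ne'
  · exact hx.2.2 h
  · exact absurd hx0 (mul_pos (hx.1 h) ((hk x).1 h)).ne'

/-- A function whose sign is that of a concave quadratic with two real roots has, after smoothing by
the normal density, a positivity set without holes. -/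
lemma integral_mul_npdf_pos_of_quadratic (hs : Integrable s μ) (hne : ¬ s =ᵐ[μ] 0) {α β : ℝ}
    (hαβ : α < β) (hT : ∀ᵐ x ∂μ, (0 < (x - α) * (β - x) → 0 < s x) ∧
      ((x - α) * (β - x) < 0 → s x < 0) ∧ ((x - α) * (β - x) = 0 → s x = 0))
    {y₁ y₂ y₃ : ℝ} (h₁₂ : y₁ < y₂) (h₂₃ : y₂ < y₃) (h₁ : 0 ≤ ∫ x, s x * npdf (y₁ - x) ∂μ)
    (h₃ : 0 ≤ ∫ x, s x * npdf (y₃ - x) ∂μ) : 0 < ∫ x, s x * npdf (y₂ - x) ∂μ := by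
  -- Subtracting suitable positive multiples of the kernels at `y₁` and `y₃` from the kernel at `y₂`
  -- leaves a function of `x` with the same sign pattern as `s`; its integral against `s` is
  -- therefore positive.
  obtain ⟨a, ha, b, hb, hk⟩ := exists_exp_combination hαβ (sub_pos.2 h₁₂) (sub_pos.2 h₂₃)
  set A := a * Real.exp ((y₁ ^ 2 - y₂ ^ 2) / 2) with hA
  set B := b * Real.exp ((y₃ ^ 2 - y₂ ^ 2) / 2) with hB
  have i₁ := (integrable_mul_npdf_sub hs y₁).const_mul A
  have i₂ := integrable_mul_npdf_sub hs y₂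
  have i₃ := (integrable_mul_npdf_sub hs y₃).const_mul B
  have i₁₂ : Integrable (fun x => s x * npdf (y₂ - x) - A * (s x * npdf (y₁ - x))) μ := i₂.sub i₁
  have e : ∀ x, s x * npdf (y₂ - x) - A * (s x * npdf (y₁ - x)) - B * (s x * npdf (y₃ - x)) =
      s x * (npdf (y₂ - x) *
        (1 - a * Real.exp (-(y₂ - y₁) * x) - b * Real.exp ((y₃ - y₂) * x))) := by
    intro x
    have e1 : A * npdf (y₁ - x) = a * Real.exp (-(y₂ - y₁) * x) * npdf (y₂ - x) := by
      rw [hA, npdf_sub_eq_mul y₁ y₂ x, ← mul_assoc, ← mul_assoc, mul_assoc a, ← Real.exp_add,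
        mul_assoc a, ← Real.exp_add]
      congr 3
      ring
    have e3 : B * npdf (y₃ - x) = b * Real.exp ((y₃ - y₂) * x) * npdf (y₂ - x) := by
      rw [hB, npdf_sub_eq_mul y₃ y₂ x, ← mul_assoc, ← mul_assoc, mul_assoc b, ← Real.exp_add,
        mul_assoc b, ← Real.exp_add]
      congr 3
      ring
    linear_combination (-s x) * e1 + (-s x) * e3
  have hpos := integral_mul_pos_of_sign (k := fun x => npdf (y₂ - x) *
      (1 - a * Real.exp (-(y₂ - y₁) * x) - b * Real.exp ((y₃ - y₂) * x))) hne
    (by simp only [← e]; exact i₁₂.sub i₃) hT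
    (fun x => ⟨fun h => mul_pos (npdf_pos _) ((hk x).1 h),
      fun h => mul_neg_of_pos_of_neg (npdf_pos _) ((hk x).2 h)⟩)
  simp only [← e] at hpos
  rw [integral_sub i₁₂ i₃, integral_sub i₂ i₁, integral_const_mul, integral_const_mul] at hpos
  have hA0 : 0 < A := by positivity
  have hB0 : 0 < B := by positivity
  nlinarith [mul_nonneg hA0.le h₁, mul_nonneg hB0.le h₃]

/-- The analogue of `integral_mul_npdf_pos_of_quadratic` with a single sign change. -/
lemma integral_mul_npdf_pos_of_linear (hs : Integrable s μ) (hne : ¬ s =ᵐ[μ] 0) {α B : ℝ}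
    (hT : ∀ᵐ x ∂μ, (0 < B * (x - α) → 0 < s x) ∧
      (B * (x - α) < 0 → s x < 0) ∧ (B * (x - α) = 0 → s x = 0))
    {y₁ y₂ : ℝ} (h₁₂ : 0 < B * (y₂ - y₁)) (h₁ : 0 ≤ ∫ x, s x * npdf (y₁ - x) ∂μ) :
    0 < ∫ x, s x * npdf (y₂ - x) ∂μ := by
  -- Chosen so that `A` times the kernel at `y₁` equals the kernel at `y₂` for `x = α`, the only
  -- place where the difference changes sign.
  set A := Real.exp (α * (y₂ - y₁)) * Real.exp ((y₁ ^ 2 - y₂ ^ 2) / 2) with hA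
  have i₁ := (integrable_mul_npdf_sub hs y₁).const_mul A
  have i₂ := integrable_mul_npdf_sub hs y₂
  have e : ∀ x, s x * npdf (y₂ - x) - A * (s x * npdf (y₁ - x)) =
      s x * (npdf (y₂ - x) * (1 - Real.exp ((α - x) * (y₂ - y₁)))) := by
    intro x
    have e1 : A * npdf (y₁ - x) = Real.exp ((α - x) * (y₂ - y₁)) * npdf (y₂ - x) := by
      rw [hA, npdf_sub_eq_mul y₁ y₂ x, ← mul_assoc, ← mul_assoc, ← Real.exp_add, ← Real.exp_add,
        ← Real.exp_add]
      congr 2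
      ring
    linear_combination (-s x) * e1
  have hpos := integral_mul_pos_of_sign (k := fun x => npdf (y₂ - x) *
      (1 - Real.exp ((α - x) * (y₂ - y₁)))) hne (by simp only [← e]; exact i₂.sub i₁) hT
    (fun x => ⟨fun h => mul_pos (npdf_pos _) (sub_pos.2 (Real.exp_lt_one_iff.2 (by
        have : 0 < B ^ 2 * ((x - α) * (y₂ - y₁)) := by nlinarith [mul_pos h h₁₂]
        have := pos_of_mul_pos_right this (sq_nonneg B)
        linarith))),
      fun h => mul_neg_of_pos_of_neg (npdf_pos _) (sub_neg.2 (Real.one_lt_exp_iff.2 (by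
        have : 0 < B ^ 2 * ((α - x) * (y₂ - y₁)) := by nlinarith [mul_pos (neg_pos.2 h) h₁₂]
        exact pos_of_mul_pos_right this (sq_nonneg B))))⟩)
  simp only [← e] at hpos
  rw [integral_sub i₂ i₁, integral_const_mul] at hpos
  have hA0 : 0 < A := by positivity
  nlinarith [mul_nonneg hA0.le h₁]

end SignChange

/-! ### A quadratic response forces a half-line or an interval -/

lemma entSlope_lt_entSlope {p q : ℝ} (hp : 0 < p) (hpq : p < q) (hq : q < 1) :
    entSlope q < entSlope p := by
  have h1 := Real.log_lt_log hp hpq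
  have h2 := Real.log_lt_log (sub_pos.2 hq) (sub_lt_sub_left hpq 1)
  unfold entSlope
  linarith

namespace IsOpt

variable {P : ℝ} {μ : Measure ℝ} {D : Set ℝ}

lemma sign_score (h : IsOpt P μ D) (hP : 0 < P) (x : ℝ) :
    (0 < resp (hard D) x - ∫ x, resp (hard D) x ∂μ → 0 < score μ (resp (hard D)) x) ∧
    (resp (hard D) x - ∫ x, resp (hard D) x ∂μ < 0 → score μ (resp (hard D)) x < 0) ∧
    (resp (hard D) x - ∫ x, resp (hard D) x ∂μ = 0 → score μ (resp (hard D)) x = 0) := by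
  have := h.adm.isProbabilityMeasure
  have hp := h.isProperTest hP
  refine ⟨fun hx => ?_, fun hx => ?_, fun hx => ?_⟩
  · exact sub_pos.2 (entSlope_lt_entSlope hp.integral_resp_pos (by linarith) (hp.resp_lt_one x))
  · exact sub_neg.2 (entSlope_lt_entSlope (hp.resp_pos x) (by linarith) hp.integral_resp_lt_one)
  · rw [score, show resp (hard D) x = ∫ x, resp (hard D) x ∂μ by linarith, sub_self]

/-- A vanishing score would make the gradient zero, and comparison with the constant quantizer would
leave no information. -/
lemma not_score_ae_eq_zero (h : IsOpt P μ D) (hP : 0 < P) :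
    ¬ score μ (resp (hard D)) =ᵐ[μ] 0 := fun h0 => by
  have := h.adm.isProbabilityMeasure
  have hle := info_resp_add_le (h.isProperTest hP) h.adm.integrable_sq
    (isSoftTest_hard MeasurableSet.empty)
  have hz : ∀ y, scoreConv μ (resp (hard D)) y = 0 := fun y => by
    rw [scoreConv, integral_congr_ae (g := fun _ => (0 : ℝ))
      (by filter_upwards [h0] with x hx; rw [hx]; simp), integral_zero]
  have hemp : info μ (resp (hard ∅)) = 0 := by simp [info, resp, hard]
  simp only [hz, mul_zero, integral_zero, add_zero, hemp] at hle
  exact absurd (h.info_pos hP) (not_lt.2 hle)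

/-- The score has the sign of the response minus its mean `q`. That difference integrates to zero,
so a concave quadratic representing it must have two distinct real roots, and a linear one must be
nonconstant; otherwise the score would vanish almost everywhere. -/
lemma scoreConv_pos_of_concave (h : IsOpt P μ D) (hP : 0 < P) {A B C : ℝ} (hC : C ≤ 0)
    (hQ : ∀ᵐ x ∂μ, resp (hard D) x = A + B * x + C * x ^ 2) {y₁ y₂ y₃ : ℝ} (h₁₂ : y₁ < y₂)
    (h₂₃ : y₂ < y₃) (h₁ : 0 ≤ scoreConv μ (resp (hard D)) y₁)
    (h₃ : 0 ≤ scoreConv μ (resp (hard D)) y₃) : 0 < scoreConv μ (resp (hard D)) y₂ := by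
  have := h.adm.isProbabilityMeasure
  have hs := (h.isProperTest hP).integrable_score h.adm.integrable_sq
  have hne := h.not_score_ae_eq_zero hP
  have hf := (isSoftTest_hard h.meas).isSoftTest_resp
  set q := ∫ x, resp (hard D) x ∂μ with hq
  have hmean : ∫ x, (resp (hard D) x - q) ∂μ = 0 := by
    rw [integral_sub hf.integrable (integrable_const _)]; simp [← hq]
  have hfi : Integrable (fun x => resp (hard D) x - q) μ := hf.integrable.sub (integrable_const _)
  rcases hC.lt_or_eq with hC | rfl
  · have hdisc : 0 < B ^ 2 - 4 * C * (A - q) := by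
      by_contra hn
      have hle : ∀ᵐ x ∂μ, 0 ≤ -(resp (hard D) x - q) := by
        filter_upwards [hQ] with x hx
        rw [hx]
        nlinarith [sq_nonneg (2 * C * x + B)]
      refine hne ?_
      have h0 := (integral_eq_zero_iff_of_nonneg_ae hle hfi.neg).1 (by
        rw [integral_neg, hmean, neg_zero])
      filter_upwards [h0] with x hx
      exact (h.sign_score hP x).2.2 (neg_eq_zero.1 hx)
    set t := √(B ^ 2 - 4 * C * (A - q)) with ht
    have ht0 : 0 < t := Real.sqrt_pos.2 hdisc
    have ht2 : t ^ 2 = B ^ 2 - 4 * C * (A - q) := Real.sq_sqrt hdisc.le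
    have hfac : ∀ x, A + B * x + C * x ^ 2 - q =
        (-C) * ((x - (-B + t) / (2 * C)) * ((-B - t) / (2 * C) - x)) := fun x => by
      have hC0 := hC.ne
      field_simp
      linear_combination ht2
    refine integral_mul_npdf_pos_of_quadratic hs hne (α := (-B + t) / (2 * C))
      (β := (-B - t) / (2 * C)) ?_ ?_ h₁₂ h₂₃ h₁ h₃
    · rw [div_lt_div_right_of_neg (by linarith)]
      linarith
    · filter_upwards [hQ] with x hx
      obtain ⟨s1, s2, s3⟩ := h.sign_score hP x
      rw [← hq, hx, hfac x] at s1 s2 s3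
      exact ⟨fun h => s1 (mul_pos (by linarith) h),
        fun h => s2 (mul_neg_of_pos_of_neg (by linarith) h), fun h => s3 (by rw [h, mul_zero])⟩
  · have hB : B ≠ 0 := by
      rintro rfl
      refine hne ?_
      have hA : A - q = 0 := by
        rw [integral_congr_ae (g := fun _ => A - q) (hQ.mono fun x hx => by simp only [hx]; ring)]
          at hmean
        simpa using hmean
      filter_upwards [hQ] with x hx
      exact (h.sign_score hP x).2.2 (by rw [hx, ← hq]; linarith)
    have hT : ∀ᵐ x ∂μ, (0 < B * (x - (q - A) / B) → 0 < score μ (resp (hard D)) x) ∧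
        (B * (x - (q - A) / B) < 0 → score μ (resp (hard D)) x < 0) ∧
        (B * (x - (q - A) / B) = 0 → score μ (resp (hard D)) x = 0) := by
      filter_upwards [hQ] with x hx
      have e : B * (x - (q - A) / B) = resp (hard D) x - q := by
        rw [hx]; field_simp; ring
      rw [e]
      exact h.sign_score hP x
    rcases lt_or_gt_of_ne hB with hB | hB
    · exact integral_mul_npdf_pos_of_linear hs hne hT (by nlinarith) h₃
    · exact integral_mul_npdf_pos_of_linear hs hne hT (by nlinarith) h₁

/-- Off its zeros `scoreConv` decides membership in the region. Among three zeros the middle one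
would be a point of positivity, so the zeros form a finite, hence null, set. -/
lemma ae_eq_setOf_scoreConv_pos (h : IsOpt P μ D) (hP : 0 < P) {A B C : ℝ} (hC : C ≤ 0)
    (hQ : ∀ᵐ x ∂μ, resp (hard D) x = A + B * x + C * x ^ 2) :
    D =ᵐ[volume] {y | 0 < scoreConv μ (resp (hard D)) y} := by
  have hfin : volume {y | scoreConv μ (resp (hard D)) y = 0} = 0 := by
    refine Set.Finite.measure_zero ?_ _
    by_contra hinf
    obtain ⟨z, hz, hz0⟩ := exists_strictMono_of_lt_encard (n := 2)
      (S := {y | scoreConv μ (resp (hard D)) y = 0})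
      (by rw [Set.encard_eq_top_iff.2 hinf]; exact ENat.natCast_lt_top 2)
    have := h.scoreConv_pos_of_concave hP hC hQ (hz (show (0 : Fin 3) < 1 by decide))
      (hz (show (1 : Fin 3) < 2 by decide)) (hz0 0).ge (hz0 2).ge
    exact this.ne' (hz0 1)
  filter_upwards [h.ae_sign_scoreConv hP, measure_eq_zero_iff_ae_notMem.1 hfin] with y hy hy0
  refine propext ⟨fun hyD => lt_of_le_of_ne (hy.1 hyD) (Ne.symm hy0), fun hyp => ?_⟩
  by_contra hyD
  exact absurd hyp (not_lt.2 (hy.2 hyD))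

lemma exists_interval_of_concave (h : IsOpt P μ D) (hP : 0 < P) {A B C : ℝ} (hC : C ≤ 0)
    (hQ : ∀ᵐ x ∂μ, resp (hard D) x = A + B * x + C * x ^ 2) :
    (∃ τ, IsOpt P μ (Set.Ioi τ)) ∨ ∃ a b, a < b ∧ IsOpt P μ (Set.Ioo a b) := by
  have hae := h.ae_eq_setOf_scoreConv_pos hP hC hQ
  set U := {y | 0 < scoreConv μ (resp (hard D)) y} with hU
  have hconn : U.OrdConnected := by
    refine ⟨fun y₁ h₁ y₃ h₃ y₂ h₂ => ?_⟩
    rcases h₂.1.eq_or_lt with rfl | h12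
    · exact h₁
    rcases h₂.2.eq_or_lt with rfl | h23
    · exact h₃
    exact h.scoreConv_pos_of_concave hP hC hQ h12 h23 (le_of_lt h₁) (le_of_lt h₃)
  have hp := h.isProperTest hP
  have hIoi : ∀ τ, D =ᵐ[volume] Set.Ioi τ → ∃ τ, IsOpt P μ (Set.Ioi τ) := fun τ hτ =>
    ⟨τ, h.congr_ae measurableSet_Ioi hτ⟩
  have hIio : ∀ τ, D =ᵐ[volume] Set.Iio τ → ∃ τ, IsOpt P μ (Set.Ioi τ) := fun τ hτ => by
    have h1 := (h.congr_ae measurableSet_Iio hτ).compl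
    rw [Set.compl_Iio] at h1
    exact ⟨τ, h1.congr_ae measurableSet_Ioi Ioi_ae_eq_Ici.symm⟩
  have hIoo : ∀ a b, D =ᵐ[volume] Set.Ioo a b → ∃ a b, a < b ∧ IsOpt P μ (Set.Ioo a b) := by
    intro a b hab
    refine ⟨a, b, not_le.1 fun hba => hp.not_zero ?_, h.congr_ae measurableSet_Ioo hab⟩
    rw [Set.Ioo_eq_empty (not_lt.2 hba)] at hab
    have := indicator_ae_eq_of_ae_eq_set (f := fun _ : ℝ => (1 : ℝ)) hab
    rwa [Set.indicator_empty] at this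
  have hmem := hconn.isPreconnected.mem_intervals
  simp only [Set.mem_insert_iff, Set.mem_singleton_iff] at hmem
  generalize sInf U = a at hmem
  generalize sSup U = b at hmem
  rcases hmem with e | e | e | e | e | e | e | e | e | e <;> rw [e] at hae
  · exact .inr (hIoo a b (hae.trans Ioo_ae_eq_Icc.symm))
  · exact .inr (hIoo a b (hae.trans Ioo_ae_eq_Ico.symm))
  · exact .inr (hIoo a b (hae.trans Ioo_ae_eq_Ioc.symm))
  · exact .inr (hIoo a b hae)
  · exact .inl (hIoi a (hae.trans Ioi_ae_eq_Ici.symm))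
  · exact .inl (hIoi a hae)
  · exact .inl (hIio b (hae.trans Iio_ae_eq_Iic.symm))
  · exact .inl (hIio b hae)
  · refine absurd ?_ hp.not_one
    have := indicator_ae_eq_of_ae_eq_set (f := fun _ : ℝ => (1 : ℝ)) hae
    rwa [Set.indicator_univ] at this
  -- The empty case, presented as a degenerate interval; `hIoo` refutes it since the region is not
  -- null.
  · exact .inr (hIoo 0 0 (by simpa using hae))

/-- If the response is quadratic on the support of the input, the same input is optimal for a
half-line or a bounded interval. -/
lemma exists_interval (h : IsOpt P μ D) (hP : 0 < P) {A B C : ℝ}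
    (hQ : ∀ᵐ x ∂μ, resp (hard D) x = A + B * x + C * x ^ 2) :
    (∃ τ, IsOpt P μ (Set.Ioi τ)) ∨ ∃ a b, a < b ∧ IsOpt P μ (Set.Ioo a b) := by
  rcases le_total C 0 with hC | hC
  · exact h.exists_interval_of_concave hP hC hQ
  · refine h.compl.exists_interval_of_concave hP (A := 1 - A) (B := -B) (C := -C) (by linarith) ?_
    filter_upwards [hQ] with x hx
    rw [hard_compl, (isSoftTest_hard h.meas).resp_one_sub, hx]
    ring

end IsOpt

/-! ### Karush–Kuhn–Tucker conditions for the input law -/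

/-- The relative entropy between the output laws given the input `x` and on average. -/
def divergence (μ : Measure ℝ) (f : ℝ → ℝ) (x : ℝ) : ℝ :=
  Real.binEntropy (∫ x, f x ∂μ) - Real.binEntropy (f x) +
    entSlope (∫ x, f x ∂μ) * (f x - ∫ x, f x ∂μ)

section Divergence

variable {f : ℝ → ℝ}

lemma integral_divergence (hf : IsSoftTest f) (μ ν : Measure ℝ) [IsProbabilityMeasure ν] :
    ∫ x, divergence μ f x ∂ν = Real.binEntropy (∫ x, f x ∂μ) - ∫ x, Real.binEntropy (f x) ∂ν +
      entSlope (∫ x, f x ∂μ) * (∫ x, f x ∂ν - ∫ x, f x ∂μ) := by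
  have i1 : Integrable (fun x => Real.binEntropy (∫ x, f x ∂μ) - Real.binEntropy (f x)) ν :=
    (integrable_const _).sub hf.integrable_binEntropy
  have i2 : Integrable (fun x => f x - ∫ x, f x ∂μ) ν := hf.integrable.sub (integrable_const _)
  unfold divergence
  rw [integral_add i1 (i2.const_mul _), integral_sub (integrable_const _) hf.integrable_binEntropy,
    integral_const_mul, integral_sub hf.integrable (integrable_const _)]
  simp

lemma integral_divergence_self (hf : IsSoftTest f) (μ : Measure ℝ) [IsProbabilityMeasure μ] :
    ∫ x, divergence μ f x ∂μ = info μ f := by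
  rw [integral_divergence hf, info]
  simp

lemma integrable_divergence (hf : IsSoftTest f) (μ ν : Measure ℝ) [IsProbabilityMeasure ν] :
    Integrable (divergence μ f) ν :=
  ((integrable_const _).sub hf.integrable_binEntropy).add
    ((hf.integrable.sub (integrable_const _)).const_mul _)

lemma le_divergence (hf : IsSoftTest f) (μ : Measure ℝ) [IsProbabilityMeasure μ] (x : ℝ) :
    -(Real.log 2 + |entSlope (∫ x, f x ∂μ)|) ≤ divergence μ f x := by
  have h1 := Real.binEntropy_nonneg (hf.integral_nonneg (μ := μ)) hf.integral_le_one
  have h2 := Real.binEntropy_le_log_two (p := f x)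
  have h3 : |f x - ∫ x, f x ∂μ| ≤ 1 := by
    rw [abs_le]
    constructor <;>
      linarith [hf.nonneg x, hf.le_one x, hf.integral_nonneg (μ := μ), hf.integral_le_one (μ := μ)]
  have h4 := neg_abs_le (entSlope (∫ x, f x ∂μ) * (f x - ∫ x, f x ∂μ))
  rw [abs_mul] at h4
  have h5 := mul_le_of_le_one_right (abs_nonneg (entSlope (∫ x, f x ∂μ))) h3
  unfold divergence
  linarith

end Divergence

lemma deriv_nonpos_of_forall_le {u : ℝ → ℝ} {u' : ℝ} (hu : HasDerivAt u u' 0)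
    (h : ∀ t, 0 ≤ t → t ≤ 1 → u t ≤ u 0) : u' ≤ 0 := by
  have ht := hu.tendsto_slope_zero_right
  refine le_of_tendsto ht ?_
  filter_upwards [Ioo_mem_nhdsGT (show (0 : ℝ) < 1 by norm_num)] with t ht
  rw [zero_add, smul_eq_mul]
  exact mul_nonpos_of_nonneg_of_nonpos (inv_nonneg.2 ht.1.le) (by linarith [h t ht.1.le ht.2.le])

namespace IsOpt

variable {P : ℝ} {μ : Measure ℝ} {D : Set ℝ}

/-- Mixing `ν` into `μ` cannot increase the information, and the right derivative at weight zero is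
the difference of the two sides. -/
lemma integral_divergence_le (h : IsOpt P μ D) (hP : 0 < P) {ν : Measure ℝ}
    (hν : IsAdmissibleInput P ν) :
    ∫ x, divergence μ (resp (hard D)) x ∂ν ≤ info μ (resp (hard D)) := by
  have := h.adm.isProbabilityMeasure
  have := hν.isProbabilityMeasure
  have hf := (isSoftTest_hard h.meas).isSoftTest_resp
  have hp := h.isProperTest hP
  set f := resp (hard D) with hfdef
  set q := ∫ x, f x ∂μ with hq
  have hq0 : 0 < q := hp.integral_resp_pos
  have hq1 : q < 1 := hp.integral_resp_lt_one
  let u : ℝ → ℝ := fun t => Real.binEntropy (q + t * (∫ x, f x ∂ν - q)) -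
    ((1 - t) * ∫ x, Real.binEntropy (f x) ∂μ + t * ∫ x, Real.binEntropy (f x) ∂ν)
  have hmix : ∀ t, 0 ≤ t → t ≤ 1 → u t ≤ u 0 := by
    intro t ht0 ht1
    have hintg : ∀ v : ℝ → ℝ, Integrable v μ → Integrable v ν →
        ∫ x, v x ∂(ENNReal.ofReal (1 - t) • μ + ENNReal.ofReal t • ν) =
          (1 - t) * ∫ x, v x ∂μ + t * ∫ x, v x ∂ν := fun v h1 h2 => by
      rw [integral_add_measure (h1.smul_measure ENNReal.ofReal_ne_top)
        (h2.smul_measure ENNReal.ofReal_ne_top), integral_smul_measure, integral_smul_measure,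
        ENNReal.toReal_ofReal ht0, ENNReal.toReal_ofReal (sub_nonneg.2 ht1)]
      rfl
    have hone : ENNReal.ofReal (1 - t) + ENNReal.ofReal t = 1 := by
      rw [← ENNReal.ofReal_add (sub_nonneg.2 ht1) ht0]
      simp
    have hadm : IsAdmissibleInput P (ENNReal.ofReal (1 - t) • μ + ENNReal.ofReal t • ν) :=
      { isProbabilityMeasure := ⟨by simp [hone]⟩
        power_le := by
          rw [lintegral_add_measure, lintegral_smul_measure, lintegral_smul_measure, smul_eq_mul,
            smul_eq_mul]
          calc _ ≤ ENNReal.ofReal (1 - t) * ENNReal.ofReal P + ENNReal.ofReal t * ENNReal.ofReal P :=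
                add_le_add (mul_le_mul_right h.adm.power_le _) (mul_le_mul_right hν.power_le _)
            _ = ENNReal.ofReal P := by rw [← add_mul, hone, one_mul] }
    have hle := h.le _ hadm D h.meas
    rw [info, hintg _ hf.integrable hf.integrable,
      hintg _ hf.integrable_binEntropy hf.integrable_binEntropy, info, ← hfdef, ← hq] at hle
    have e0 : u 0 = Real.binEntropy q - ∫ x, Real.binEntropy (f x) ∂μ := by simp [u]
    have e1 : q + t * (∫ x, f x ∂ν - q) = (1 - t) * q + t * ∫ x, f x ∂ν := by ring
    rw [e0]
    simp only [u, e1]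
    exact hle
  have hderiv : HasDerivAt u (entSlope q * (∫ x, f x ∂ν - q) -
      (-(∫ x, Real.binEntropy (f x) ∂μ) + ∫ x, Real.binEntropy (f x) ∂ν)) 0 := by
    have h1 : HasDerivAt (fun t : ℝ => q + t * (∫ x, f x ∂ν - q)) (∫ x, f x ∂ν - q) 0 := by
      simpa using ((hasDerivAt_id (0 : ℝ)).mul_const (∫ x, f x ∂ν - q)).const_add q
    have h2 : HasDerivAt Real.binEntropy (entSlope q) (q + 0 * (∫ x, f x ∂ν - q)) := by
      rw [zero_mul, add_zero]
      exact Real.hasDerivAt_binEntropy hq0.ne' hq1.ne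
    have h3 : HasDerivAt (fun t : ℝ => (1 - t) * ∫ x, Real.binEntropy (f x) ∂μ +
        t * ∫ x, Real.binEntropy (f x) ∂ν)
        (-(∫ x, Real.binEntropy (f x) ∂μ) + ∫ x, Real.binEntropy (f x) ∂ν) 0 := by
      simpa using (((hasDerivAt_id (0 : ℝ)).const_sub 1).mul_const
        (∫ x, Real.binEntropy (f x) ∂μ)).fun_add
        ((hasDerivAt_id (0 : ℝ)).mul_const (∫ x, Real.binEntropy (f x) ∂ν))
    exact (h2.comp 0 h1).sub h3
  have := deriv_nonpos_of_forall_le hderiv hmix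
  rw [integral_divergence hf, info, ← hq]
  linarith

/-- The Karush–Kuhn–Tucker conditions for the input law. -/
lemma exists_multiplier (h : IsOpt P μ D) (hP : 0 < P) :
    ∃ l : ℝ, 0 ≤ l ∧
      (∀ x, divergence μ (resp (hard D)) x ≤ info μ (resp (hard D)) + l * (x ^ 2 - P)) ∧
      ∀ᵐ x ∂μ, divergence μ (resp (hard D)) x = info μ (resp (hard D)) + l * (x ^ 2 - P) := by
  have := h.adm.isProbabilityMeasure
  have hf := (isSoftTest_hard h.meas).isSoftTest_resp
  set K := info μ (resp (hard D)) with hK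
  set Ψ := divergence μ (resp (hard D)) with hΨ
  have htwo : ∀ p a b : ℝ, 0 ≤ p → p ≤ 1 → p * a ^ 2 + (1 - p) * b ^ 2 ≤ P →
      p * Ψ a + (1 - p) * Ψ b ≤ K := fun p a b hp0 hp1 hle => by
    have := h.integral_divergence_le hP (isAdmissibleInput_two_point hp0 hp1 hle)
    rwa [integral_two_point hp0 hp1] at this
  have hin : ∀ x, x ^ 2 ≤ P → Ψ x ≤ K := fun x hx => by
    have := htwo 1 x x zero_le_one le_rfl (by linarith)
    linarith
  -- A two-point law on `x` and `y` with power exactly `P` shows that, in the variable `x ^ 2`,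
  -- every slope from outside `P` is at most every slope from inside. Any number between the two
  -- families serves as multiplier.
  have hcross : ∀ x y, x ^ 2 < P → P < y ^ 2 →
      (Ψ y - K) / (y ^ 2 - P) ≤ (K - Ψ x) / (P - x ^ 2) := by
    intro x y hx hy
    have hd : 0 < y ^ 2 - x ^ 2 := by linarith
    have := htwo ((y ^ 2 - P) / (y ^ 2 - x ^ 2)) x y (div_nonneg (by linarith) hd.le)
      ((div_le_one hd).2 (by linarith)) (le_of_eq (by field_simp; ring))
    rw [div_le_div_iff₀ (by linarith) (by linarith)]
    have e : (y ^ 2 - P) / (y ^ 2 - x ^ 2) * Ψ x + (1 - (y ^ 2 - P) / (y ^ 2 - x ^ 2)) * Ψ y =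
        ((y ^ 2 - P) * Ψ x + (P - x ^ 2) * Ψ y) / (y ^ 2 - x ^ 2) := by
      field_simp
      ring
    rw [e, div_le_iff₀ hd] at this
    linarith
  obtain ⟨l, hl1, hl2⟩ := exists_between_of_forall_le
    (s := (fun y : ℝ => (Ψ y - K) / (y ^ 2 - P)) '' {y | P < y ^ 2})
    (t := (fun x : ℝ => (K - Ψ x) / (P - x ^ 2)) '' {x | x ^ 2 < P})
    ⟨_, P + 1, show P < (P + 1) ^ 2 by nlinarith, rfl⟩ ⟨_, 0, show (0 : ℝ) ^ 2 < P by simpa, rfl⟩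
    (by rintro _ ⟨y, hy, rfl⟩ _ ⟨x, hx, rfl⟩; exact hcross x y hx hy)
  have hle : ∀ x, Ψ x ≤ K + l * (x ^ 2 - P) := by
    intro x
    rcases lt_trichotomy (x ^ 2) P with hx | hx | hx
    · have := hl2 ⟨x, hx, rfl⟩
      rw [le_div_iff₀ (by linarith)] at this
      linarith
    · have := hin x hx.le
      rw [hx]
      linarith
    · have := hl1 ⟨x, hx, rfl⟩
      rw [div_le_iff₀ (by linarith)] at this
      linarith
  refine ⟨l, ?_, hle, ?_⟩
  · by_contra hn
    -- A negative multiplier would force the divergence to `-∞` for large inputs, while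
    -- `le_divergence` bounds it below. The test point makes the upper bound equal to `-(M + 1)`.
    have hl : 0 < -l := by linarith
    set M := Real.log 2 + |entSlope (∫ x, resp (hard D) x ∂μ)| with hM
    have hlow : ∀ x, -M ≤ Ψ x := le_divergence hf μ
    have hK0 : 0 < K := h.info_pos hP
    have hM0 : 0 ≤ M := add_nonneg (Real.log_nonneg (by norm_num)) (abs_nonneg _)
    have hpos : 0 ≤ P + (M + K + 1) / -l := by positivity
    have h1 := hle (√(P + (M + K + 1) / -l))
    have h2 := hlow (√(P + (M + K + 1) / -l))
    rw [Real.sq_sqrt hpos] at h1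
    have e : l * (P + (M + K + 1) / -l - P) = -(M + K + 1) := by
      have : l ≠ 0 := by linarith
      field_simp
      ring
    linarith
  · have i1 : Integrable Ψ μ := integrable_divergence hf μ μ
    have i2 : Integrable (fun x => x ^ 2 - P) μ := h.adm.integrable_sq.sub (integrable_const _)
    have i3 : Integrable (fun x => K + l * (x ^ 2 - P)) μ :=
      (integrable_const _).add (i2.const_mul _)
    -- Full use of the power makes the two sides of the pointwise inequality have equal integrals,
    -- hence agree almost everywhere.
    have h0 : ∫ x, (K + l * (x ^ 2 - P) - Ψ x) ∂μ = 0 := by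
      rw [integral_sub i3 i1, integral_add (integrable_const _) (i2.const_mul _),
        integral_const_mul, integral_sub h.adm.integrable_sq (integrable_const _),
        h.integral_sq hP, integral_divergence_self hf]
      simp [hK]
    have hnn : 0 ≤ fun x => K + l * (x ^ 2 - P) - Ψ x := fun x => sub_nonneg.2 (hle x)
    filter_upwards [(integral_eq_zero_iff_of_nonneg hnn (i3.sub i1)).1 h0] with x hx
    have hx : K + l * (x ^ 2 - P) - Ψ x = 0 := hx
    linarith

end IsOpt

/-! ### The normal distribution function and its hazard rate -/

/-- The standard normal distribution function. -/
def ncdf (u : ℝ) : ℝ := ∫ y in Set.Iic u, npdf y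

lemma hasDerivAt_ncdf (u : ℝ) : HasDerivAt ncdf (npdf u) u := by
  have h : ncdf = fun v => ncdf 0 + ∫ y in (0 : ℝ)..v, npdf y := by
    ext v
    rw [← intervalIntegral.integral_Iic_sub_Iic integrable_npdf.integrableOn
      integrable_npdf.integrableOn]
    simp [ncdf]
  rw [h]
  exact (intervalIntegral.integral_hasDerivAt_right (continuous_npdf.intervalIntegrable _ _)
    (continuous_npdf.stronglyMeasurableAtFilter _ _) continuous_npdf.continuousAt).const_add _

lemma resp_hard_Ioi (τ x : ℝ) : resp (hard (Set.Ioi τ)) x = ncdf (x - τ) := by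
  rw [resp, ← integral_sub_left_eq_self (fun y => hard (Set.Ioi τ) y * npdf (y - x)) volume x, ncdf,
    ← integral_Iic_eq_integral_Iio.symm, ← integral_indicator measurableSet_Iio]
  refine integral_congr_ae (ae_of_all _ fun y => ?_)
  simp only
  rw [show x - y - x = -y by ring, npdf_neg]
  by_cases hy : y < x - τ
  · rw [hard_of_mem (show x - y ∈ Set.Ioi τ from (by linarith : τ < x - y)),
      Set.indicator_of_mem (show y ∈ Set.Iio (x - τ) from hy),
      one_mul]
  · rw [hard_of_notMem (show x - y ∉ Set.Ioi τ from (by linarith : ¬ τ < x - y)),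
      Set.indicator_of_notMem (show y ∉ Set.Iio (x - τ) from hy), zero_mul]

lemma resp_hard_Ioo {a b : ℝ} (hab : a < b) (x : ℝ) :
    resp (hard (Set.Ioo a b)) x = ncdf (x - a) - ncdf (x - b) := by
  rw [← resp_hard_Ioi, ← resp_hard_Ioi, resp, resp, resp, ← integral_sub
    ((isSoftTest_hard measurableSet_Ioi).integrable_mul (integrable_npdf_sub x))
    ((isSoftTest_hard measurableSet_Ioi).integrable_mul (integrable_npdf_sub x))]
  have hne : ∀ᵐ y : ℝ, y ≠ b := by simp [ae_iff]
  refine integral_congr_ae ?_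
  filter_upwards [hne] with y hy
  simp only [hard, Set.indicator, Set.mem_Ioo, Set.mem_Ioi]
  rcases lt_or_gt_of_ne hy with h | h
  · simp [h, h.not_gt]
  · simp [h, h.not_gt, hab.trans h]

lemma isProperTest_hard_Ioi (τ : ℝ) : IsProperTest (hard (Set.Ioi τ)) where
  toIsSoftTest := isSoftTest_hard measurableSet_Ioi
  not_zero h := by
    have : volume (Set.Ioi τ) = 0 := by
      refine measure_mono_null (fun y hy => ?_) (ae_iff.1 h)
      simp [hard_of_mem hy]
    simp at this
  not_one h := by
    have : volume (Set.Iic τ) = 0 := by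
      refine measure_mono_null (fun y hy => ?_) (ae_iff.1 h)
      simp [hard_of_notMem (Set.notMem_Ioi.2 hy)]
    simp at this

lemma ncdf_eq_resp (u : ℝ) : ncdf u = resp (hard (Set.Ioi 0)) u := by rw [resp_hard_Ioi, sub_zero]

lemma ncdf_pos (u : ℝ) : 0 < ncdf u := ncdf_eq_resp u ▸ (isProperTest_hard_Ioi 0).resp_pos u

lemma ncdf_lt_one (u : ℝ) : ncdf u < 1 := ncdf_eq_resp u ▸ (isProperTest_hard_Ioi 0).resp_lt_one u

lemma ncdf_neg (u : ℝ) : ncdf (-u) = 1 - ncdf u := by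
  have h : ncdf u + ∫ y in Set.Ioi u, npdf y = 1 := by
    rw [ncdf, ← integral_npdf, ← Set.compl_Iic,
      integral_add_compl measurableSet_Iic integrable_npdf]
  have h2 : ncdf (-u) = ∫ y in Set.Ioi u, npdf y := by
    rw [ncdf, ← neg_neg u, ← integral_comp_neg_Iic, neg_neg]
    simp [npdf_neg]
  linarith

lemma ncdf_zero : ncdf 0 = 1 / 2 := by
  have := ncdf_neg 0
  rw [neg_zero] at this
  linarith

lemma strictMono_ncdf : StrictMono ncdf :=
  strictMono_of_deriv_pos fun u => by rw [(hasDerivAt_ncdf u).deriv]; exact npdf_pos u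

lemma tendsto_ncdf_atTop : Filter.Tendsto ncdf Filter.atTop (nhds 1) := by
  have h : Filter.Tendsto (fun u => ∫ y in Set.Iic u, npdf y) Filter.atTop (nhds (∫ y, npdf y)) :=
    (aecover_Iic Filter.tendsto_id).integral_tendsto_of_countably_generated integrable_npdf
  rwa [integral_npdf] at h

lemma tendsto_mul_npdf_atTop : Filter.Tendsto (fun u => u * npdf u) Filter.atTop (nhds 0) := by
  have hlim : Filter.Tendsto (fun u : ℝ => 2 * u⁻¹) Filter.atTop (nhds 0) := by
    simpa using tendsto_inv_atTop_zero.const_mul (2 : ℝ)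
  refine squeeze_zero' (Filter.eventually_atTop.2 ⟨0, fun u hu => mul_nonneg hu (npdf_nonneg u)⟩)
    (Filter.eventually_atTop.2 ⟨1, fun u hu => ?_⟩) hlim
  have hu : 0 < u := by linarith
  have h1 : npdf u ≤ Real.exp (-u ^ 2 / 2) := by
    rw [npdf_eq]
    have : 1 ≤ √(2 * Real.pi) := Real.one_le_sqrt.2 (by linarith [Real.pi_gt_three])
    exact mul_le_of_le_one_left (Real.exp_pos _).le (inv_le_one_of_one_le₀ this)
  have h2 : Real.exp (-u ^ 2 / 2) ≤ 2 / u ^ 2 := by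
    rw [neg_div, Real.exp_neg, inv_le_comm₀ (Real.exp_pos _) (by positivity), inv_div]
    linarith [Real.add_one_le_exp (u ^ 2 / 2)]
  calc u * npdf u ≤ u * (2 / u ^ 2) := mul_le_mul_of_nonneg_left (h1.trans h2) hu.le
    _ = 2 * u⁻¹ := by field_simp

lemma tendsto_npdf_atTop : Filter.Tendsto npdf Filter.atTop (nhds 0) :=
  squeeze_zero' (Filter.Eventually.of_forall npdf_nonneg)
    (Filter.eventually_atTop.2 ⟨1, fun u hu => le_mul_of_one_le_left (npdf_nonneg u) hu⟩)
    tendsto_mul_npdf_atTop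

lemma pos_of_deriv_neg_of_tendsto {f f' : ℝ → ℝ} (hf : ∀ u, HasDerivAt f (f' u) u)
    (hneg : ∀ u, f' u < 0) (hlim : Filter.Tendsto f Filter.atTop (nhds 0)) (u : ℝ) : 0 < f u := by
  have hanti : StrictAnti f := strictAnti_of_deriv_neg fun u => by rw [(hf u).deriv]; exact hneg u
  exact (hanti.antitone.le_of_tendsto hlim (u + 1)).trans_lt (hanti (lt_add_one u))

/-- The lower bound for the Mills ratio: `1 - ncdf u - u * npdf u / (1 + u ^ 2)` has derivative `-2
* npdf u / (1 + u ^ 2) ^ 2` and tends to zero. -/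
lemma mul_npdf_lt_mul_one_sub_ncdf (u : ℝ) : u * npdf u < (1 + u ^ 2) * (1 - ncdf u) := by
  have hpos : ∀ v : ℝ, 0 < 1 + v ^ 2 := fun v => by positivity
  have hd : ∀ v : ℝ, HasDerivAt (fun u => 1 - ncdf u - u * npdf u / (1 + u ^ 2))
      (-(2 * npdf v / (1 + v ^ 2) ^ 2)) v := fun v => by
    have h1 := (hasDerivAt_id v).fun_mul (hasDerivAt_npdf v)
    have h2 : HasDerivAt (fun u : ℝ => 1 + u ^ 2) (2 * v) v := by
      simpa using (hasDerivAt_pow 2 v).const_add 1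
    refine (((hasDerivAt_ncdf v).const_sub 1).sub (h1.fun_div h2 (hpos v).ne')).congr_deriv ?_
    have := (hpos v).ne'
    simp only [id]
    field_simp
    ring
  have hlim : Filter.Tendsto (fun u => 1 - ncdf u - u * npdf u / (1 + u ^ 2)) Filter.atTop
      (nhds 0) := by
    have h1 : Filter.Tendsto (fun u => u * npdf u / (1 + u ^ 2)) Filter.atTop (nhds 0) := by
      refine squeeze_zero' (Filter.eventually_atTop.2 ⟨0, fun u hu =>
        div_nonneg (mul_nonneg hu (npdf_nonneg u)) (hpos u).le⟩)
        (Filter.eventually_atTop.2 ⟨0, fun u hu => ?_⟩) tendsto_mul_npdf_atTop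
      exact div_le_self (mul_nonneg hu (npdf_nonneg u)) (by nlinarith [sq_nonneg u])
    simpa using (tendsto_ncdf_atTop.const_sub 1).sub h1
  have := pos_of_deriv_neg_of_tendsto hd (fun v => by
    have := npdf_pos v
    have := hpos v
    exact neg_neg_of_pos (by positivity)) hlim u
  rw [sub_pos, div_lt_iff₀ (hpos u)] at this
  linarith

/-- The derivative of the normal hazard rate is less than one. -/
lemma hazard_mul_sub_lt_one (u : ℝ) :
    npdf u / (1 - ncdf u) * (npdf u / (1 - ncdf u) - u) < 1 := by
  -- Cleared of denominators, the claim is that this function is positive. It tends to zero at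
  -- infinity, and its derivative is negative by the Mills ratio bound.
  have hd : ∀ v : ℝ, HasDerivAt
      (fun u => (1 - ncdf u) ^ 2 + u * npdf u * (1 - ncdf u) - npdf u ^ 2)
      (npdf v * (v * npdf v - (1 + v ^ 2) * (1 - ncdf v))) v := fun v => by
    have h0 := (hasDerivAt_ncdf v).const_sub 1
    have h1 := (hasDerivAt_id v).fun_mul (hasDerivAt_npdf v)
    refine (((h0.fun_pow 2).fun_add (h1.fun_mul h0)).sub
      ((hasDerivAt_npdf v).fun_pow 2)).congr_deriv ?_
    simp only [id]
    ring
  have hlim : Filter.Tendsto (fun u => (1 - ncdf u) ^ 2 + u * npdf u * (1 - ncdf u) - npdf u ^ 2)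
      Filter.atTop (nhds 0) := by
    have h0 := tendsto_ncdf_atTop.const_sub 1
    simpa using ((h0.pow 2).add (tendsto_mul_npdf_atTop.mul h0)).sub (tendsto_npdf_atTop.pow 2)
  have hpos := pos_of_deriv_neg_of_tendsto hd (fun v => mul_neg_of_pos_of_neg (npdf_pos v)
    (sub_neg.2 (mul_npdf_lt_mul_one_sub_ncdf v))) hlim u
  have hG : 0 < 1 - ncdf u := sub_pos.2 (ncdf_lt_one u)
  rw [div_sub' hG.ne', div_mul_div_comm, div_lt_one (by positivity)]
  nlinarith

/-! ### Fisher information of a sign and its intersections with parabolas -/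

/-- The logarithmic derivative of `fisher`. -/
def fisherSlope (u : ℝ) : ℝ := npdf u / (1 - ncdf u) - npdf u / ncdf u - 2 * u

/-- The Fisher information of the sign of a unit-variance normal variable about its mean. -/
def fisher (u : ℝ) : ℝ := npdf u ^ 2 / (ncdf u * (1 - ncdf u))

lemma fisher_pos (u : ℝ) : 0 < fisher u :=
  div_pos (pow_pos (npdf_pos u) 2) (mul_pos (ncdf_pos u) (sub_pos.2 (ncdf_lt_one u)))

lemma fisher_neg (u : ℝ) : fisher (-u) = fisher u := by
  rw [fisher, fisher, npdf_neg, ncdf_neg, sub_sub_cancel, mul_comm (ncdf u)]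

lemma fisherSlope_neg (u : ℝ) : fisherSlope (-u) = -fisherSlope u := by
  rw [fisherSlope, fisherSlope, npdf_neg, ncdf_neg, sub_sub_cancel]
  ring

lemma hasDerivAt_fisher (u : ℝ) : HasDerivAt fisher (fisher u * fisherSlope u) u := by
  have h0 := (ncdf_pos u).ne'
  have h1 := (sub_pos.2 (ncdf_lt_one u)).ne'
  have hd := ((hasDerivAt_npdf u).fun_pow 2).fun_div
    ((hasDerivAt_ncdf u).fun_mul ((hasDerivAt_ncdf u).const_sub 1)) (mul_ne_zero h0 h1)
  refine hd.congr_deriv ?_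
  rw [fisher, fisherSlope]
  field_simp
  ring

/-- The derivative is the sum of the hazard rate derivatives at `u` and `-u`, minus `2`; each of
these is less than one. -/
lemma exists_hasDerivAt_fisherSlope (u : ℝ) : ∃ r < 0, HasDerivAt fisherSlope r u := by
  have h0 := (ncdf_pos u).ne'
  have h1 := (sub_pos.2 (ncdf_lt_one u)).ne'
  have hA := hazard_mul_sub_lt_one u
  have hB := hazard_mul_sub_lt_one (-u)
  rw [npdf_neg, ncdf_neg, sub_sub_cancel] at hB
  refine ⟨npdf u / (1 - ncdf u) * (npdf u / (1 - ncdf u) - u) +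
    npdf u / ncdf u * (npdf u / ncdf u - -u) - 2, by linarith, ?_⟩
  have hd := (((hasDerivAt_npdf u).fun_div ((hasDerivAt_ncdf u).const_sub 1) h1).fun_sub
    ((hasDerivAt_npdf u).fun_div (hasDerivAt_ncdf u) h0)).fun_sub ((hasDerivAt_id u).const_mul 2)
  refine hd.congr_deriv ?_
  field_simp
  ring

lemma strictAnti_fisherSlope : StrictAnti fisherSlope :=
  strictAnti_of_deriv_neg fun u => by
    obtain ⟨r, hr, hd⟩ := exists_hasDerivAt_fisherSlope u
    rwa [hd.deriv]

lemma fisherSlope_zero : fisherSlope 0 = 0 := by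
  have := fisherSlope_neg 0
  rw [neg_zero] at this
  linarith

lemma fisherSlope_neg_of_pos {u : ℝ} (hu : 0 < u) : fisherSlope u < 0 :=
  fisherSlope_zero ▸ strictAnti_fisherSlope hu

lemma neg_two_mul_le_fisherSlope {u : ℝ} (hu : 0 ≤ u) : -2 * u ≤ fisherSlope u := by
  have h : 1 / 2 ≤ ncdf u := ncdf_zero ▸ strictMono_ncdf.monotone hu
  have : npdf u / ncdf u ≤ npdf u / (1 - ncdf u) :=
    div_le_div_of_nonneg_left (npdf_nonneg u) (sub_pos.2 (ncdf_lt_one u)) (by linarith)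
  rw [fisherSlope]
  linarith

lemma strictAntiOn_fisher : StrictAntiOn fisher (Set.Ici 0) := by
  refine strictAntiOn_of_deriv_neg (convex_Ici 0)
    (fun u _ => (hasDerivAt_fisher u).continuousAt.continuousWithinAt) fun u hu => ?_
  rw [interior_Ici] at hu
  rw [(hasDerivAt_fisher u).deriv]
  exact mul_neg_of_pos_of_neg (fisher_pos u) (fisherSlope_neg_of_pos hu)

/-- With `s = fisherSlope v` and `r < 0` its derivative, the sign is that of `2 - 2 * v * s - s ^ 2
* (1 - v ^ 2) - r * (1 - v ^ 2)`. Since `-2 * v ≤ s < 0`, the only harmful term is at most `4 * v ^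
2 * (1 - v ^ 2) ≤ 1`. -/
lemma strictMonoOn_fisher_quotient :
    StrictMonoOn (fun v => fisher v * (1 - v * fisherSlope v) / (1 - v ^ 2)) (Set.Ioo 0 1) := by
  have hd : ∀ v ∈ Set.Ioo (0 : ℝ) 1, ∃ d > 0,
      HasDerivAt (fun v => fisher v * (1 - v * fisherSlope v) / (1 - v ^ 2)) d v := by
    intro v hv
    obtain ⟨r, hr, hs⟩ := exists_hasDerivAt_fisherSlope v
    have hw : 0 < 1 - v ^ 2 := by nlinarith [hv.1, hv.2]
    have h1 := ((hasDerivAt_id v).fun_mul hs).const_sub 1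
    have h2 : HasDerivAt (fun v : ℝ => 1 - v ^ 2) (-(2 * v)) v := by
      simpa using (hasDerivAt_pow 2 v).const_sub 1
    refine ⟨_, ?_, ((hasDerivAt_fisher v).fun_mul h1).fun_div h2 hw.ne'⟩
    have hk := fisher_pos v
    have hsl := fisherSlope_neg_of_pos hv.1
    have hsl' := neg_two_mul_le_fisherSlope hv.1.le
    set s := fisherSlope v
    set k := fisher v
    simp only [id]
    refine div_pos ?_ (pow_pos hw 2)
    have e : (k * s * (1 - v * s) + k * -(1 * s + v * r)) * (1 - v ^ 2) -
        k * (1 - v * s) * -(2 * v) =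
        k * v * (2 - 2 * (v * s) - s ^ 2 * (1 - v ^ 2) + -r * (1 - v ^ 2)) := by ring
    rw [e]
    have hs2 : s ^ 2 ≤ 4 * v ^ 2 := by nlinarith [hv.1]
    have h4 : s ^ 2 * (1 - v ^ 2) ≤ 1 := by
      nlinarith [mul_le_mul_of_nonneg_right hs2 hw.le, sq_nonneg (2 * v ^ 2 - 1)]
    have h5 : 0 < -r * (1 - v ^ 2) := mul_pos (by linarith) hw
    have h6 : v * s ≤ 0 := mul_nonpos_of_nonneg_of_nonpos hv.1.le hsl.le
    exact mul_pos (mul_pos hk hv.1) (by linarith)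
  refine strictMonoOn_of_deriv_pos (convex_Ioo 0 1) (fun v hv => ?_) fun v hv => ?_
  · obtain ⟨d, -, h⟩ := hd v hv
    exact h.continuousAt.continuousWithinAt
  · rw [interior_Ioo] at hv
    obtain ⟨d, hpos, h⟩ := hd v hv
    rwa [h.deriv]

/-- Rolle's theorem for a finite increasing sequence of points with equal values. -/
lemma exists_strictMono_deriv_eq_zero {f f' : ℝ → ℝ} (hf : ∀ x, HasDerivAt f (f' x) x) {n : ℕ}
    {z : Fin (n + 1) → ℝ} (hz : StrictMono z) {c : ℝ} (hc : ∀ i, f (z i) = c) :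
    ∃ w : Fin n → ℝ, StrictMono w ∧ (∀ i, f' (w i) = 0) ∧
      ∀ i, z i.castSucc < w i ∧ w i < z i.succ := by
  have h : ∀ i : Fin n, ∃ w ∈ Set.Ioo (z i.castSucc) (z i.succ), f' w = 0 := fun i =>
    exists_hasDerivAt_eq_zero (hz i.castSucc_lt_succ)
      (fun x _ => (hf x).continuousAt.continuousWithinAt) ((hc _).trans (hc _).symm)
      fun x _ => hf x
  choose w hw hw0 using h
  refine ⟨w, fun i j hij => ?_, hw0, fun i => hw i⟩
  exact (hw i).2.trans_le ((hz.monotone (Fin.succ_le_castSucc_iff.2 hij)).trans (hw j).1.le)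

/-- Divided by `v`, the equation says that one function takes the same value three times. Rolle's
theorem yields two points where the quotient of `strictMonoOn_fisher_quotient` equals `2 * l`,
against its monotonicity. The points lie in `(0, 1)`: positivity of `fisher v₃` excludes `l = 0` and
gives `1 + v₃ ^ 2 > τ * v₃ > 2 * v₃ ^ 2`. -/
lemma not_three_fisher_eq {l τ : ℝ} (hl : 0 ≤ l) {v₁ v₂ v₃ : ℝ} (h₀ : 0 < v₁) (h₁₂ : v₁ < v₂)
    (h₂₃ : v₂ < v₃) (h₃ : v₃ < τ / 2)
    (e₁ : fisher v₁ = 2 * l * (1 + v₁ ^ 2 - τ * v₁)) (e₂ : fisher v₂ = 2 * l * (1 + v₂ ^ 2 - τ * v₂))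
    (e₃ : fisher v₃ = 2 * l * (1 + v₃ ^ 2 - τ * v₃)) : False := by
  have hv3 : v₃ < 1 := by
    by_contra hn
    have h1 := fisher_pos v₃
    rw [e₃] at h1
    have h2 := pos_of_mul_pos_right h1 (by positivity)
    nlinarith
  have hd : ∀ v : ℝ, 0 < v → HasDerivAt (fun v => (fisher v - 2 * l * (1 + v ^ 2)) / v)
      (((fisher v * fisherSlope v - 2 * l * (2 * v)) * v - (fisher v - 2 * l * (1 + v ^ 2))) /
        v ^ 2) v := fun v hv => by
    have h1 : HasDerivAt (fun v : ℝ => 2 * l * (1 + v ^ 2)) (2 * l * (2 * v)) v := by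
      simpa using ((hasDerivAt_pow 2 v).const_add 1).const_mul (2 * l)
    refine (((hasDerivAt_fisher v).fun_sub h1).fun_div (hasDerivAt_id v) hv.ne').congr_deriv ?_
    simp
  have hval : ∀ v : ℝ, 0 < v → fisher v = 2 * l * (1 + v ^ 2 - τ * v) →
      (fisher v - 2 * l * (1 + v ^ 2)) / v = -(2 * l * τ) := fun v hv e => by
    rw [e]
    field_simp
    ring
  have hrolle : ∀ a b : ℝ, 0 < a → a < b → fisher a = 2 * l * (1 + a ^ 2 - τ * a) →
      fisher b = 2 * l * (1 + b ^ 2 - τ * b) → ∃ c ∈ Set.Ioo a b, c < 1 → 0 < c →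
      fisher c * (1 - c * fisherSlope c) / (1 - c ^ 2) = 2 * l := by
    intro a b ha hab ea eb
    obtain ⟨c, hc, hc0⟩ := exists_hasDerivAt_eq_zero hab
      (fun x hx => (hd x (ha.trans_le hx.1)).continuousAt.continuousWithinAt)
      ((hval a ha ea).trans (hval b (ha.trans hab) eb).symm)
      (fun x hx => hd x (ha.trans hx.1))
    refine ⟨c, hc, fun hc1 hcp => ?_⟩
    have h1 : 0 < 1 - c ^ 2 := by nlinarith
    rcases div_eq_zero_iff.1 hc0 with h | h
    · rw [div_eq_iff h1.ne']
      linarith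
    · exact absurd h (pow_pos hcp 2).ne'
  obtain ⟨c, hc, hce⟩ := hrolle v₁ v₂ h₀ h₁₂ e₁ e₂
  obtain ⟨d, hd', hde⟩ := hrolle v₂ v₃ (h₀.trans h₁₂) h₂₃ e₂ e₃
  have hcd : c < d := hc.2.trans hd'.1
  have hc0 : 0 < c := h₀.trans hc.1
  have hd1 : d < 1 := hd'.2.trans hv3
  have := strictMonoOn_fisher_quotient ⟨hc0, hcd.trans hd1⟩ ⟨hc0.trans hcd, hd1⟩ hcd
  simp only [hce (hcd.trans hd1) hc0, hde hd1 (hc0.trans hcd)] at this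
  exact lt_irrefl _ this

/-- Up to `-τ / 2` the Fisher information increases while the parabola does not, and from `0` on the
roles are reversed. Each of these rays holds at most one solution, so three of the five fall
strictly between, where `not_three_fisher_eq` applies after reflection. -/
lemma not_five_fisher_eq_of_nonneg {l τ : ℝ} (hl : 0 ≤ l) (hτ : 0 ≤ τ) {z : Fin 5 → ℝ}
    (hz : StrictMono z) (h : ∀ i, fisher (z i) = 2 * l * (1 + z i * (z i + τ))) : False := by
  have z01 : z 0 < z 1 := hz (by decide)
  have z12 : z 1 < z 2 := hz (by decide)
  have z23 : z 2 < z 3 := hz (by decide)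
  have z34 : z 3 < z 4 := hz (by decide)
  have h1 : -(τ / 2) < z 1 := by
    by_contra hn
    have hm : fisher (-z 0) < fisher (-z 1) := strictAntiOn_fisher
      (show (0 : ℝ) ≤ -z 1 by linarith) (show (0 : ℝ) ≤ -z 0 by linarith) (by linarith)
    rw [fisher_neg, fisher_neg, h 0, h 1] at hm
    have := mul_nonneg hl (mul_nonneg (sub_nonneg.2 z01.le)
      (show 0 ≤ -(z 0 + z 1 + τ) by linarith))
    nlinarith
  have h3 : z 3 < 0 := by
    by_contra hn
    have hm : fisher (z 4) < fisher (z 3) := strictAntiOn_fisher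
      (show (0 : ℝ) ≤ z 3 by linarith) (show (0 : ℝ) ≤ z 4 by linarith) z34
    rw [h 3, h 4] at hm
    have := mul_nonneg hl (mul_nonneg (sub_nonneg.2 z34.le)
      (show 0 ≤ z 3 + z 4 + τ by linarith))
    nlinarith
  have e : ∀ i, fisher (-z i) = 2 * l * (1 + (-z i) ^ 2 - τ * -z i) := fun i => by
    rw [fisher_neg, h i]; ring
  exact not_three_fisher_eq hl (show 0 < -z 3 by linarith) (show -z 3 < -z 2 by linarith)
    (show -z 2 < -z 1 by linarith) (show -z 1 < τ / 2 by linarith) (e 3) (e 2) (e 1)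

lemma not_five_fisher_eq {l τ : ℝ} (hl : 0 ≤ l) {z : Fin 5 → ℝ} (hz : StrictMono z)
    (h : ∀ i, fisher (z i) = 2 * l * (1 + z i * (z i + τ))) : False := by
  rcases le_total 0 τ with hτ | hτ
  · exact not_five_fisher_eq_of_nonneg hl hτ hz h
  · refine not_five_fisher_eq_of_nonneg (τ := -τ) (z := fun i => -z i.rev) hl (by linarith)
      (fun i j hij => neg_lt_neg (hz (Fin.rev_lt_rev.2 hij))) fun i => ?_
    rw [fisher_neg, h]
    ring

/-! ### Contact points for a half-line -/

lemma hasDerivAt_entSlope {p : ℝ} (h0 : 0 < p) (h1 : p < 1) :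
    HasDerivAt entSlope (-(1 / (p * (1 - p)))) p := by
  have hp := (sub_pos.2 h1).ne'
  have h2 := h0.ne'
  refine ((((hasDerivAt_id p).const_sub 1).log hp).sub (Real.hasDerivAt_log h2)).congr_deriv ?_
  simp only [id]
  field_simp
  ring

lemma hasDerivAt_divergence {μ : Measure ℝ} {f : ℝ → ℝ} {f' x : ℝ} (hf : HasDerivAt f f' x)
    (h0 : 0 < f x) (h1 : f x < 1) : HasDerivAt (divergence μ f) (score μ f x * f') x := by
  have hb := (Real.hasDerivAt_binEntropy h0.ne' h1.ne).comp x hf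
  refine ((hb.const_sub _).add ((hf.sub_const _).const_mul _)).congr_deriv ?_
  rw [score, entSlope, entSlope]
  ring

/-- A contact point maximizes the divergence minus its quadratic bound, so the derivative vanishes
there. -/
lemma score_mul_eq_of_contact {μ : Measure ℝ} {f : ℝ → ℝ} {f' x l K P : ℝ} (hf : HasDerivAt f f' x)
    (h0 : 0 < f x) (h1 : f x < 1) (hle : ∀ x, divergence μ f x ≤ K + l * (x ^ 2 - P))
    (hx : divergence μ f x = K + l * (x ^ 2 - P)) : score μ f x * f' = 2 * l * x := by
  have hd : HasDerivAt (fun x => divergence μ f x - (K + l * (x ^ 2 - P)))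
      (score μ f x * f' - l * (2 * x)) x := by
    refine (hasDerivAt_divergence hf h0 h1).fun_sub ?_
    simpa using (((hasDerivAt_pow 2 x).sub_const P).const_mul l).const_add K
  have hmax : IsLocalMax (fun x => divergence μ f x - (K + l * (x ^ 2 - P))) x :=
    Filter.Eventually.of_forall fun y => by simp only [hx, sub_self]; linarith [hle y]
  have := hmax.hasDerivAt_eq_zero hd
  linarith

/-- For a half-line region at most three inputs satisfy the optimality condition with equality. -/
lemma encard_contact_halfline_le {μ : Measure ℝ} {τ l K P : ℝ} (hl : 0 ≤ l)
    (hle : ∀ x, divergence μ (resp (hard (Set.Ioi τ))) x ≤ K + l * (x ^ 2 - P)) :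
    {x | divergence μ (resp (hard (Set.Ioi τ))) x = K + l * (x ^ 2 - P)}.encard ≤ 3 := by
  by_contra hcon
  obtain ⟨z, hz, hzc⟩ := exists_strictMono_of_lt_encard (n := 3) (not_le.1 hcon)
  set f := resp (hard (Set.Ioi τ)) with hf
  have hfe : f = fun x => ncdf (x - τ) := funext fun x => resp_hard_Ioi τ x
  have hproper := isProperTest_hard_Ioi τ
  have hfd : ∀ x, HasDerivAt f (npdf (x - τ)) x := fun x => by
    rw [hfe]
    exact (hasDerivAt_ncdf (x - τ)).comp_sub_const x τ
  have hFd : ∀ x, HasDerivAt (fun x => divergence μ f x - (K + l * (x ^ 2 - P)))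
      (score μ f x * npdf (x - τ) - l * (2 * x)) x := fun x => by
    refine (hasDerivAt_divergence (hfd x) (hproper.resp_pos x) (hproper.resp_lt_one x)).fun_sub ?_
    simpa using (((hasDerivAt_pow 2 x).sub_const P).const_mul l).const_add K
  obtain ⟨w, -, hw0, hwz⟩ := exists_strictMono_deriv_eq_zero hFd hz (c := 0)
    (fun i => by rw [show divergence μ f (z i) = _ from hzc i, sub_self])
  have hz0 : ∀ i, score μ f (z i) * npdf (z i - τ) - l * (2 * z i) = 0 := fun i => by
    have := score_mul_eq_of_contact (hfd (z i)) (hproper.resp_pos _) (hproper.resp_lt_one _) hle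
      (hzc i)
    linarith
  -- The four contacts are double zeros, and Rolle's theorem adds a critical point in each of the
  -- three gaps, for seven zeros of the derivative.
  let c : Fin 7 → ℝ := ![z 0, w 0, z 1, w 1, z 2, w 2, z 3]
  have hc : StrictMono c := by
    refine Fin.strictMono_iff_lt_succ.2 fun i => ?_
    fin_cases i
    exacts [(hwz 0).1, (hwz 0).2, (hwz 1).1, (hwz 1).2, (hwz 2).1, (hwz 2).2]
  have hc0 : ∀ i, score μ f (c i) * npdf (c i - τ) - l * (2 * c i) = 0 := by
    intro i
    fin_cases i
    exacts [hz0 0, hw0 0, hz0 1, hw0 1, hz0 2, hw0 2, hz0 3]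
  -- Dividing the derivative by the normal density leaves a function whose own derivative no longer
  -- involves the score. Its six Rolle zeros are solutions of the Fisher equation; five of them
  -- already contradict `not_five_fisher_eq`.
  let N : ℝ → ℝ := fun x => score μ f x - 2 * l * x / npdf (x - τ)
  have hN : ∀ x, HasDerivAt N ((fisher (x - τ) - 2 * l * (1 + (x - τ) * (x - τ + τ))) /
      npdf (x - τ)) x := fun x => by
    have hn := (npdf_pos (x - τ)).ne'
    have h0 := hproper.resp_pos x
    have h1 := hproper.resp_lt_one x
    have d1 : HasDerivAt (fun x => npdf (x - τ)) (-(x - τ) * npdf (x - τ)) x :=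
      (hasDerivAt_npdf (x - τ)).comp_sub_const x τ
    have d2 : HasDerivAt (fun x : ℝ => 2 * l * x) (2 * l) x := by
      simpa using (hasDerivAt_id x).const_mul (2 * l)
    have d3 : HasDerivAt (score μ f) (-(-(1 / (f x * (1 - f x))) * npdf (x - τ))) x :=
      ((hasDerivAt_entSlope h0 h1).comp x (hfd x)).const_sub _
    refine (d3.sub (d2.fun_div d1 hn)).congr_deriv ?_
    have e : f x = ncdf (x - τ) := by rw [hfe]
    have h0' := (ncdf_pos (x - τ)).ne'
    have h1' := (sub_pos.2 (ncdf_lt_one (x - τ))).ne'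
    rw [e, fisher]
    field_simp
    ring
  have hNc : ∀ i, N (c i) = 0 := fun i => by
    have hn := (npdf_pos (c i - τ)).ne'
    have := hc0 i
    simp only [N]
    field_simp
    linarith
  obtain ⟨t, ht, ht0, -⟩ := exists_strictMono_deriv_eq_zero hN hc hNc
  refine not_five_fisher_eq (τ := τ) (z := fun i => t i.castSucc - τ) hl
    (fun i j hij => sub_lt_sub_right (ht (Fin.castSucc_lt_castSucc_iff.2 hij)) τ) fun i => ?_
  rcases div_eq_zero_iff.1 (ht0 i.castSucc) with h | h
  · linarith
  · exact absurd h (npdf_pos _).ne'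

/-! ### Contact points for a bounded interval -/

/-- Solutions of the optimality equations for a bounded interval. -/
lemma encard_interval_solutions_le {P l r s : ℝ} (hP : 0 < P) (hl : 0 ≤ l) (hr : r ≤ 0)
    (hrs : r = 0 → s ≠ 0) {E : ℝ → ℝ} (hE : StrictMono E) :
    {x | (r * (x ^ 2 - P) + s * x) * E x = r * (x ^ 2 - P) + s * x - 2 * l * x}.encard ≤ 3 := by
  by_contra hcon
  obtain ⟨z, hz, hzc⟩ := exists_strictMono_of_lt_encard (n := 3) (not_le.1 hcon)
  set R : ℝ → ℝ := fun x => r * (x ^ 2 - P) + s * x with hR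
  have hzc : ∀ i, R (z i) * E (z i) = R (z i) - 2 * l * z i := hzc
  -- Cross-multiplying the equations at two solutions isolates the increment of `E`, whose sign is
  -- known by monotonicity.
  have hpair : ∀ i j, R (z i) * R (z j) * (E (z j) - E (z i)) =
      2 * l * r * ((z j - z i) * (z i * z j + P)) := fun i j => by
    have h1 := hzc i
    have h2 := hzc j
    have h3 : z i * R (z j) - z j * R (z i) = r * ((z j - z i) * (z i * z j + P)) := by
      simp only [hR]; ring
    linear_combination R (z i) * h2 - R (z j) * h1 + 2 * l * h3
  -- Among four indices, two satisfy `Q` or three violate it.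
  have pigeon : ∀ Q : Fin 4 → Prop, (∀ i j, i < j → Q i → Q j → False) →
      (∀ i j k, i < j → j < k → ¬ Q i → ¬ Q j → ¬ Q k → False) → False := by
    intro Q h2 h3
    by_cases q0 : Q 0
    · exact h3 1 2 3 (by decide) (by decide) (fun h => h2 0 1 (by decide) q0 h)
        (fun h => h2 0 2 (by decide) q0 h) (fun h => h2 0 3 (by decide) q0 h)
    by_cases q1 : Q 1
    · exact h3 0 2 3 (by decide) (by decide) q0 (fun h => h2 1 2 (by decide) q1 h)
        (fun h => h2 1 3 (by decide) q1 h)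
    by_cases q2 : Q 2
    · exact h3 0 1 3 (by decide) (by decide) q0 q1 (fun h => h2 2 3 (by decide) q2 h)
    exact h3 0 1 2 (by decide) (by decide) q0 q1 q2
  have hroots : ∀ i j k, i < j → j < k → R (z i) = 0 → R (z j) = 0 → R (z k) = 0 → False := by
    intro i j k hij hjk hi hj hk
    have zij := hz hij
    have zjk := hz hjk
    have e1 : (z j - z i) * (r * (z i + z j) + s) = 0 := by
      simp only [hR] at hi hj; linear_combination hj - hi
    have e2 : (z k - z j) * (r * (z j + z k) + s) = 0 := by
      simp only [hR] at hj hk; linear_combination hk - hj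
    have f1 := (mul_eq_zero.1 e1).resolve_left (sub_pos.2 zij).ne'
    have f2 := (mul_eq_zero.1 e2).resolve_left (sub_pos.2 zjk).ne'
    have f3 : r * (z k - z i) = 0 := by linear_combination f2 - f1
    have hr0 : r = 0 := (mul_eq_zero.1 f3).resolve_right (by linarith)
    rw [hr0] at f1
    exact hrs hr0 (by linarith)
  by_cases hlr : l * r = 0
  · refine pigeon (fun i => R (z i) ≠ 0) (fun i j hij hi hj => ?_) fun i j k hij hjk hi hj hk =>
      hroots i j k hij hjk (not_not.1 hi) (not_not.1 hj) (not_not.1 hk)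
    have := hpair i j
    rw [show 2 * l * r * ((z j - z i) * (z i * z j + P)) =
      l * r * (2 * ((z j - z i) * (z i * z j + P))) by ring, hlr, zero_mul] at this
    exact mul_ne_zero (mul_ne_zero hi hj) (sub_pos.2 (hE (hz hij))).ne' this
  · have hl0 : 0 < l := lt_of_le_of_ne hl fun h => hlr (by rw [← h, zero_mul])
    have hr0 : r < 0 := lt_of_le_of_ne hr fun h => hlr (by rw [h, mul_zero])
    have hne : ∀ i, R (z i) ≠ 0 := fun i h0 => by
      have h1 := hzc i
      rw [h0] at h1
      have hzi : z i = 0 := by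
        have : l * z i = 0 := by linarith
        exact (mul_eq_zero.1 this).resolve_left hl0.ne'
      rw [hzi] at h0
      have : r * P = 0 := by simp only [hR] at h0; linarith
      exact (mul_neg_of_neg_of_pos hr0 hP).ne this
    -- As `E` increases and `l * r < 0`, solutions at which `R` has equal signs have product below
    -- `-P`, and so lie on opposite sides of zero.
    have hsame : ∀ i j, i < j → 0 < R (z i) * R (z j) → z i * z j + P < 0 := by
      intro i j hij hpos
      have h1 : 0 < 2 * l * r * ((z j - z i) * (z i * z j + P)) :=
        hpair i j ▸ mul_pos hpos (sub_pos.2 (hE (hz hij)))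
      by_contra hn
      have h2 : 0 ≤ (z j - z i) * (z i * z j + P) :=
        mul_nonneg (sub_pos.2 (hz hij)).le (not_lt.1 hn)
      have h3 : l * r < 0 := mul_neg_of_pos_of_neg hl0 hr0
      nlinarith
    -- Two positive values of `R` give `z i < 0 < z j`, and then `R (z i) * z j - R (z j) * z i` is
    -- positive although it equals a product of three negative factors. Three negative values would
    -- need three numbers of pairwise opposite sign.
    refine pigeon (fun i => 0 < R (z i)) (fun i j hij hi hj => ?_) fun i j k hij hjk hi hj hk => ?_
    · have h1 := hsame i j hij (mul_pos hi hj)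
      have hzij := hz hij
      have hi0 : z i < 0 := by
        by_contra hn
        nlinarith [mul_nonneg (not_lt.1 hn) ((not_lt.1 hn).trans hzij.le)]
      have hj0 : 0 < z j := by
        by_contra hn
        nlinarith [mul_nonneg_of_nonpos_of_nonpos hi0.le (not_lt.1 hn)]
      have h2 : 0 < r * ((z i - z j) * (z i * z j + P)) := by
        have h3 := mul_pos hi hj0
        have h4 := mul_pos hj (neg_pos.2 hi0)
        have e : R (z i) * z j + R (z j) * -z i = r * ((z i - z j) * (z i * z j + P)) := by
          simp only [hR]; ring
        linarith
      have h3 : 0 < (z i - z j) * (z i * z j + P) :=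
        mul_pos_of_neg_of_neg (by linarith) h1
      nlinarith
    · have neg : ∀ i, ¬ 0 < R (z i) → R (z i) < 0 := fun i h =>
        lt_of_le_of_ne (not_lt.1 h) (hne i)
      have p1 : z i * z j < 0 := by
        linarith [hsame i j hij (mul_pos_of_neg_of_neg (neg i hi) (neg j hj))]
      have p2 : z j * z k < 0 := by
        linarith [hsame j k hjk (mul_pos_of_neg_of_neg (neg j hj) (neg k hk))]
      have p3 : z i * z k < 0 := by
        linarith [hsame i k (hij.trans hjk) (mul_pos_of_neg_of_neg (neg i hi) (neg k hk))]
      have := mul_neg_of_pos_of_neg (mul_pos_of_neg_of_neg p1 p2) p3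
      nlinarith [sq_nonneg (z i * z j * z k)]

lemma closure_interior_Ioo {a b : ℝ} (hab : a < b) :
    closure (interior (Set.Ioo a b)) = Set.Icc a b := by
  rw [isOpen_Ioo.interior_eq, closure_Ioo hab.ne]

lemma Iic_subset_closure_interior_compl_Ioo (a b : ℝ) :
    Set.Iic a ⊆ closure (interior (Set.Ioo a b)ᶜ) := by
  rw [← closure_Iio]
  exact closure_mono (isOpen_Iio.subset_interior_iff.2 fun x hx hx' => lt_asymm hx hx'.1)

lemma Ici_subset_closure_interior_compl_Ioo (a b : ℝ) :
    Set.Ici b ⊆ closure (interior (Set.Ioo a b)ᶜ) := by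
  rw [← closure_Ioi]
  exact closure_mono (isOpen_Ioi.subset_interior_iff.2 fun x hx hx' => lt_asymm hx hx'.2)

/-- The equation has at most two roots and is never an identity, since the coefficient of `x` is
one; the bound three is all that is needed. -/
lemma encard_parabola_le (α β : ℝ) : {x : ℝ | x = α + β * x ^ 2}.encard ≤ 3 := by
  by_contra! hlt
  obtain ⟨z, hz, hzm⟩ := exists_strictMono_of_lt_encard (n := 3) hlt
  have h01 : z 0 < z 1 := hz (by decide)
  have h12 : z 1 < z 2 := hz (by decide)
  have e0 : z 0 = α + β * z 0 ^ 2 := hzm 0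
  have e1 : z 1 = α + β * z 1 ^ 2 := hzm 1
  have e2 : z 2 = α + β * z 2 ^ 2 := hzm 2
  have f1 : β * (z 1 + z 0) = 1 :=
    mul_left_cancel₀ (sub_pos.2 h01).ne' (by linear_combination e0 - e1)
  have f2 : β * (z 2 + z 1) = 1 :=
    mul_left_cancel₀ (sub_pos.2 h12).ne' (by linear_combination e1 - e2)
  have f3 : β * (z 2 - z 0) = 0 := by linear_combination f2 - f1
  rcases mul_eq_zero.1 f3 with h | h
  · rw [h] at f1
    simp at f1
  · linarith

/-! ### The support of an optimal input has at most three points -/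

namespace IsOpt

variable {P : ℝ} {μ : Measure ℝ} {D : Set ℝ}

/-- If `r > 0`, the negated score has the sign pattern of a concave quadratic with two real roots,
as `P > 0`. Since `scoreConv` is nonpositive at both endpoints, it would be negative at the
midpoint, which lies inside the region. -/
lemma leading_coeff_nonpos {a b : ℝ} (hab : a < b) (h : IsOpt P μ (Set.Ioo a b)) (hP : 0 < P)
    {r s : ℝ} (hrs : ∀ᵐ x ∂μ,
      score μ (resp (hard (Set.Ioo a b))) x * npdf (a - x) = r * (x ^ 2 - P) + s * x) :
    r ≤ 0 := by
  by_contra! hr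
  have := h.adm.isProbabilityMeasure
  have hs := (h.isProperTest hP).integrable_score h.adm.integrable_sq
  have hne := h.not_score_ae_eq_zero hP
  set t := √(s ^ 2 + 4 * r ^ 2 * P) with ht
  have hdisc : 0 < s ^ 2 + 4 * r ^ 2 * P := by positivity
  have ht0 : 0 < t := Real.sqrt_pos.2 hdisc
  have ht2 : t ^ 2 = s ^ 2 + 4 * r ^ 2 * P := Real.sq_sqrt hdisc.le
  have hfac : ∀ x, r * (x ^ 2 - P) + s * x =
      -(r * ((x - (-s - t) / (2 * r)) * ((-s + t) / (2 * r) - x))) := fun x => by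
    field_simp
    linear_combination ht2
  have hneg : ∀ y, ∫ x, -score μ (resp (hard (Set.Ioo a b))) x * npdf (y - x) ∂μ =
      -scoreConv μ (resp (hard (Set.Ioo a b))) y := fun y => by
    simp only [neg_mul, integral_neg]
    rfl
  have key := integral_mul_npdf_pos_of_quadratic
    (s := fun x => -score μ (resp (hard (Set.Ioo a b))) x)
    (μ := μ) (α := (-s - t) / (2 * r)) (β := (-s + t) / (2 * r)) hs.neg
    (fun h0 => hne (h0.mono fun x hx => neg_eq_zero.1 hx))
    (by rw [div_lt_div_iff_of_pos_right (by positivity)]; linarith)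
    (by
      filter_upwards [hrs] with x hx
      rw [hfac] at hx
      have hn := npdf_pos (a - x)
      refine ⟨fun h => ?_, fun h => ?_, fun h => ?_⟩
      · have h1 := mul_pos hr h
        refine neg_pos.2 (not_le.1 fun h2 => ?_)
        linarith [mul_nonneg h2 hn.le]
      · have h1 := mul_neg_of_pos_of_neg hr h
        refine neg_neg_iff_pos.2 (not_le.1 fun h2 => ?_)
        linarith [mul_nonpos_of_nonpos_of_nonneg h2 hn.le]
      · rw [h, mul_zero, neg_zero] at hx
        rw [(mul_eq_zero.1 hx).resolve_right hn.ne', neg_zero])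
    (y₁ := a) (y₂ := (a + b) / 2) (y₃ := b) (by linarith) (by linarith)
    (by
      rw [hneg]
      exact neg_nonneg.2 (h.scoreConv_nonpos hP
        (Iic_subset_closure_interior_compl_Ioo a b Set.self_mem_Iic)))
    (by
      rw [hneg]
      exact neg_nonneg.2 (h.scoreConv_nonpos hP
        (Ici_subset_closure_interior_compl_Ioo a b Set.self_mem_Ici)))
  rw [hneg] at key
  have h2 := h.scoreConv_nonneg hP (y := (a + b) / 2)
    (by rw [closure_interior_Ioo hab]; constructor <;> linarith)
  linarith

lemma exists_support_of_Ioi {τ : ℝ} (h : IsOpt P μ (Set.Ioi τ)) (hP : 0 < P) :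
    ∃ S : Set ℝ, S.encard ≤ 3 ∧ ∀ᵐ x ∂μ, x ∈ S := by
  obtain ⟨l, hl, hle, heq⟩ := h.exists_multiplier hP
  exact ⟨_, encard_contact_halfline_le hl hle, heq⟩

/-- At the endpoint `a` the weighted score is a quadratic `R` on the support, and the kernel at `b`
is an increasing exponential `E` times the kernel at `a`. Stationarity at contact points thus reads
`R x * (1 - E x) = 2 * l * x`. -/
lemma exists_support_of_Ioo {a b : ℝ} (hab : a < b) (h : IsOpt P μ (Set.Ioo a b)) (hP : 0 < P) :
    ∃ S : Set ℝ, S.encard ≤ 3 ∧ ∀ᵐ x ∂μ, x ∈ S := by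
  rcases h.ae_quadratic hP with ⟨α, β, hαβ⟩ | ⟨A, B, C, hQ⟩
  · exact ⟨_, encard_parabola_le α β, hαβ⟩
  have hp := h.isProperTest hP
  obtain ⟨l, hl, hle, heq⟩ := h.exists_multiplier hP
  obtain ⟨r, s, hrs⟩ := h.ae_score_quadratic hP hQ (y := a)
    (by rw [closure_interior_Ioo hab]; exact ⟨le_rfl, hab.le⟩)
    (Iic_subset_closure_interior_compl_Ioo a b Set.self_mem_Iic)
  have hr := h.leading_coeff_nonpos hab hP hrs
  have hrs0 : r = 0 → s ≠ 0 := by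
    rintro rfl rfl
    refine h.not_score_ae_eq_zero hP ?_
    filter_upwards [hrs] with x hx
    rw [zero_mul, zero_mul, zero_add] at hx
    exact (mul_eq_zero.1 hx).resolve_right (npdf_pos _).ne'
  refine ⟨_, encard_interval_solutions_le hP hl hr hrs0
    (E := fun x => Real.exp ((a ^ 2 - b ^ 2) / 2) * Real.exp (x * (b - a))) ?_, ?_⟩
  · intro x x' hx
    exact mul_lt_mul_of_pos_left
      (Real.exp_lt_exp.2 (mul_lt_mul_of_pos_right hx (sub_pos.2 hab))) (Real.exp_pos _)
  · filter_upwards [hrs, heq] with x hx hxe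
    have hd : HasDerivAt (resp (hard (Set.Ioo a b))) (npdf (x - a) - npdf (x - b)) x := by
      rw [funext (resp_hard_Ioo hab)]
      exact ((hasDerivAt_ncdf _).comp_sub_const x a).sub ((hasDerivAt_ncdf _).comp_sub_const x b)
    have hc := score_mul_eq_of_contact hd (hp.resp_pos x) (hp.resp_lt_one x) hle hxe
    rw [← neg_sub a x, ← neg_sub b x, npdf_neg, npdf_neg, npdf_sub_eq_mul b a x] at hc
    change (r * (x ^ 2 - P) + s * x) *
      (Real.exp ((a ^ 2 - b ^ 2) / 2) * Real.exp (x * (b - a))) = _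
    linear_combination (-hc) + (1 - Real.exp ((a ^ 2 - b ^ 2) / 2) * Real.exp (x * (b - a))) * hx

lemma exists_support (h : IsOpt P μ D) (hP : 0 < P) :
    ∃ S : Set ℝ, S.encard ≤ 3 ∧ ∀ᵐ x ∂μ, x ∈ S := by
  rcases h.ae_quadratic hP with ⟨α, β, hαβ⟩ | ⟨A, B, C, hQ⟩
  · exact ⟨_, encard_parabola_le α β, hαβ⟩
  -- Only the region is replaced; the input law stays the same, so the bound on its support carries
  -- over.
  rcases h.exists_interval hP hQ with ⟨τ, hτ⟩ | ⟨a, b, hab, hI⟩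
  · exact hτ.exists_support_of_Ioi hP
  · exact hI.exists_support_of_Ioo hab hP

end IsOpt

/-! ### Finitely supported laws as mixtures of point masses -/

/-- A probability measure carried by at most `n` points is a mixture of `n` point masses. -/
lemma exists_eq_sum_dirac {μ : Measure ℝ} [IsProbabilityMeasure μ] {n : ℕ} {S : Set ℝ}
    (hS : S.encard ≤ n) (h : ∀ᵐ x ∂μ, x ∈ S) :
    ∃ p ξ : Fin n → ℝ, (∀ l, 0 ≤ p l ∧ p l ≤ 1) ∧ ∑ l, p l = 1 ∧
      μ = ∑ l, ENNReal.ofReal (p l) • Measure.dirac (ξ l) := by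
  classical
  have hfin : S.Finite := Set.finite_of_encard_le_coe hS
  lift S to Finset ℝ using hfin
  have hcard : S.card ≤ n := by
    rw [Set.encard_coe_eq_coe_finsetCard] at hS
    exact_mod_cast hS
  have hsum : μ = ∑ x ∈ S, μ {x} • Measure.dirac x := by
    ext A hA
    have h1 : μ A = μ (A ∩ S) := measure_congr (by
      filter_upwards [h] with x hx
      exact propext ⟨fun hxA => ⟨hxA, hx⟩, fun hxA => hxA.1⟩)
    have h2 : A ∩ S = ((S.filter (· ∈ A) : Finset ℝ) : Set ℝ) := by
      ext x; simp [and_comm]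
    rw [h1, h2, ← sum_measure_singleton, Measure.finsetSum_apply, Finset.sum_filter]
    refine Finset.sum_congr rfl fun x _ => ?_
    rw [Measure.smul_apply, Measure.dirac_apply' _ hA, Set.indicator_apply]
    simp
  let e := S.equivFin
  let p : Fin n → ℝ := fun l => if hl : (l : ℕ) < S.card then μ.real {(e.symm ⟨l, hl⟩ : ℝ)} else 0
  let ξ : Fin n → ℝ := fun l => if hl : (l : ℕ) < S.card then (e.symm ⟨l, hl⟩ : ℝ) else 0
  have hμ : μ = ∑ l, ENNReal.ofReal (p l) • Measure.dirac (ξ l) := by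
    have h3 : ∑ l, ENNReal.ofReal (p l) • Measure.dirac (ξ l) =
        ∑ x : S, μ {(x : ℝ)} • Measure.dirac (x : ℝ) := by
      symm
      refine Finset.sum_of_injOn (fun x => Fin.castLE hcard (e x))
        (fun x _ y _ hxy => e.injective (Fin.castLE_injective hcard hxy)) (by simp) ?_ ?_
      · intro l _ hl
        have : ¬ (l : ℕ) < S.card := fun hlt => hl ⟨e.symm ⟨l, hlt⟩, by simp, by ext; simp⟩
        simp [p, this]
      · intro x _
        simp [p, ξ, measureReal_def]
    rw [h3, Finset.sum_coe_sort S fun x => μ {x} • Measure.dirac x]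
    exact hsum
  have hp0 : ∀ l, 0 ≤ p l := fun l => by
    simp only [p]; split_ifs <;> simp
  refine ⟨p, ξ, fun l => ⟨hp0 l, ?_⟩, ?_, hμ⟩
  · simp only [p]; split_ifs
    · exact measureReal_le_one
    · exact zero_le_one
  · have h1 : μ Set.univ = 1 := measure_univ
    rw [hμ] at h1
    simp only [Measure.finsetSum_apply, Measure.smul_apply, measure_univ, smul_eq_mul, mul_one] at h1
    rw [← ENNReal.ofReal_sum_of_nonneg fun l _ => hp0 l] at h1
    rwa [ENNReal.ofReal_eq_one] at h1

lemma integral_sum_dirac {n : ℕ} {p ξ : Fin n → ℝ} (hp : ∀ l, 0 ≤ p l) {f : ℝ → ℝ} :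
    ∫ x, f x ∂(∑ l, ENNReal.ofReal (p l) • Measure.dirac (ξ l)) = ∑ l, p l * f (ξ l) := by
  rw [integral_finsetSum_measure]
  · refine Finset.sum_congr rfl fun l _ => ?_
    rw [integral_smul_measure, integral_dirac, ENNReal.toReal_ofReal (hp l), smul_eq_mul]
  · exact fun l _ => (integrable_dirac (by simp)).smul_measure ENNReal.ofReal_ne_top

/-- A centred input with power `P` carried by at most three points is a mixture of three point
masses. -/
lemma exists_three_points {P : ℝ} {μ : Measure ℝ} [IsProbabilityMeasure μ] {S : Set ℝ}
    (hS : S.encard ≤ 3) (hmem : ∀ᵐ x ∂μ, x ∈ S) (h1 : ∫ x, x ∂μ = 0) (h2 : ∫ x, x ^ 2 ∂μ = P) :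
    ∃ p ξ : Fin 3 → ℝ, (∀ l, 0 ≤ p l ∧ p l ≤ 1) ∧ ∑ l, p l = 1 ∧
      μ = ∑ l, ENNReal.ofReal (p l) • Measure.dirac (ξ l) ∧
      ∑ l, p l * ξ l = 0 ∧ ∑ l, p l * ξ l ^ 2 = P := by
  obtain ⟨p, ξ, hp, hp1, hμ⟩ := exists_eq_sum_dirac (n := 3) (by exact_mod_cast hS) hmem
  refine ⟨p, ξ, hp, hp1, hμ, ?_, ?_⟩
  · rw [← integral_sum_dirac (f := fun x => x) fun l => (hp l).1, ← hμ, h1]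
  · rw [← integral_sum_dirac (f := fun x => x ^ 2) fun l => (hp l).1, ← hμ, h2]

/-! ### Compactness and existence of an optimal pair -/

lemma IsSoftTest.memLp {ψ : ℝ → ℝ} (hψ : IsSoftTest ψ) (p : ℝ≥0∞) (γ : Measure ℝ)
    [IsFiniteMeasure γ] : MemLp ψ p γ :=
  MemLp.of_bound hψ.measurable.aestronglyMeasurable 1
    (ae_of_all _ fun x => by rw [Real.norm_eq_abs, abs_of_nonneg (hψ.nonneg x)]; exact hψ.le_one x)

/-- Weak sequential compactness of soft tests in `L²`. -/
lemma exists_subseq_tendsto_integral_mul (γ : Measure ℝ) [IsProbabilityMeasure γ]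
    {ψ : ℕ → ℝ → ℝ} (hψ : ∀ n, IsSoftTest (ψ n)) :
    ∃ φ : ℕ → ℕ, StrictMono φ ∧ ∃ χ, IsSoftTest χ ∧ ∀ g, MemLp g 2 γ →
      Filter.Tendsto (fun n => ∫ y, ψ (φ n) y * g y ∂γ) Filter.atTop
        (nhds (∫ y, χ y * g y ∂γ)) := by
  let v : ℕ → Lp ℝ 2 γ := fun n => ((hψ n).memLp 2 γ).toLp (ψ n)
  have hv : ∀ n, ‖v n‖ ≤ 1 := fun n => by
    have h := Lp.norm_le_of_ae_bound (p := 2) (f := v n) (C := 1) zero_le_one (by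
      filter_upwards [((hψ n).memLp 2 γ).coeFn_toLp] with y hy
      rw [hy, Real.norm_eq_abs, abs_of_nonneg ((hψ n).nonneg y)]
      exact (hψ n).le_one y)
    simpa [measureUnivNNReal] using h
  have : Fact ((2 : ℝ≥0∞) ≠ ∞) := ⟨ENNReal.ofNat_ne_top⟩
  -- Sequential Banach–Alaoglu in the dual of `L²`; the Riesz isomorphism turns the limit functional
  -- back into a function.
  obtain ⟨T, -, φ, hφ, hT⟩ := WeakDual.isSeqCompact_closedBall ℝ (Lp ℝ 2 γ) 0 1
    (x := fun n => StrongDual.toWeakDual (InnerProductSpace.toDual ℝ (Lp ℝ 2 γ) (v n)))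
    (fun n => by simpa using hv n)
  set u : Lp ℝ 2 γ := (InnerProductSpace.toDual ℝ (Lp ℝ 2 γ)).symm (WeakDual.toStrongDual T) with hu
  have hconv : ∀ w : Lp ℝ 2 γ, Filter.Tendsto (fun n => inner ℝ (v (φ n)) w) Filter.atTop
      (nhds (inner ℝ u w)) := fun w => by
    have h := (WeakDual.eval_continuous w).continuousAt.tendsto.comp hT
    rw [hu, InnerProductSpace.toDual_symm_apply]
    exact h
  have hinner : ∀ g (hg : MemLp g 2 γ), Filter.Tendsto (fun n => ∫ y, ψ (φ n) y * g y ∂γ)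
      Filter.atTop (nhds (∫ y, u y * g y ∂γ)) := fun g hg => by
    have h := hconv (hg.toLp g)
    simp only [L2.inner_def] at h
    convert h using 1
    · ext n
      refine integral_congr_ae ?_
      filter_upwards [((hψ (φ n)).memLp 2 γ).coeFn_toLp, hg.coeFn_toLp] with y h1 h2
      rw [h2, h1]
      simp [mul_comm]
    · congr 1
      refine integral_congr_ae ?_
      filter_upwards [hg.coeFn_toLp] with y h2
      rw [h2]
      simp [mul_comm]
  have hui : Integrable u γ := (Lp.memLp u).integrable (by norm_num)
  have hset : ∀ s, MeasurableSet s → Filter.Tendsto (fun n => ∫ y in s, ψ (φ n) y ∂γ) Filter.atTop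
      (nhds (∫ y in s, u y ∂γ)) := fun s hs => by
    have h := hinner (s.indicator fun _ => 1)
      (memLp_indicator_const 2 hs 1 (.inr (measure_ne_top _ _)))
    have e : ∀ f : ℝ → ℝ, ∫ y, f y * s.indicator (fun _ => 1) y ∂γ = ∫ y in s, f y ∂γ := fun f => by
      rw [← integral_indicator hs]
      congr 1
      ext y
      by_cases hy : y ∈ s <;> simp [hy]
    simpa only [e] using h
  have h0 : 0 ≤ᵐ[γ] u := ae_nonneg_of_forall_setIntegral_nonneg hui fun s hs _ =>
    ge_of_tendsto' (hset s hs) fun n => (hψ (φ n)).integral_nonneg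
  have h1 : u ≤ᵐ[γ] fun _ => 1 :=
    ae_le_of_forall_setIntegral_le hui (integrable_const _) fun s hs _ =>
    le_of_tendsto' (hset s hs) fun n =>
      integral_mono (hψ (φ n)).integrable.integrableOn (integrable_const _) (hψ (φ n)).le_one
  -- The limit lies in the unit interval only almost everywhere; truncation makes this hold
  -- everywhere without changing integrals.
  refine ⟨φ, hφ, fun y => max 0 (min 1 (u y)), ⟨?_, fun y => le_max_left _ _, fun y => ?_⟩,
    fun g hg => ?_⟩
  · exact measurable_const.max (measurable_const.min (Lp.stronglyMeasurable u).measurable)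
  · exact max_le zero_le_one (min_le_left _ _)
  · convert hinner g hg using 2
    refine integral_congr_ae ?_
    filter_upwards [h0, h1] with y hy0 hy1
    simp only [Pi.zero_apply] at hy0
    rw [min_eq_right hy1, max_eq_right hy0]

lemma memLp_two_exp (x : ℝ) :
    MemLp (fun y => Real.exp (x * y - x ^ 2 / 2)) 2 (gaussianReal 0 1) := by
  rw [memLp_two_iff_integrable_sq (by fun_prop)]
  have h := (integrable_exp_mul_gaussianReal (μ := 0) (v := 1) (2 * x)).const_mul
    (Real.exp (-x ^ 2))
  refine h.congr (ae_of_all _ fun y => ?_)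
  simp only
  rw [← Real.exp_add, ← Real.exp_nat_mul]
  congr 1
  push_cast
  ring

/-- A sequence of soft tests has a subsequence along which the responses converge pointwise to the
response of a soft test. -/
lemma exists_subseq_tendsto_resp {ψ : ℕ → ℝ → ℝ} (hψ : ∀ n, IsSoftTest (ψ n)) :
    ∃ φ : ℕ → ℕ, StrictMono φ ∧ ∃ χ, IsSoftTest χ ∧ ∀ x,
      Filter.Tendsto (fun n => resp (ψ (φ n)) x) Filter.atTop (nhds (resp χ x)) := by
  obtain ⟨φ, hφ, χ, hχ, h⟩ := exists_subseq_tendsto_integral_mul (gaussianReal 0 1) hψ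
  refine ⟨φ, hφ, χ, hχ, fun x => ?_⟩
  simpa only [resp_eq_integral_exp] using h _ (memLp_two_exp x)

lemma equicontinuous_resp {ι : Type*} {ψ : ι → ℝ → ℝ} (hψ : ∀ n, IsSoftTest (ψ n)) :
    Equicontinuous fun n => resp (ψ n) := fun x => by
  refine Metric.equicontinuousAt_of_continuity_modulus
    (fun x' => √(Real.exp (x ^ 2) + Real.exp (x' ^ 2) - 2 * Real.exp (x * x'))) ?_ _
    (Filter.Eventually.of_forall fun x' n => ?_)
  · have : Continuous fun x' =>
        √(Real.exp (x ^ 2) + Real.exp (x' ^ 2) - 2 * Real.exp (x * x')) := by fun_prop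
    convert this.tendsto x using 2
    rw [sq, ← two_mul, sub_self, Real.sqrt_zero]
  · rw [Real.dist_eq]
    exact Real.abs_le_sqrt ((hψ n).sq_resp_sub_le x x')

/-- Uniform continuity carries equicontinuity of responses over to their entropies. Only values on
the unit interval matter, so the function is extended by constants. -/
lemma exists_uniformContinuous_eq_binEntropy :
    ∃ H : ℝ → ℝ, UniformContinuous H ∧ ∀ p, 0 ≤ p → p ≤ 1 → H p = Real.binEntropy p := by
  refine ⟨fun p => Set.IccExtend (zero_le_one (α := ℝ))
    (fun p : Set.Icc (0 : ℝ) 1 => Real.binEntropy p) p, ?_, fun p h0 h1 => ?_⟩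
  · exact (CompactSpace.uniformContinuous_of_continuous
      (Real.binEntropy_continuous.comp continuous_subtype_val)).comp
      (LipschitzWith.projIcc zero_le_one).uniformContinuous
  · exact Set.IccExtend_of_mem _ _ ⟨h0, h1⟩

/-- Convergence of integrals when both the measures and the integrands vary. -/
lemma tendsto_integral_of_equicontinuous {F : ℕ → ℝ → ℝ} {f : ℝ → ℝ} (hF : Equicontinuous F)
    {M : ℝ} (hM : ∀ n x, |F n x| ≤ M)
    (hpt : ∀ x, Filter.Tendsto (fun n => F n x) Filter.atTop (nhds (f x)))
    {μ : ℕ → ProbabilityMeasure ℝ} {ν : ProbabilityMeasure ℝ}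
    (hμ : Filter.Tendsto μ Filter.atTop (nhds ν)) {P : ℝ}
    (hP : ∀ n, IsAdmissibleInput P (μ n : Measure ℝ)) (hP0 : 0 ≤ P) :
    Filter.Tendsto (fun n => ∫ x, F n x ∂(μ n : Measure ℝ)) Filter.atTop
      (nhds (∫ x, f x ∂(ν : Measure ℝ))) := by
  have hM0 : 0 ≤ M := (abs_nonneg _).trans (hM 0 0)
  have hfM : ∀ x, |f x| ≤ M := fun x => le_of_tendsto' (hpt x).abs fun n => hM n x
  have hfc : Continuous f :=
    Filter.Tendsto.continuous_of_equicontinuous (tendsto_pi_nhds.2 hpt) hF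
  -- For an equicontinuous sequence, pointwise convergence is uniform on compact sets.
  have hunif : ∀ K : Set ℝ, IsCompact K → TendstoUniformlyOn F f Filter.atTop K := fun K hK => by
    have h := (EquicontinuousOn.tendsto_uniformOnFun_iff_pi' (𝔖 := {K}) (F := F)
      (by simpa using hK) (fun K _ => hF.equicontinuousOn K) Filter.atTop f).2
      (tendsto_pi_nhds.2 fun x => hpt x)
    exact (UniformOnFun.tendsto_iff_tendstoUniformlyOn.1 h) K rfl
  have hfix : Filter.Tendsto (fun n => ∫ x, f x ∂(μ n : Measure ℝ)) Filter.atTop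
      (nhds (∫ x, f x ∂(ν : Measure ℝ))) :=
    (ProbabilityMeasure.tendsto_iff_forall_integral_tendsto.1 hμ)
      (BoundedContinuousFunction.ofNormedAddCommGroup f hfc M hfM)
  have hdiff : Filter.Tendsto (fun n => ∫ x, F n x ∂(μ n : Measure ℝ) - ∫ x, f x ∂(μ n : Measure ℝ))
      Filter.atTop (nhds 0) := by
    rw [Metric.tendsto_atTop']
    intro ε hε
    -- Beyond radius `R` the difference is at most `2 * M ≤ 2 * M / R ^ 2 * x ^ 2`, so the power
    -- bound controls the tails uniformly in `n`.
    obtain ⟨R, hR, hRε⟩ : ∃ R : ℝ, 0 < R ∧ 2 * M / R ^ 2 * P < ε / 2 := by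
      refine ⟨1 + 4 * M * P / ε, by positivity, ?_⟩
      rw [div_mul_eq_mul_div, div_lt_iff₀ (by positivity)]
      have : ε / 2 * (1 + 4 * M * P / ε) ^ 2 =
          ε / 2 + 4 * M * P + ε / 2 * (4 * M * P / ε) ^ 2 := by
        field_simp
        ring
      rw [this]
      have h1 : 0 ≤ M * P := by positivity
      have h2 : 0 ≤ ε / 2 * (4 * M * P / ε) ^ 2 := by positivity
      linarith
    obtain ⟨N, hN⟩ := Filter.eventually_atTop.1
      (Metric.tendstoUniformlyOn_iff.1 (hunif _ (isCompact_closedBall (0 : ℝ) R)) (ε / 2)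
        (half_pos hε))
    refine ⟨N, fun n hn => ?_⟩
    have i1 : Integrable (F n) (μ n : Measure ℝ) := Integrable.of_bound
      (hF.continuous n).aestronglyMeasurable M (ae_of_all _ (hM n))
    have i2 : Integrable f (μ n : Measure ℝ) := Integrable.of_bound
      hfc.aestronglyMeasurable M (ae_of_all _ hfM)
    have i3 := (hP n).integrable_sq.const_mul (2 * M / R ^ 2)
    have hb : ∀ x, |F n x - f x| ≤ ε / 2 + 2 * M / R ^ 2 * x ^ 2 := fun x => by
      by_cases hx : x ∈ Metric.closedBall (0 : ℝ) R
      · have h1 := hN n hn.le x hx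
        rw [dist_comm, Real.dist_eq] at h1
        have : 0 ≤ 2 * M / R ^ 2 * x ^ 2 := by positivity
        linarith
      · rw [mem_closedBall_zero_iff, not_le, Real.norm_eq_abs] at hx
        have h1 : R ^ 2 ≤ x ^ 2 := by
          rw [← sq_abs x]
          exact pow_le_pow_left₀ hR.le hx.le 2
        have h2 : 2 * M ≤ 2 * M / R ^ 2 * x ^ 2 := by
          rw [div_mul_eq_mul_div, le_div_iff₀ (by positivity)]
          exact mul_le_mul_of_nonneg_left h1 (by positivity)
        have h3 := abs_sub (F n x) (f x)
        linarith [hM n x, hfM x]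
    rw [Real.dist_eq, sub_zero, ← integral_sub i1 i2]
    calc |∫ x, (F n x - f x) ∂(μ n : Measure ℝ)|
        ≤ ∫ x, |F n x - f x| ∂(μ n : Measure ℝ) := abs_integral_le_integral_abs
      _ ≤ ∫ x, (ε / 2 + 2 * M / R ^ 2 * x ^ 2) ∂(μ n : Measure ℝ) :=
          integral_mono (i1.sub i2).abs ((integrable_const _).add i3) hb
      _ = ε / 2 + 2 * M / R ^ 2 * ∫ x, x ^ 2 ∂(μ n : Measure ℝ) := by
          rw [integral_add (integrable_const _) i3, integral_const_mul]
          simp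
      _ ≤ ε / 2 + 2 * M / R ^ 2 * P := by
          gcongr
          exact (hP n).integral_sq_le hP0
      _ < ε := by linarith
  simpa using hdiff.add hfix

lemma tendsto_info {ψ : ℕ → ℝ → ℝ} (hψ : ∀ n, IsSoftTest (ψ n)) {χ : ℝ → ℝ} (hχ : IsSoftTest χ)
    (hpt : ∀ x, Filter.Tendsto (fun n => resp (ψ n) x) Filter.atTop (nhds (resp χ x)))
    {μ : ℕ → ProbabilityMeasure ℝ} {ν : ProbabilityMeasure ℝ}
    (hμ : Filter.Tendsto μ Filter.atTop (nhds ν)) {P : ℝ}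
    (hP : ∀ n, IsAdmissibleInput P (μ n : Measure ℝ)) (hP0 : 0 ≤ P) :
    Filter.Tendsto (fun n => info (μ n) (resp (ψ n))) Filter.atTop (nhds (info ν (resp χ))) := by
  obtain ⟨H, hH, hHe⟩ := exists_uniformContinuous_eq_binEntropy
  have e : ∀ {φ : ℝ → ℝ}, IsSoftTest φ → ∀ x, H (resp φ x) = Real.binEntropy (resp φ x) :=
    fun hφ x => hHe _ (hφ.resp_nonneg x) (hφ.resp_le_one x)
  have h1 := tendsto_integral_of_equicontinuous (equicontinuous_resp hψ) (M := 1)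
    (fun n x => by rw [abs_of_nonneg ((hψ n).resp_nonneg x)]; exact (hψ n).resp_le_one x)
    hpt hμ hP hP0
  have h2 := tendsto_integral_of_equicontinuous (F := fun n x => H (resp (ψ n) x))
    (f := fun x => H (resp χ x)) (fun x _ hU => equicontinuous_resp hψ x _ (hH hU))
    (M := Real.log 2)
    (fun n x => by
      rw [e (hψ n), abs_of_nonneg (Real.binEntropy_nonneg ((hψ n).resp_nonneg x)
        ((hψ n).resp_le_one x))]
      exact Real.binEntropy_le_log_two)
    (fun x => (hH.continuous.tendsto _).comp (hpt x)) hμ hP hP0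
  simp only [e hχ, e (hψ _)] at h2
  exact ((Real.binEntropy_continuous.tendsto _).comp h1).sub h2

lemma isTightMeasureSet_isAdmissibleInput (P : ℝ) :
    IsTightMeasureSet {μ | IsAdmissibleInput P μ} := by
  rw [isTightMeasureSet_iff_exists_isCompact_measure_compl_le]
  intro ε hε
  obtain ⟨R, hR, hRε⟩ : ∃ R : ℝ, 0 < R ∧ ENNReal.ofReal P / ENNReal.ofReal (R ^ 2) ≤ ε := by
    have h : Filter.Tendsto (fun R : ℝ => ENNReal.ofReal P / ENNReal.ofReal (R ^ 2)) Filter.atTop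
        (nhds 0) := ENNReal.Tendsto.const_div
      (ENNReal.tendsto_ofReal_atTop.comp (Filter.tendsto_pow_atTop two_ne_zero))
      (.inr ENNReal.ofReal_ne_top) |>.trans (by simp)
    obtain ⟨R, h1, h2⟩ := ((h.eventually (ge_mem_nhds hε)).and (Filter.eventually_gt_atTop 0)).exists
    exact ⟨R, h2, h1⟩
  refine ⟨Metric.closedBall 0 R, isCompact_closedBall _ _, fun μ hμ => ?_⟩
  have h0 : ENNReal.ofReal (R ^ 2) ≠ 0 := by
    rw [Ne, ENNReal.ofReal_eq_zero, not_le]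
    positivity
  calc μ (Metric.closedBall 0 R)ᶜ ≤ μ {x | ENNReal.ofReal (R ^ 2) ≤ ENNReal.ofReal (x ^ 2)} := by
        refine measure_mono fun x hx => ENNReal.ofReal_le_ofReal ?_
        rw [Set.mem_compl_iff, mem_closedBall_zero_iff, not_le, Real.norm_eq_abs] at hx
        rw [← sq_abs x]
        exact pow_le_pow_left₀ hR.le hx.le 2
    _ ≤ (∫⁻ x, ENNReal.ofReal (x ^ 2) ∂μ) / ENNReal.ofReal (R ^ 2) :=
        meas_ge_le_lintegral_div (by fun_prop) h0 ENNReal.ofReal_ne_top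
    _ ≤ ENNReal.ofReal P / ENNReal.ofReal (R ^ 2) := ENNReal.div_le_div_right hμ.power_le _
    _ ≤ ε := hRε

/-- Tightness, by Markov's inequality, gives a weakly convergent subsequence. The limit is
admissible because the second moment is lower semicontinuous, by the open-set form of weak
convergence. -/
lemma exists_subseq_tendsto_admissible {P : ℝ} {μ : ℕ → ProbabilityMeasure ℝ}
    (hμ : ∀ n, IsAdmissibleInput P (μ n : Measure ℝ)) :
    ∃ φ : ℕ → ℕ, StrictMono φ ∧ ∃ ν : ProbabilityMeasure ℝ, IsAdmissibleInput P (ν : Measure ℝ) ∧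
      Filter.Tendsto (μ ∘ φ) Filter.atTop (nhds ν) := by
  have hc := isCompact_closure_of_isTightMeasureSet
    (S := {ν : ProbabilityMeasure ℝ | IsAdmissibleInput P (ν : Measure ℝ)})
    ((isTightMeasureSet_isAdmissibleInput P).subset (by rintro _ ⟨ν, hν, rfl⟩; exact hν))
  obtain ⟨ν, -, φ, hφ, hν⟩ := hc.tendsto_subseq fun n => subset_closure (hμ n)
  refine ⟨φ, hφ, ν, ⟨inferInstance, ?_⟩, hν⟩
  refine (lintegral_le_liminf_lintegral_of_forall_isOpen_measure_le_liminf_measure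
    (μs := fun n => (μ (φ n) : Measure ℝ)) (f := fun x => x ^ 2) (by fun_prop)
    (fun x => sq_nonneg x) fun G hG =>
      ProbabilityMeasure.le_liminf_measure_open_of_tendsto hν hG).trans ?_
  exact Filter.liminf_le_of_le (by isBoundedDefault) fun b hb =>
    (hb.exists.choose_spec).trans (hμ _).power_le

lemma isAdmissibleInput_dirac_zero {P : ℝ} : IsAdmissibleInput P (Measure.dirac 0) where
  isProbabilityMeasure := inferInstance
  power_le := by simp

/-- An optimal pair exists. -/
lemma exists_isOpt {P : ℝ} (hP : 0 ≤ P) : ∃ μ D, IsOpt P μ D := by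
  set S : Set ℝ := {r | ∃ μ, IsAdmissibleInput P μ ∧ ∃ D, MeasurableSet D ∧
    info μ (resp (hard D)) = r} with hS
  have hbdd : BddAbove S := ⟨Real.log 2, by
    rintro _ ⟨μ, hμ, D, hD, rfl⟩
    exact (isSoftTest_hard hD).isSoftTest_resp.info_le_log_two⟩
  have hne : S.Nonempty := ⟨_, _, isAdmissibleInput_dirac_zero, ∅, MeasurableSet.empty, rfl⟩
  obtain ⟨u, -, hu, huS⟩ := exists_seq_tendsto_sSup hne hbdd
  choose μ hμ D hD hval using huS
  let m : ℕ → ProbabilityMeasure ℝ := fun n => ⟨μ n, (hμ n).isProbabilityMeasure⟩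
  obtain ⟨φ, hφ, ν, hν, hlim⟩ := exists_subseq_tendsto_admissible (μ := m) hμ
  obtain ⟨φ', hφ', χ, hχ, hpt⟩ := exists_subseq_tendsto_resp
    (ψ := fun n => hard (D (φ n))) fun n => isSoftTest_hard (hD _)
  have hinfo := tendsto_info (ψ := fun n => hard (D (φ (φ' n)))) (fun n => isSoftTest_hard (hD _))
    hχ hpt (hlim.comp hφ'.tendsto_atTop) (fun n => hμ _) hP
  have hsup : info ν (resp χ) = sSup S := by
    refine tendsto_nhds_unique hinfo ?_
    have := hu.comp (hφ.tendsto_atTop.comp hφ'.tendsto_atTop)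
    refine this.congr fun n => ?_
    exact (hval _).symm
  have hopt : ∀ {E}, MeasurableSet E → info ν (resp χ) ≤ info ν (resp (hard E)) → IsOpt P ν E :=
    fun hE h => ⟨hν, hE, fun μ' hμ' D' hD' =>
      (le_csSup hbdd ⟨μ', hμ', D', hD', rfl⟩).trans (hsup.symm.le.trans h)⟩
  -- The limiting test may be randomized. If its information is positive, the sign of the gradient
  -- gives a region at least as good; if it is zero, so is the supremum, and any region will do.
  rcases hχ.isSoftTest_resp.info_nonneg.eq_or_lt (a := 0) (b := info ν (resp χ)) with h0 | hpos
  · exact ⟨ν, ∅, hopt MeasurableSet.empty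
      (h0.symm.le.trans (isSoftTest_hard MeasurableSet.empty).isSoftTest_resp.info_nonneg)⟩
  · have hp := hχ.isProperTest_of_info_pos hpos
    exact ⟨ν, _, hopt (measurableSet_scoreConv_pos hp hν.integrable_sq)
      (info_le_info_hard hp hν.integrable_sq)⟩

/-! ### Reduction to unit noise variance -/

lemma IsAdmissibleInput.map_mul {P : ℝ} {μ : Measure ℝ} (h : IsAdmissibleInput P μ) (c : ℝ) :
    IsAdmissibleInput (c ^ 2 * P) (μ.map (c * ·)) where
  isProbabilityMeasure :=
    have := h.isProbabilityMeasure
    Measure.isProbabilityMeasure_map (by fun_prop)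
  power_le := by
    rw [lintegral_map (by fun_prop) (by fun_prop), ENNReal.ofReal_mul (sq_nonneg c)]
    simp only [mul_pow, ENNReal.ofReal_mul (sq_nonneg c)]
    rw [lintegral_const_mul _ (by fun_prop)]
    exact mul_le_mul_right h.power_le _

section Scaling

variable {σ : ℝ≥0} {P : ℝ} {μ : Measure ℝ} {D : Set ℝ}

lemma mutualInfo_jointLaw_eq_info_map (hσ : σ ≠ 0) (hD : MeasurableSet D)
    (hμ : IsAdmissibleInput P μ) :
    mutualInfo (jointLaw σ D μ) =
      ENNReal.ofReal (info (μ.map ((σ : ℝ)⁻¹ * ·)) (resp (hard {y | (σ : ℝ) * y ∈ D}))) := by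
  have := hμ.isProbabilityMeasure
  have hE : MeasurableSet {y : ℝ | (σ : ℝ) * y ∈ D} := (measurable_const_mul (σ : ℝ)) hD
  rw [mutualInfo_jointLaw σ hD, info_map (by fun_prop)
    (isSoftTest_hard hE).isSoftTest_resp.measurable]
  congr 2
  ext x
  rw [crossover_eq_resp hσ hD, div_eq_inv_mul]

lemma mutualInfo_jointLaw_map (hσ : σ ≠ 0) (hD : MeasurableSet D) (hμ : IsAdmissibleInput P μ) :
    mutualInfo (jointLaw σ {y | (σ : ℝ)⁻¹ * y ∈ D} (μ.map ((σ : ℝ) * ·))) =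
      ENNReal.ofReal (info μ (resp (hard D))) := by
  have h0 : (σ : ℝ) ≠ 0 := by exact_mod_cast hσ
  have hE : MeasurableSet {y : ℝ | (σ : ℝ)⁻¹ * y ∈ D} := (measurable_const_mul (σ : ℝ)⁻¹) hD
  rw [mutualInfo_jointLaw_eq_info_map hσ hE (hμ.map_mul σ),
    Measure.map_map (by fun_prop) (by fun_prop)]
  have e1 : ((σ : ℝ)⁻¹ * ·) ∘ ((σ : ℝ) * ·) = id := by
    ext x
    simp [h0]
  have e2 : {y | (σ : ℝ) * y ∈ {y | (σ : ℝ)⁻¹ * y ∈ D}} = D := by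
    ext y
    simp [h0]
  rw [e1, e2, Measure.map_id]

lemma mutualInfo_le_capacity (hD : MeasurableSet D) (hμ : IsAdmissibleInput P μ) :
    mutualInfo (jointLaw σ D μ) ≤ capacity σ P :=
  le_iSup₂_of_le D hD (le_iSup₂_of_le μ hμ le_rfl)

lemma IsOpt.isCapacityAchieving (hσ : σ ≠ 0) (h : IsOpt ((σ : ℝ)⁻¹ ^ 2 * P) μ D) :
    IsCapacityAchieving σ P (μ.map ((σ : ℝ) * ·)) := by
  have h0 : (σ : ℝ) ≠ 0 := by exact_mod_cast hσ
  have hadm := h.adm.map_mul σ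
  rw [← mul_assoc, ← mul_pow, mul_inv_cancel₀ h0, one_pow, one_mul] at hadm
  have hE : MeasurableSet {y : ℝ | (σ : ℝ)⁻¹ * y ∈ D} := (measurable_const_mul (σ : ℝ)⁻¹) h.meas
  refine ⟨hadm, _, hE, le_antisymm (mutualInfo_le_capacity hE hadm) ?_⟩
  refine iSup₂_le fun D' hD' => iSup₂_le fun μ' hμ' => ?_
  rw [mutualInfo_jointLaw_map hσ h.meas h.adm, mutualInfo_jointLaw_eq_info_map hσ hD' hμ']
  exact ENNReal.ofReal_le_ofReal (h.le _ (hμ'.map_mul _) _ ((measurable_const_mul (σ : ℝ)) hD'))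

lemma IsCapacityAchieving.exists_isOpt (hσ : σ ≠ 0) (h : IsCapacityAchieving σ P μ) :
    ∃ E, IsOpt ((σ : ℝ)⁻¹ ^ 2 * P) (μ.map ((σ : ℝ)⁻¹ * ·)) E := by
  have h0 : (σ : ℝ) ≠ 0 := by exact_mod_cast hσ
  obtain ⟨hμ, D, hD, hval⟩ := h
  have hE : MeasurableSet {y : ℝ | (σ : ℝ) * y ∈ D} := (measurable_const_mul (σ : ℝ)) hD
  have hadm := hμ.map_mul (σ : ℝ)⁻¹
  have := hadm.isProbabilityMeasure
  refine ⟨_, hadm, hE, fun μ' hμ' D' hD' => ?_⟩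
  have hadm' := hμ'.map_mul σ
  rw [← mul_assoc, ← mul_pow, mul_inv_cancel₀ h0, one_pow, one_mul] at hadm'
  have hle := mutualInfo_le_capacity (σ := σ) (D := {y | (σ : ℝ)⁻¹ * y ∈ D'})
    ((measurable_const_mul (σ : ℝ)⁻¹) hD') hadm'
  rw [mutualInfo_jointLaw_map hσ hD' hμ', ← hval, mutualInfo_jointLaw_eq_info_map hσ hD hμ] at hle
  exact (ENNReal.ofReal_le_ofReal_iff (isSoftTest_hard hE).isSoftTest_resp.info_nonneg).1 hle

lemma IsCapacityAchieving.exists_three_points (hσ : σ ≠ 0) (hP : 0 ≤ P)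
    (h : IsCapacityAchieving σ P μ) :
    ∃ p ξ : Fin 3 → ℝ, (∀ l, 0 ≤ p l ∧ p l ≤ 1) ∧ ∑ l, p l = 1 ∧
      μ = ∑ l, ENNReal.ofReal (p l) • Measure.dirac (ξ l) ∧
      ∑ l, p l * ξ l = 0 ∧ ∑ l, p l * ξ l ^ 2 = P := by
  have h0 : (σ : ℝ) ≠ 0 := by exact_mod_cast hσ
  have := h.1.isProbabilityMeasure
  rcases hP.eq_or_lt with rfl | hP
  -- At zero power the only admissible law is the point mass at zero; the optimality analysis, which
  -- needs positive power, is bypassed.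
  · have hsq : ∫ x, x ^ 2 ∂μ = 0 :=
      le_antisymm (h.1.integral_sq_le le_rfl) (integral_nonneg fun x => sq_nonneg x)
    have hae : ∀ᵐ x ∂μ, x = 0 := by
      filter_upwards [(integral_eq_zero_iff_of_nonneg (fun x => sq_nonneg x)
        h.1.integrable_sq).1 hsq] with x hx
      simpa using hx
    refine OneBitChannel.exists_three_points (S := {0}) (by simp) hae ?_ hsq
    rw [integral_congr_ae (g := fun _ => (0 : ℝ)) hae, integral_zero]
  · obtain ⟨E, hE⟩ := h.exists_isOpt hσ
    have hP' : 0 < (σ : ℝ)⁻¹ ^ 2 * P := by positivity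
    obtain ⟨S, hS, hmem⟩ := hE.exists_support hP'
    have hm := hE.integral_id hP'
    have hs := hE.integral_sq hP'
    rw [integral_map (by fun_prop) (by fun_prop)] at hm hs
    simp only [mul_pow] at hs
    rw [integral_const_mul] at hm hs
    refine OneBitChannel.exists_three_points (S := ((σ : ℝ) * ·) '' S)
      ((Set.encard_image_le _ _).trans hS) ?_ ((mul_eq_zero.1 hm).resolve_left (inv_ne_zero h0))
      (mul_left_cancel₀ (pow_ne_zero 2 (inv_ne_zero h0)) hs)
    filter_upwards [ae_of_ae_map (by fun_prop) hmem] with x hx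
    exact ⟨_, hx, mul_inv_cancel_left₀ h0 x⟩

end Scaling

end

end OneBitChannel

theorem proposition1 (σ : ℝ≥0) (hσ : 0 < σ) (P : ℝ) (hP : 0 ≤ P) :
    (∃ μ : Measure ℝ, OneBitChannel.IsCapacityAchieving σ P μ) ∧
      ∀ μ : Measure ℝ, OneBitChannel.IsCapacityAchieving σ P μ →
        ∃ p ξ : Fin 3 → ℝ,
          (∀ l, 0 ≤ p l ∧ p l ≤ 1) ∧ ∑ l, p l = 1 ∧
          μ = ∑ l, ENNReal.ofReal (p l) • Measure.dirac (ξ l) ∧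
          ∑ l, p l * ξ l = 0 ∧ ∑ l, p l * ξ l ^ 2 = P := by
  refine ⟨?_, fun μ hμ => hμ.exists_three_points hσ.ne' hP⟩
  obtain ⟨μ, D, h⟩ := OneBitChannel.exists_isOpt
    (mul_nonneg (sq_nonneg (σ : ℝ)⁻¹) hP)
  exact ⟨_, h.isCapacityAchieving hσ.ne'⟩
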